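/- Let $V:\mathbb R\to\mathbb R$ be continuous and periodic with period $d>0$, let $\Gamma_\pm,\mu\in\mathbb R$, put $\Gamma(x)=\Gamma_+$ for $x\ge 0$ and $\Gamma(x)=\Gamma_-$ for $x<0$, and let $\phi:\mathbb R\to\mathbb R$ be a $C^1$ function with $|\phi(x)|\le Ce^{-\alpha|x|}$ for some $C,\alpha>0$ that satisfies $\phi''+\mu\phi-V\phi+\Gamma\phi^3=0$ for all $x\neq 0$. For $\lambda\in\mathbb C$ with $\operatorname{Re}\lambda>0$ put $\mu_\pm=\mu\pm i\lambda$. Let $\psi_{1,2}^{\mu_\pm}(x)=p_{1,2}^{\mu_\pm}(x)e^{\pm' i k_{\pm}x}$ (with $\pm'=+$ for the index $1$ and $\pm'=-$ for the index $2$), where $\operatorname{Im}k_\pm>0$ and $p_{1,2}^{\mu_\pm}$ is $d$-periodic with $p_{1,2}^{\mu_\pm}(0)=1$, be the Bloch waves of Hill's equation $-\psi''+V\psi=\mu_\pm\psi$. Consider the first order system $$v'=Av,\qquad A=\begin{pmatrix}0&1&0&0\\ V-2\Gamma\phi^2-\mu_+&0&-\Gamma\phi^2&0\\ 0&0&0&1\\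 -\Gamma\phi^2&0&V-2\Gamma\phi^2-\mu_-&0\end{pmatrix}$$ (solutions are continuous on $\mathbb R$ and satisfy the equation for $x\ne0$), and let $v_1^\pm,v_2^\pm$ be solutions with $$v_1^-\sim(\psi_2^{\mu_+},(\psi_2^{\mu_+})',0,0)^T,\quad v_2^-\sim(0,0,\psi_2^{\mu_-},(\psi_2^{\mu_-})')^T\quad\text{as }x\to-\infty,$$ $$v_1^+\sim(\psi_1^{\mu_+},(\psi_1^{\mu_+})',0,0)^T,\quad v_2^+\sim(0,0,\psi_1^{\mu_-},(\psi_1^{\mu_-})')^T\quad\text{as }x\to+\infty,$$ where $v\sim w$ means $|v-w|=o(|w|)$. Fix $x_*\in\mathbb R$ and let $$\mathcal E(\lambda)=\det\big(v_1^-(x_*),v_2^-(x_*),v_1^+(x_*),v_2^+(x_*)\big),\qquad E(\lambda)=\frac{-1}{4\lambda+1}\,\mathcal E(\lambda).$$ Then for every $\lambda$ with $\operatorname{Re}\lambda>0$ such Bloch waves and solutions exist and $\mathcal E(\lambda)$ does not depend on their choice; $E$ is analytic in $\{\operatorname{Re}\lambda>0\}$; and, for every $\delta>0$, $\mathcal E(\lambda)\sim-4\lambda$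 and $E(\lambda)\to1$ as $|\lambda|\to\infty$ with $\operatorname{Re}\lambda\ge\delta$. In particular, $E(\lambda)\to 1$ as $|\lambda|\to\infty$ along every ray $\arg\lambda=\theta$, $\theta\in(-\pi/2,\pi/2)$, and uniformly in every closed sector $|\arg\lambda|\le\theta_0<\pi/2$. -/

import Mathlib

open Filter Topology Asymptotics

/-- The interface coefficient `Γ = Γ₊ χ_[0,∞) + Γ₋ χ_(-∞,0)`. -/
noncomputable def interfaceCoeff (Γp Γm : ℝ) (x : ℝ) : ℝ :=
  if 0 ≤ x then Γp else Γm

/-- `φ` is a real, exponentially localized `C¹` solution of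
`φ'' + μ φ - V φ + Γ φ³ = 0`. As `Γ` jumps at `0`, the second derivative is only
required away from `0`. -/
structure IsGapSoliton (V : ℝ → ℝ) (Γp Γm μ : ℝ) (φ : ℝ → ℝ) : Prop where
  contDiff : ContDiff ℝ 1 φ
  equation : ∀ x : ℝ, x ≠ 0 →
    HasDerivAt (deriv φ)
      (-(μ * φ x) + V x * φ x - interfaceCoeff Γp Γm x * φ x ^ 3) x
  localized : ∃ C α : ℝ, 0 < α ∧ ∀ x : ℝ, |φ x| ≤ C * Real.exp (-(α * |x|))

/-- `ψ(x) = p(x) exp(i k x)` is a Bloch wave of Hill's equation `-ψ'' + V ψ = μ ψ`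
with `d`-periodic part `p` normalized by `p(0) = 1`. -/
structure IsBlochWave (V : ℝ → ℝ) (d : ℝ) (μ k : ℂ) (ψ : ℝ → ℂ) : Prop where
  differentiable : Differentiable ℝ ψ
  hill : ∀ x : ℝ, HasDerivAt (deriv ψ) (((V x : ℂ) - μ) * ψ x) x
  bloch : ∃ p : ℝ → ℂ, Function.Periodic p d ∧ p 0 = 1 ∧
    ∀ x : ℝ, ψ x = p x * Complex.exp (Complex.I * k * (x : ℂ))

/-- `μ₊ = μ + i λ`. -/
noncomputable def muPlus (μ : ℝ) (lam : ℂ) : ℂ := (μ : ℂ) + Complex.I * lam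

/-- `μ₋ = μ - i λ`. -/
noncomputable def muMinus (μ : ℝ) (lam : ℂ) : ℂ := (μ : ℂ) - Complex.I * lam

/-- Coefficient matrix of the spectral problem `λ u = 𝕃 u`, written as a first order system
for `v = (u₁, u₁', u₂, u₂')`. -/
noncomputable def systemMatrix (V : ℝ → ℝ) (Γp Γm μ : ℝ) (φ : ℝ → ℝ) (lam : ℂ) (x : ℝ) :
    Matrix (Fin 4) (Fin 4) ℂ :=
  let G : ℂ := ((interfaceCoeff Γp Γm x * φ x ^ 2 : ℝ) : ℂ)
  !![0, 1, 0, 0;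
     (V x : ℂ) - 2 * G - muPlus μ lam, 0, -G, 0;
     0, 0, 0, 1;
     -G, 0, (V x : ℂ) - 2 * G - muMinus μ lam, 0]

/-- `v` solves `v' = A v` on `ℝ`: it is continuous, and differentiable away from the jump of
the coefficients at `0`. -/
def IsSystemSolution (V : ℝ → ℝ) (Γp Γm μ : ℝ) (φ : ℝ → ℝ) (lam : ℂ)
    (v : ℝ → Fin 4 → ℂ) : Prop :=
  Continuous v ∧ ∀ x : ℝ, x ≠ 0 →
    HasDerivAt v ((systemMatrix V Γp Γm μ φ lam x).mulVec (v x)) x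

/-- `z` is the value at `λ` of the Evans determinant
`det (v₁⁻(x⋆), v₂⁻(x⋆), v₁⁺(x⋆), v₂⁺(x⋆))`, where `v₁⁻, v₂⁻` (`v₁⁺, v₂⁺`) are solutions of the
first order system asymptotic at `-∞` (at `+∞`) to the normalized decaying Bloch waves of the
two uncoupled Hill equations. -/
def IsEvansValue (V : ℝ → ℝ) (d Γp Γm μ : ℝ) (φ : ℝ → ℝ) (xs : ℝ) (lam z : ℂ) : Prop :=
  ∃ (kp km : ℂ) (ψp₁ ψp₂ ψm₁ ψm₂ : ℝ → ℂ) (vm₁ vm₂ vp₁ vp₂ : ℝ → Fin 4 → ℂ),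
    0 < kp.im ∧ 0 < km.im ∧
    IsBlochWave V d (muPlus μ lam) kp ψp₁ ∧
    IsBlochWave V d (muPlus μ lam) (-kp) ψp₂ ∧
    IsBlochWave V d (muMinus μ lam) km ψm₁ ∧
    IsBlochWave V d (muMinus μ lam) (-km) ψm₂ ∧
    IsSystemSolution V Γp Γm μ φ lam vm₁ ∧
    IsSystemSolution V Γp Γm μ φ lam vm₂ ∧
    IsSystemSolution V Γp Γm μ φ lam vp₁ ∧
    IsSystemSolution V Γp Γm μ φ lam vp₂ ∧
    vm₁ ~[atBot] (fun x => ![ψp₂ x, deriv ψp₂ x, 0, 0]) ∧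
    vm₂ ~[atBot] (fun x => ![0, 0, ψm₂ x, deriv ψm₂ x]) ∧
    vp₁ ~[atTop] (fun x => ![ψp₁ x, deriv ψp₁ x, 0, 0]) ∧
    vp₂ ~[atTop] (fun x => ![0, 0, ψm₁ x, deriv ψm₁ x]) ∧
    z = (Matrix.of ![vm₁ xs, vm₂ xs, vp₁ xs, vp₂ xs]).transpose.det

/-- The Evans function `𝓔(λ)`, evaluated at the point `x⋆ = xs`. -/
noncomputable def evans (V : ℝ → ℝ) (d Γp Γm μ : ℝ) (φ : ℝ → ℝ) (xs : ℝ) (lam : ℂ) : ℂ :=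
  Classical.epsilon (IsEvansValue V d Γp Γm μ φ xs lam)

/-- The renormalized Evans function `E(λ) = -𝓔(λ) / (4 λ + 1)`. -/
noncomputable def renormEvans (V : ℝ → ℝ) (d Γp Γm μ : ℝ) (φ : ℝ → ℝ) (xs : ℝ) (lam : ℂ) : ℂ :=
  -1 / (4 * lam + 1) * evans V d Γp Γm μ φ xs lam

/-! For `Re λ > 0` the numbers `μ_±` are non-real. When `z` is non-real, the flux `Im (conj ψ · ψ')`
of a solution of Hill's equation has derivative `-Im z |ψ|²`, so no Floquet multiplier lies on the
unit circle (`IsHillSol.eq_zero_of_flux_eq`, `norm_mult_ne_one`). Hence each end has exactly one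
decaying solution with value `1` at `0`, the Wronskian `W` of the two is nonzero, and all these
objects are analytic in `z`. These Weyl solutions are the Bloch waves.

Variation of constants in the four Weyl modes `χ_i` turns the coupled system into `c_i' = ∑ N_il
(χ_l / χ_i) c_l`, where `N` is the diagonal Green function times the exponentially localized `q = Γ
φ²`. The solutions `v₁⁺, v₂⁺` need not be unique, since the faster decaying one can be added to the
slower one, and which is faster may change with `λ`. The determinant, however, only sees the planes
they span. The Plücker coordinates of the plane at `+∞`, normalized by the growth of `χ₀ χ₁`, solve
a Volterra equation integrated from `+∞`. Its kernel is at most a constant times `exp (-β t)`,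
because up to a constant no coordinate plane decays faster than that of the two decaying modes. The
Neumann series gives the unique solution (`ModeBound.wedge_eq_planeSol`): the determinant is
independent of choices (`det_eq_coupledEvans`) and analytic in `λ`. Existence of the individual
solutions is a Levinson argument at fixed `λ` (`ModeBound.exists_asymptotic`), and `-∞` is reduced
to `+∞` by reflection.

The determinant equals `-W₊ W₋` times a Laplace pairing of the Plücker coordinates of the two
planes. With `k_±² = μ_±` and `Im k_± > 0`, at high energy `W_± ~ -2 i k_±` and the Green function
is `O(1/|k_±|)` (`exists_hillBound_large`). So the coupling disappears, the pairing tends to `1`,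
and the determinant is asymptotic to `4 k₊ k₋ ~ -4 λ`. The delicate point is that `Re λ ≥ δ` only
forces `Im k` to be of order `δ/|k|`, the same order as the first correction `V/(2ik)`. But the mean
of `V` is real, so to first order it only rotates the phase, and the oscillating part is small by a
Riemann-Lebesgue lemma (`norm_resonance_ge`, `IsHillSol.leftPart_le`). -/

/-! ### Linear integral equations: Neumann series, uniqueness, analytic dependence on a parameter.
-/

section IntegralEquation

open MeasureTheory

variable {ι : Type*} [Fintype ι]

/-- A dominated integral of holomorphic functions is holomorphic. -/
theorem differentiableOn_integral_of_dominated {U : Set ℂ} (hU : IsOpen U) {F : ℂ → ℝ → ℂ}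
    {b : ℝ → ℝ} (hmeas : ∀ z ∈ U, AEStronglyMeasurable (F z))
    (hdiff : ∀ t, DifferentiableOn ℂ (fun z => F z t) U)
    (hb : ∀ z ∈ U, ∀ t, ‖F z t‖ ≤ b t) (hintg : Integrable b) :
    DifferentiableOn ℂ (fun z => ∫ t, F z t) U := by
  intro z hz
  obtain ⟨r, hr, hball⟩ := Metric.isOpen_iff.1 hU z hz
  have hsub : ∀ w ∈ Metric.ball z (r / 2), Metric.closedBall w (r / 4) ⊆ U := by
    intro w hw y hy
    apply hball
    rw [Metric.mem_ball] at hw ⊢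
    rw [Metric.mem_closedBall] at hy
    linarith [dist_triangle y w z]
  have hmem : ∀ w ∈ Metric.ball z (r / 2), w ∈ U := fun w hw =>
    hsub w hw (Metric.mem_closedBall_self (by positivity))
  have hat : ∀ w ∈ Metric.ball z (r / 2), ∀ t, DifferentiableAt ℂ (fun z => F z t) w :=
    fun w hw t => (hdiff t).differentiableAt (hU.mem_nhds (hmem w hw))
  -- Cauchy's estimate on circles of radius `r / 4` bounds the derivative by the bound on `F`
  -- itself.
  have hderiv : ∀ t, ∀ w ∈ Metric.ball z (r / 2),
      ‖deriv (fun z => F z t) w‖ ≤ b t / (r / 4) := by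
    intro t w hw
    refine Complex.norm_deriv_le_of_forall_mem_sphere_norm_le (by positivity) ?_ ?_
    · refine DifferentiableOn.diffContOnCl ((hdiff t).mono ?_)
      rw [closure_ball _ (by positivity)]
      exact hsub w hw
    · intro y hy
      exact hb y (hsub w hw (Metric.sphere_subset_closedBall hy)) t
  have hz' : z ∈ Metric.ball z (r / 2) := Metric.mem_ball_self (by positivity)
  -- The derivative is measurable in `t` as a pointwise limit of difference quotients along `z +
  -- 1/(n+1)`; dropping the first `n₀` terms keeps these points in `U`.
  have hFmeas : AEStronglyMeasurable (fun t => deriv (fun z => F z t) z) := by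
    have hseq : Tendsto (fun n : ℕ => z + ((1 / ((n : ℝ) + 1) : ℝ) : ℂ)) atTop (𝓝[≠] z) := by
      rw [tendsto_nhdsWithin_iff]
      constructor
      · have := tendsto_one_div_add_atTop_nhds_zero_nat (𝕜 := ℝ)
        have h2 : Tendsto (fun n : ℕ => z + ((1 / ((n : ℝ) + 1) : ℝ) : ℂ)) atTop
            (𝓝 (z + ((0 : ℝ) : ℂ))) :=
          tendsto_const_nhds.add ((Complex.continuous_ofReal.tendsto 0).comp this)
        simpa using h2
      · refine Eventually.of_forall fun n => ?_
        simp only [Set.mem_compl_iff, Set.mem_singleton_iff, add_eq_left]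
        exact_mod_cast (by positivity : (1 / ((n : ℝ) + 1)) ≠ 0)
    have hev : ∀ᶠ n : ℕ in atTop, z + ((1 / ((n : ℝ) + 1) : ℝ) : ℂ) ∈ U :=
      (tendsto_nhdsWithin_iff.1 hseq).1 (hU.mem_nhds hz)
    obtain ⟨n₀, hn₀⟩ := eventually_atTop.1 hev
    have hseq' := hseq.comp (tendsto_add_atTop_nat n₀)
    refine aestronglyMeasurable_of_tendsto_ae atTop
      (f := fun n t => slope (fun z => F z t) z (z + ((1 / (((n + n₀ : ℕ) : ℝ) + 1) : ℝ) : ℂ)))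
      (fun n => ?_) (Eventually.of_forall fun t => ?_)
    · simp only [slope_def_module]
      exact AEStronglyMeasurable.const_smul (𝕜 := ℂ)
        ((hmeas _ (hn₀ _ (Nat.le_add_left _ _))).sub (hmeas z hz)) _
    · exact (hasDerivAt_iff_tendsto_slope.1 (hat z hz' t).hasDerivAt).comp hseq'
  have := hasDerivAt_integral_of_dominated_loc_of_deriv_le (𝕜 := ℂ) (μ := volume) (F := F)
    (F' := fun w t => deriv (fun z => F z t) w) (bound := fun t => b t / (r / 4))
    (Metric.ball_mem_nhds z (by positivity : 0 < r / 2))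
    (Filter.eventually_of_mem (hU.mem_nhds hz) hmeas)
    (hintg.mono' (hmeas z hz) (Eventually.of_forall (hb z hz))) hFmeas
    (Eventually.of_forall hderiv) (hintg.div_const _)
    (Eventually.of_forall fun t w hw => (hat w hw t).hasDerivAt)
  exact this.2.differentiableAt.differentiableWithinAt

/-- The kernel bound `kb` acts as a contraction on functions dominated by the weight `ω`. -/
structure ContractiveBound (ι : Type*) [Fintype ι] (kb : ℝ → ℝ → ℝ) (ω : ℝ → ℝ) : Prop where
  nonneg : ∀ x, 0 ≤ ω x
  integrable : ∀ x, Integrable (fun t => kb x t * ω t)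
  le : ∀ x, Fintype.card ι * ∫ t, kb x t * ω t ≤ ω x / 2

/-- The terms of the Neumann series of `f = f₀ + ∑ⱼ ∫ kᵢⱼ fⱼ`. -/
noncomputable def picardTerm (k : ℝ → ℝ → ι → ι → ℂ) (f₀ : ℝ → ι → ℂ) : ℕ → ℝ → ι → ℂ
  | 0 => f₀
  | n + 1 => fun x i => ∑ j, ∫ t, k x t i j * picardTerm k f₀ n t j

/-- The sum of the Neumann series of `f = f₀ + ∑ⱼ ∫ kᵢⱼ fⱼ`. -/
noncomputable def integralSol (k : ℝ → ℝ → ι → ι → ℂ) (f₀ : ℝ → ι → ℂ) (x : ℝ) (i : ι) : ℂ :=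
  ∑' n, picardTerm k f₀ n x i

variable {k : ℝ → ℝ → ι → ι → ℂ} {f₀ : ℝ → ι → ℂ} {kb : ℝ → ℝ → ℝ} {ω : ℝ → ℝ}

theorem measurable_kernel_section {ι : Type*} {k : ℝ → ℝ → ι → ι → ℂ}
    (hk : ∀ i j, Measurable (fun p : ℝ × ℝ => k p.1 p.2 i j))
    (x : ℝ) (i j : ι) : Measurable (fun t => k x t i j) :=
  (hk i j).comp measurable_prodMk_left

theorem norm_sum_integral_le (hB : ContractiveBound ι kb ω)
    (hkb : ∀ x t i j, ‖k x t i j‖ ≤ kb x t) {f : ℝ → ι → ℂ} {C : ℝ}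
    (hf : ∀ x i, ‖f x i‖ ≤ C * ω x) (x : ℝ) (i : ι) :
    ‖∑ j, ∫ t, k x t i j * f t j‖ ≤ C * (ω x / 2) := by
  calc ‖∑ j, ∫ t, k x t i j * f t j‖ ≤ ∑ j, ‖∫ t, k x t i j * f t j‖ := norm_sum_le _ _
    _ ≤ ∑ _j : ι, C * ∫ t, kb x t * ω t := by
        refine Finset.sum_le_sum fun j _ => ?_
        rw [← integral_const_mul]
        refine norm_integral_le_of_norm_le ((hB.integrable x).const_mul C)
          (Eventually.of_forall fun t => ?_)
        rw [norm_mul]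
        calc ‖k x t i j‖ * ‖f t j‖ ≤ kb x t * (C * ω t) :=
              mul_le_mul (hkb x t i j) (hf t j) (norm_nonneg _)
                ((norm_nonneg _).trans (hkb x t i j))
          _ = C * (kb x t * ω t) := by ring
    _ = C * (Fintype.card ι * ∫ t, kb x t * ω t) := by
        rw [Finset.sum_const, nsmul_eq_mul, Finset.card_univ]; ring
    _ ≤ C * (ω x / 2) := by
        by_cases h : 0 ≤ C
        · exact mul_le_mul_of_nonneg_left (hB.le x) h
        -- The sign of `C` is not assumed; a negative `C` forces `ω` to vanish, and then both sides
        -- are zero.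
        · have hω : ∀ t, ω t = 0 := fun t => le_antisymm (by
            have := (norm_nonneg _).trans (hf t i)
            by_contra hpos
            push Not at hpos h
            nlinarith) (hB.nonneg t)
          simp [hω]

theorem integrable_kernel_mul (hB : ContractiveBound ι kb ω)
    (hk : ∀ i j, Measurable (fun p : ℝ × ℝ => k p.1 p.2 i j))
    (hkb : ∀ x t i j, ‖k x t i j‖ ≤ kb x t) {f : ℝ → ι → ℂ} {C : ℝ}
    (hfm : ∀ i, Measurable (fun x => f x i)) (hf : ∀ x i, ‖f x i‖ ≤ C * ω x) (x : ℝ) (i j : ι) :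
    Integrable (fun t => k x t i j * f t j) := by
  refine ((hB.integrable x).const_mul C).mono'
    ((measurable_kernel_section hk x i j).mul (hfm j)).aestronglyMeasurable
    (Eventually.of_forall fun t => ?_)
  rw [norm_mul]
  calc ‖k x t i j‖ * ‖f t j‖ ≤ kb x t * (C * ω t) :=
        mul_le_mul (hkb x t i j) (hf t j) (norm_nonneg _)
          ((norm_nonneg _).trans (hkb x t i j))
    _ = C * (kb x t * ω t) := by ring

theorem measurable_picardTerm (hk : ∀ i j, Measurable (fun p : ℝ × ℝ => k p.1 p.2 i j))
    (hf₀ : ∀ i, Measurable (fun x => f₀ x i)) (n : ℕ) :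
    ∀ i, Measurable (fun x => picardTerm k f₀ n x i) := by
  induction n with
  | zero => exact hf₀
  | succ n ih =>
    intro i
    simp only [picardTerm]
    refine Finset.measurable_sum _ fun j _ => ?_
    have : StronglyMeasurable (fun p : ℝ × ℝ => k p.1 p.2 i j * picardTerm k f₀ n p.2 j) :=
      ((hk i j).mul ((ih j).comp measurable_snd)).stronglyMeasurable
    exact this.integral_prod_right.measurable

/-- Each application of the kernel halves a bound by a multiple of `ω`. The contraction comes from
the choice of weight, so the kernel need not be small. -/
theorem norm_picardTerm_le (hB : ContractiveBound ι kb ω)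
    (hkb : ∀ x t i j, ‖k x t i j‖ ≤ kb x t) (hb : ∀ x i, ‖f₀ x i‖ ≤ ω x) (n : ℕ) :
    ∀ x i, ‖picardTerm k f₀ n x i‖ ≤ (1 / 2) ^ n * ω x := by
  induction n with
  | zero => simpa [picardTerm] using hb
  | succ n ih =>
    intro x i
    refine (norm_sum_integral_le hB hkb ih x i).trans (le_of_eq ?_)
    rw [pow_succ]; ring

theorem summable_picardTerm (hB : ContractiveBound ι kb ω)
    (hkb : ∀ x t i j, ‖k x t i j‖ ≤ kb x t) (hb : ∀ x i, ‖f₀ x i‖ ≤ ω x) (x : ℝ) (i : ι) :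
    Summable (fun n => picardTerm k f₀ n x i) :=
  Summable.of_norm_bounded (summable_geometric_two.mul_right (ω x))
    fun n => norm_picardTerm_le hB hkb hb n x i

theorem norm_integralSol_le (hB : ContractiveBound ι kb ω)
    (hkb : ∀ x t i j, ‖k x t i j‖ ≤ kb x t) (hb : ∀ x i, ‖f₀ x i‖ ≤ ω x) (x : ℝ) (i : ι) :
    ‖integralSol k f₀ x i‖ ≤ 2 * ω x :=
  tsum_of_norm_bounded (hasSum_geometric_two.mul_right (ω x))
    fun n => norm_picardTerm_le hB hkb hb n x i

theorem measurable_integralSol (hB : ContractiveBound ι kb ω)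
    (hk : ∀ i j, Measurable (fun p : ℝ × ℝ => k p.1 p.2 i j))
    (hkb : ∀ x t i j, ‖k x t i j‖ ≤ kb x t) (hf₀ : ∀ i, Measurable (fun x => f₀ x i))
    (hb : ∀ x i, ‖f₀ x i‖ ≤ ω x) (i : ι) :
    Measurable (fun x => integralSol k f₀ x i) := by
  refine measurable_of_tendsto_metrizable
    (f := fun N x => ∑ n ∈ Finset.range N, picardTerm k f₀ n x i)
    (fun N => Finset.measurable_sum _ fun n _ => measurable_picardTerm hk hf₀ n i) ?_
  rw [tendsto_pi_nhds]
  intro x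
  exact (summable_picardTerm hB hkb hb x i).hasSum.tendsto_sum_nat

theorem integralSol_eq (hB : ContractiveBound ι kb ω)
    (hk : ∀ i j, Measurable (fun p : ℝ × ℝ => k p.1 p.2 i j))
    (hkb : ∀ x t i j, ‖k x t i j‖ ≤ kb x t) (hf₀ : ∀ i, Measurable (fun x => f₀ x i))
    (hb : ∀ x i, ‖f₀ x i‖ ≤ ω x) (x : ℝ) (i : ι) :
    integralSol k f₀ x i = f₀ x i + ∑ j, ∫ t, k x t i j * integralSol k f₀ t j := by
  have hs := summable_picardTerm hB hkb hb
  have hintg : ∀ j, HasSum (fun n => ∫ t, k x t i j * picardTerm k f₀ n t j)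
      (∫ t, k x t i j * integralSol k f₀ t j) := by
    intro j
    refine hasSum_integral_of_dominated_convergence
      (fun n t => (1 / 2 : ℝ) ^ n * (kb x t * ω t)) (fun n => ?_) (fun n => ?_) ?_ ?_ ?_
    · exact ((measurable_kernel_section hk x i j).mul
        (measurable_picardTerm hk hf₀ n j)).aestronglyMeasurable
    · refine Eventually.of_forall fun t => ?_
      rw [norm_mul]
      calc ‖k x t i j‖ * ‖picardTerm k f₀ n t j‖ ≤ kb x t * ((1 / 2) ^ n * ω t) :=
            mul_le_mul (hkb x t i j) (norm_picardTerm_le hB hkb hb n t j) (norm_nonneg _)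
              ((norm_nonneg _).trans (hkb x t i j))
        _ = _ := by ring
    · exact Eventually.of_forall fun t => summable_geometric_two.mul_right _
    · simp only [tsum_mul_right]
      exact (hB.integrable x).const_mul _
    · exact Eventually.of_forall fun t => (hs t j).hasSum.mul_left _
  rw [integralSol, (hs x i).tsum_eq_zero_add]
  congr 1
  exact (hasSum_sum fun j _ => hintg j).tsum_eq

/-- The difference of two solutions solves the homogeneous equation, so every substitution into
itself halves its bound by a multiple of `ω`. -/
theorem eq_of_integral_equation (hB : ContractiveBound ι kb ω)
    (hk : ∀ i j, Measurable (fun p : ℝ × ℝ => k p.1 p.2 i j))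
    (hkb : ∀ x t i j, ‖k x t i j‖ ≤ kb x t) {f g : ℝ → ι → ℂ} {C : ℝ}
    (hfm : ∀ i, Measurable (fun x => f x i)) (hgm : ∀ i, Measurable (fun x => g x i))
    (hf : ∀ x i, ‖f x i‖ ≤ C * ω x) (hg : ∀ x i, ‖g x i‖ ≤ C * ω x)
    (hfe : ∀ x i, f x i = f₀ x i + ∑ j, ∫ t, k x t i j * f t j)
    (hge : ∀ x i, g x i = f₀ x i + ∑ j, ∫ t, k x t i j * g t j) (x : ℝ) (i : ι) :
    f x i = g x i := by
  have heq : ∀ x i, f x i - g x i = ∑ j, ∫ t, k x t i j * (f t j - g t j) := by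
    intro x i
    rw [hfe x i, hge x i, add_sub_add_left_eq_sub, ← Finset.sum_sub_distrib]
    refine Finset.sum_congr rfl fun j _ => ?_
    rw [← integral_sub (integrable_kernel_mul hB hk hkb hfm hf x i j)
      (integrable_kernel_mul hB hk hkb hgm hg x i j)]
    simp only [mul_sub]
  have hbound : ∀ n : ℕ, ∀ x i, ‖f x i - g x i‖ ≤ (1 / 2) ^ n * (2 * C) * ω x := by
    intro n
    induction n with
    | zero =>
      intro x i
      refine (norm_sub_le _ _).trans ?_
      linarith [hf x i, hg x i]
    | succ n ih =>
      intro x i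
      rw [heq x i]
      refine (norm_sum_integral_le (f := fun t j => f t j - g t j) hB hkb ih x i).trans
        (le_of_eq ?_)
      rw [pow_succ]; ring
  have hlim : Tendsto (fun n : ℕ => (1 / 2 : ℝ) ^ n * (2 * C) * ω x) atTop (𝓝 (0 * (2 * C) * ω x)) :=
    ((tendsto_pow_atTop_nhds_zero_of_lt_one (by norm_num) (by norm_num)).mul_const _).mul_const _
  have := ge_of_tendsto' hlim fun n => hbound n x i
  rw [zero_mul, zero_mul] at this
  exact sub_eq_zero.1 (norm_le_zero_iff.1 this)

/-- Every term is holomorphic by induction, and the majorant `2⁻ⁿ ω x` does not depend on the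
parameter. This is why one pair `kb`, `ω` has to serve all of `U`. -/
theorem differentiableOn_integralSol {U : Set ℂ} (hU : IsOpen U)
    {k : ℂ → ℝ → ℝ → ι → ι → ℂ} {f₀ : ℂ → ℝ → ι → ℂ} (hB : ContractiveBound ι kb ω)
    (hk : ∀ z ∈ U, ∀ i j, Measurable (fun p : ℝ × ℝ => k z p.1 p.2 i j))
    (hkb : ∀ z ∈ U, ∀ x t i j, ‖k z x t i j‖ ≤ kb x t)
    (hf₀ : ∀ z ∈ U, ∀ i, Measurable (fun x => f₀ z x i))
    (hb : ∀ z ∈ U, ∀ x i, ‖f₀ z x i‖ ≤ ω x)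
    (hkd : ∀ x t i j, DifferentiableOn ℂ (fun z => k z x t i j) U)
    (hfd : ∀ x i, DifferentiableOn ℂ (fun z => f₀ z x i) U) (x : ℝ) (i : ι) :
    DifferentiableOn ℂ (fun z => integralSol (k z) (f₀ z) x i) U := by
  have hterm : ∀ n x i, DifferentiableOn ℂ (fun z => picardTerm (k z) (f₀ z) n x i) U := by
    intro n
    induction n with
    | zero => exact hfd
    | succ n ih =>
      intro x i
      simp only [picardTerm]
      refine DifferentiableOn.fun_sum fun j _ => ?_
      refine differentiableOn_integral_of_dominated hU
        (b := fun t => (1 / 2 : ℝ) ^ n * (kb x t * ω t)) (fun z hz => ?_)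
        (fun t => (hkd x t i j).mul (ih t j)) (fun z hz t => ?_) ((hB.integrable x).const_mul _)
      · exact ((measurable_kernel_section (hk z hz) x i j).mul
          (measurable_picardTerm (hk z hz) (hf₀ z hz) n j)).aestronglyMeasurable
      · rw [norm_mul]
        calc ‖k z x t i j‖ * ‖picardTerm (k z) (f₀ z) n t j‖ ≤ kb x t * ((1 / 2) ^ n * ω t) :=
              mul_le_mul (hkb z hz x t i j) (norm_picardTerm_le hB (hkb z hz) (hb z hz) n t j)
                (norm_nonneg _) ((norm_nonneg _).trans (hkb z hz x t i j))
          _ = _ := by ring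
  exact Complex.differentiableOn_tsum_of_summable_norm (summable_geometric_two.mul_right (ω x))
    (fun n => hterm n x i) hU
    fun n z hz => norm_picardTerm_le hB (hkb z hz) (hb z hz) n x i

end IntegralEquation

/-! ### Linear initial value problems as integral equations. -/

section LinearODE

open MeasureTheory Set

variable {ι : Type*} [Fintype ι]

/-- The kernel of the integral form of `y' = A y` with initial point `a`. -/
noncomputable def ivpKernel {ι : Type*} (A : ℝ → ι → ι → ℂ) (a x t : ℝ) (i j : ι) : ℂ :=
  ((Ioc a x).indicator 1 t - (Ioc x a).indicator 1 t) * A t i j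

/-- The solution of the linear system `y' = A y`, `y a = y₀`. -/
noncomputable def linSol (A : ℝ → ι → ι → ℂ) (a : ℝ) (y₀ : ι → ℂ) : ℝ → ι → ℂ :=
  integralSol (ivpKernel A a) (fun _ => y₀)

theorem setIntegral_uIoc_exp_le {c : ℝ} (hc : 0 < c) (a x : ℝ) :
    ∫ t in uIoc a x, Real.exp (c * |t - a|) ≤ Real.exp (c * |x - a|) / c := by
  rcases le_total a x with h | h
  · rw [uIoc_of_le h, ← intervalIntegral.integral_of_le h]
    have : ∫ t in a..x, Real.exp (c * |t - a|) = ∫ t in a..x, Real.exp (c * (t - a)) := by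
      refine intervalIntegral.integral_congr fun t ht => ?_
      rw [uIcc_of_le h] at ht
      simp only [abs_of_nonneg (sub_nonneg.2 ht.1)]
    rw [this, intervalIntegral.integral_comp_sub_right (fun t => Real.exp (c * t)),
      intervalIntegral.integral_comp_mul_left (fun t => Real.exp t) hc.ne', integral_exp,
      abs_of_nonneg (sub_nonneg.2 h)]
    simp only [sub_self, mul_zero, Real.exp_zero, smul_eq_mul]
    rw [inv_mul_eq_div]
    gcongr
    linarith
  · rw [uIoc_of_ge h, ← intervalIntegral.integral_of_le h]
    have : ∫ t in x..a, Real.exp (c * |t - a|) = ∫ t in x..a, Real.exp (c * (a - t)) := by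
      refine intervalIntegral.integral_congr fun t ht => ?_
      rw [uIcc_of_le h] at ht
      simp only [abs_of_nonpos (sub_nonpos.2 ht.2), neg_sub]
    rw [this, intervalIntegral.integral_comp_sub_left (fun t => Real.exp (c * t)),
      intervalIntegral.integral_comp_mul_left (fun t => Real.exp t) hc.ne', integral_exp,
      abs_of_nonpos (sub_nonpos.2 h)]
    simp only [sub_self, mul_zero, Real.exp_zero, smul_eq_mul, neg_sub]
    rw [inv_mul_eq_div]
    gcongr
    linarith

/-- The exponential weight dominating solutions of `y' = A y` with `‖A‖ ≤ L`, `‖y a‖ ≤ M`. -/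
noncomputable def ivpWeight (ι : Type*) [Fintype ι] (L M a x : ℝ) : ℝ :=
  M * Real.exp (2 * (Fintype.card ι + 1) * L * |x - a|)

/-- Integrating an exponential divides it by its rate, here `2 (card ι + 1) L`; multiplied by `card
ι * L` this is at most one half. The `+ 1` keeps the rate positive for empty `ι`. -/
theorem ivpWeight_contractive {L M : ℝ} (hL : 0 < L) (hM : 0 ≤ M) (a : ℝ) :
    ContractiveBound ι (fun x t => (uIoc a x).indicator (fun _ => L) t) (ivpWeight ι L M a) := by
  have hrw : ∀ x, (fun t => (uIoc a x).indicator (fun _ => L) t * ivpWeight ι L M a t) =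
      (uIoc a x).indicator fun t => L * ivpWeight ι L M a t := by
    intro x
    ext t
    by_cases ht : t ∈ uIoc a x <;> simp [ht]
  have hn : (0 : ℝ) ≤ Fintype.card ι := Nat.cast_nonneg _
  have hcont : Continuous fun t => L * ivpWeight ι L M a t := by
    unfold ivpWeight; fun_prop
  refine ⟨fun x => ?_, fun x => ?_, fun x => ?_⟩
  · unfold ivpWeight; positivity
  · rw [hrw, integrable_indicator_iff measurableSet_uIoc]
    exact (hcont.integrableOn_Icc (a := min a x) (b := max a x)).mono_set Ioc_subset_Icc_self
  · rw [hrw, integral_indicator measurableSet_uIoc, integral_const_mul]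
    unfold ivpWeight
    rw [integral_const_mul]
    have h := setIntegral_uIoc_exp_le (c := 2 * (Fintype.card ι + 1) * L) (by positivity) a x
    set E := Real.exp (2 * (Fintype.card ι + 1) * L * |x - a|)
    calc (Fintype.card ι : ℝ) * (L * (M * ∫ t in uIoc a x, Real.exp
          (2 * (Fintype.card ι + 1) * L * |t - a|)))
        ≤ Fintype.card ι * (L * (M * (E / (2 * (Fintype.card ι + 1) * L)))) := by gcongr
      _ = (Fintype.card ι / (Fintype.card ι + 1)) * (M * E / 2) := by field_simp
      _ ≤ 1 * (M * E / 2) := by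
          gcongr
          rw [div_le_one (by positivity)]
          linarith
      _ = M * E / 2 := one_mul _

theorem measurable_ivpKernel {ι : Type*} {A : ℝ → ι → ι → ℂ}
    (hA : ∀ i j, Measurable fun x => A x i j) (a : ℝ) (i j : ι) :
    Measurable fun p : ℝ × ℝ => ivpKernel A a p.1 p.2 i j := by
  unfold ivpKernel
  have h1 : Measurable fun p : ℝ × ℝ => (Ioc a p.1).indicator (1 : ℝ → ℂ) p.2 := by
    have : (fun p : ℝ × ℝ => (Ioc a p.1).indicator (1 : ℝ → ℂ) p.2) =
        ({p : ℝ × ℝ | a < p.2} ∩ {p | p.2 ≤ p.1}).indicator 1 := by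
      ext p; simp [indicator]
    rw [this]
    exact measurable_one.indicator ((measurableSet_lt measurable_const measurable_snd).inter
      (measurableSet_le measurable_snd measurable_fst))
  have h2 : Measurable fun p : ℝ × ℝ => (Ioc p.1 a).indicator (1 : ℝ → ℂ) p.2 := by
    have : (fun p : ℝ × ℝ => (Ioc p.1 a).indicator (1 : ℝ → ℂ) p.2) =
        ({p : ℝ × ℝ | p.1 < p.2} ∩ {p | p.2 ≤ a}).indicator 1 := by
      ext p; simp [indicator]
    rw [this]
    exact measurable_one.indicator ((measurableSet_lt measurable_fst measurable_snd).inter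
      (measurableSet_le measurable_snd measurable_const))
  exact (h1.sub h2).mul ((hA i j).comp measurable_snd)

theorem norm_ivpKernel_le {ι : Type*} {A : ℝ → ι → ι → ℂ} {L : ℝ}
    (hA : ∀ x i j, ‖A x i j‖ ≤ L) (a x t : ℝ) (i j : ι) :
    ‖ivpKernel A a x t i j‖ ≤ (uIoc a x).indicator (fun _ => L) t := by
  unfold ivpKernel
  have := hA t i j
  rcases le_total a x with h | h
  · rw [uIoc_of_le h, Ioc_eq_empty (not_lt.2 h)]
    by_cases ht : t ∈ Ioc a x <;> simp [ht, this]
  · rw [uIoc_of_ge h, Ioc_eq_empty (not_lt.2 h)]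
    by_cases ht : t ∈ Ioc x a <;> simp [ht, this]

theorem integral_ivpKernel_mul {ι : Type*} {A : ℝ → ι → ι → ℂ} {f : ℝ → ℂ} (a x : ℝ) (i j : ι)  :
    ∫ t, ivpKernel A a x t i j * f t = ∫ t in a..x, A t i j * f t := by
  rcases le_total a x with h | h
  · rw [intervalIntegral.integral_of_le h, ← integral_indicator measurableSet_Ioc]
    congr 1; ext t
    unfold ivpKernel
    rw [Ioc_eq_empty (not_lt.2 h)]
    by_cases ht : t ∈ Ioc a x <;> simp [ht]
  · rw [intervalIntegral.integral_of_ge h, ← integral_indicator measurableSet_Ioc, ← integral_neg]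
    congr 1; ext t
    unfold ivpKernel
    rw [Ioc_eq_empty (not_lt.2 h)]
    by_cases ht : t ∈ Ioc x a <;> simp [ht]

variable {A : ℝ → ι → ι → ℂ} {L M : ℝ} {y₀ : ι → ℂ}

theorem norm_linSol_le (hL : 0 < L) (hA : ∀ x i j, ‖A x i j‖ ≤ L) (hM : 0 ≤ M)
    (hy : ∀ i, ‖y₀ i‖ ≤ M) (a x : ℝ) (i : ι) : ‖linSol A a y₀ x i‖ ≤ 2 * ivpWeight ι L M a x := by
  refine norm_integralSol_le (ivpWeight_contractive hL hM a) (norm_ivpKernel_le hA a)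
    (fun x i => (hy i).trans ?_) x i
  exact le_mul_of_one_le_right hM (Real.one_le_exp (by positivity))

theorem le_ivpWeight (hL : 0 < L) (hM : 0 ≤ M) (hy : ∀ i, ‖y₀ i‖ ≤ M) (a : ℝ) :
    ∀ x i, ‖y₀ i‖ ≤ ivpWeight ι L M a x := fun _ i =>
  (hy i).trans (le_mul_of_one_le_right hM (Real.one_le_exp (by positivity)))

theorem measurable_linSol (hAm : ∀ i j, Measurable fun x => A x i j) (hL : 0 < L)
    (hA : ∀ x i j, ‖A x i j‖ ≤ L) (a : ℝ) (i : ι) :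
    Measurable fun x => linSol A a y₀ x i :=
  measurable_integralSol (f₀ := fun _ => y₀) (ivpWeight_contractive hL (norm_nonneg y₀) a)
    (measurable_ivpKernel hAm a)
    (norm_ivpKernel_le hA a) (fun _ => measurable_const)
    (le_ivpWeight hL (norm_nonneg y₀) (norm_le_pi_norm y₀) a) i

theorem linSol_eq (hAm : ∀ i j, Measurable fun x => A x i j) (hL : 0 < L)
    (hA : ∀ x i j, ‖A x i j‖ ≤ L) (a x : ℝ) (i : ι) :
    linSol A a y₀ x i = y₀ i + ∑ j, ∫ t in a..x, A t i j * linSol A a y₀ t j := by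
  have := integralSol_eq (f₀ := fun _ => y₀) (ivpWeight_contractive hL (norm_nonneg y₀) a)
    (measurable_ivpKernel hAm a)
    (norm_ivpKernel_le hA a) (fun _ => measurable_const)
    (le_ivpWeight hL (norm_nonneg y₀) (norm_le_pi_norm y₀) a) x i
  rw [linSol, this]
  simp only [integral_ivpKernel_mul]

theorem intervalIntegrable_linSol (hAm : ∀ i j, Measurable fun x => A x i j) (hL : 0 < L)
    (hA : ∀ x i j, ‖A x i j‖ ≤ L) (a : ℝ) (i j : ι) (b c : ℝ) :
    IntervalIntegrable (fun t => A t i j * linSol A a y₀ t j) volume b c := by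
  have hc : Continuous fun t => L * (2 * ivpWeight ι L ‖y₀‖ a t) := by
    unfold ivpWeight; fun_prop
  refine (hc.intervalIntegrable b c).mono_fun
    ((hAm i j).mul (measurable_linSol hAm hL hA a j)).aestronglyMeasurable
    (Eventually.of_forall fun t => ?_)
  simp only [norm_mul]
  refine mul_le_mul ((hA t i j).trans (le_abs_self L)) ?_ (norm_nonneg _) (norm_nonneg _)
  refine (norm_linSol_le hL hA (norm_nonneg y₀) (norm_le_pi_norm y₀) a t j).trans ?_
  rw [← norm_mul]
  exact le_abs_self _

theorem linSol_self (hAm : ∀ i j, Measurable fun x => A x i j) (hL : 0 < L)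
    (hA : ∀ x i j, ‖A x i j‖ ≤ L) (a : ℝ) (i : ι) : linSol A a y₀ a i = y₀ i := by
  rw [linSol_eq hAm hL hA]; simp

theorem continuous_linSol (hAm : ∀ i j, Measurable fun x => A x i j) (hL : 0 < L)
    (hA : ∀ x i j, ‖A x i j‖ ≤ L) (a : ℝ) (i : ι) : Continuous fun x => linSol A a y₀ x i := by
  have : (fun x => linSol A a y₀ x i) =
      fun x => y₀ i + ∑ j, ∫ t in a..x, A t i j * linSol A a y₀ t j :=
    funext fun x => linSol_eq hAm hL hA a x i
  rw [this]
  refine continuous_const.add (continuous_finsetSum _ fun j _ => ?_)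
  exact intervalIntegral.continuous_primitive
    (fun b c => intervalIntegrable_linSol hAm hL hA a i j b c) a

/-- The integral equation makes sense for merely measurable `A`. Differentiability is claimed only
where the relevant row of `A` is continuous, which accommodates the jump at `0`. -/
theorem hasDerivAt_linSol (hAm : ∀ i j, Measurable fun x => A x i j) (hL : 0 < L)
    (hA : ∀ x i j, ‖A x i j‖ ≤ L) (a x : ℝ) (i : ι) (hx : ∀ j, ContinuousAt (fun t => A t i j) x) :
    HasDerivAt (fun x => linSol A a y₀ x i) (∑ j, A x i j * linSol A a y₀ x j) x := by
  have : (fun x => linSol A a y₀ x i) =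
      fun x => y₀ i + ∑ j, ∫ t in a..x, A t i j * linSol A a y₀ t j :=
    funext fun x => linSol_eq hAm hL hA a x i
  rw [this]
  refine HasDerivAt.const_add _ (HasDerivAt.fun_sum fun j _ => ?_)
  refine intervalIntegral.integral_hasDerivAt_right
    (intervalIntegrable_linSol hAm hL hA a i j a x) ?_ ?_
  · exact ((hAm i j).mul
      (measurable_linSol hAm hL hA a j)).stronglyMeasurable.stronglyMeasurableAtFilter
  · exact (hx j).mul (continuous_linSol hAm hL hA a j).continuousAt

theorem differentiableOn_linSol {U : Set ℂ} (hU : IsOpen U) {A : ℂ → ℝ → ι → ι → ℂ}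
    (hAm : ∀ z ∈ U, ∀ i j, Measurable fun x => A z x i j) (hL : 0 < L)
    (hA : ∀ z ∈ U, ∀ x i j, ‖A z x i j‖ ≤ L)
    (hAd : ∀ x i j, DifferentiableOn ℂ (fun z => A z x i j) U) (a x : ℝ) (i : ι) :
    DifferentiableOn ℂ (fun z => linSol (A z) a y₀ x i) U :=
  differentiableOn_integralSol (f₀ := fun _ _ => y₀) hU
    (ivpWeight_contractive hL (norm_nonneg y₀) a)
    (fun z hz => measurable_ivpKernel (hAm z hz) a) (fun z hz => norm_ivpKernel_le (hA z hz) a)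
    (fun _ _ _ => measurable_const)
    (fun _ _ => le_ivpWeight hL (norm_nonneg y₀) (norm_le_pi_norm y₀) a)
    (fun _ t i j => (hAd t i j).const_mul _) (fun _ _ => differentiableOn_const _) x i

end LinearODE

/-! ### Solutions of Hill's equation, Wronskian and flux. -/

section Hill

open Set

/-- `ψ` solves Hill's equation `-ψ'' + V ψ = z ψ` and has derivative `ψ'`. -/
structure IsHillSol (V : ℝ → ℝ) (z : ℂ) (ψ ψ' : ℝ → ℂ) : Prop where
  hasDerivAt : ∀ x, HasDerivAt ψ (ψ' x) x
  hasDerivAt' : ∀ x, HasDerivAt ψ' (((V x : ℂ) - z) * ψ x) x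

namespace IsHillSol

variable {V : ℝ → ℝ} {z : ℂ} {ψ ψ' χ χ' : ℝ → ℂ}

theorem continuous (h : IsHillSol V z ψ ψ') : Continuous ψ :=
  continuous_iff_continuousAt.2 fun x => (h.hasDerivAt x).continuousAt

theorem continuous' (h : IsHillSol V z ψ ψ') : Continuous ψ' :=
  continuous_iff_continuousAt.2 fun x => (h.hasDerivAt' x).continuousAt

theorem deriv_eq (h : IsHillSol V z ψ ψ') : deriv ψ = ψ' := funext fun x => (h.hasDerivAt x).deriv

theorem add (h : IsHillSol V z ψ ψ') (h₁ : IsHillSol V z χ χ') :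
    IsHillSol V z (fun x => ψ x + χ x) (fun x => ψ' x + χ' x) :=
  ⟨fun x => (h.hasDerivAt x).add (h₁.hasDerivAt x),
    fun x => ((h.hasDerivAt' x).add (h₁.hasDerivAt' x)).congr_deriv (by ring)⟩

theorem const_mul (h : IsHillSol V z ψ ψ') (a : ℂ) :
    IsHillSol V z (fun x => a * ψ x) (fun x => a * ψ' x) :=
  ⟨fun x => (h.hasDerivAt x).const_mul a,
    fun x => ((h.hasDerivAt' x).const_mul a).congr_deriv (by ring)⟩

theorem translate (h : IsHillSol V z ψ ψ') (a : ℝ) :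
    IsHillSol (fun x => V (x + a)) z (fun x => ψ (x + a)) (fun x => ψ' (x + a)) :=
  ⟨fun x => (h.hasDerivAt (x + a)).comp_add_const x a,
    fun x => (h.hasDerivAt' (x + a)).comp_add_const x a⟩

theorem reflect (h : IsHillSol V z ψ ψ') :
    IsHillSol (fun x => V (-x)) z (fun x => ψ (-x)) (fun x => -ψ' (-x)) := by
  refine ⟨fun x => ?_, fun x => ?_⟩
  · exact ((h.hasDerivAt (-x)).scomp x (hasDerivAt_neg x)).congr_deriv (by simp)
  · exact ((h.hasDerivAt' (-x)).scomp x (hasDerivAt_neg x)).neg.congr_deriv (by simp)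

theorem wronskian_eq (h : IsHillSol V z ψ ψ') (h₁ : IsHillSol V z χ χ') (x y : ℝ) :
    ψ x * χ' x - ψ' x * χ x = ψ y * χ' y - ψ' y * χ y := by
  have hd : ∀ x, HasDerivAt (fun x => ψ x * χ' x - ψ' x * χ x) 0 x := fun x =>
    (((h.hasDerivAt x).mul (h₁.hasDerivAt' x)).sub
      ((h.hasDerivAt' x).mul (h₁.hasDerivAt x))).congr_deriv (by ring)
  exact is_const_of_deriv_eq_zero (fun x => (hd x).differentiableAt) (fun x => (hd x).deriv) x y

theorem unique {B : ℝ} (hV : ∀ x, |V x| ≤ B) (h : IsHillSol V z ψ ψ') (h₁ : IsHillSol V z χ χ')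
    {a : ℝ} (h0 : ψ a = χ a) (h0' : ψ' a = χ' a) (x : ℝ) : ψ x = χ x ∧ ψ' x = χ' x := by
  have hB : 0 ≤ B := (abs_nonneg _).trans (hV 0)
  let v : ℝ → ℂ × ℂ → ℂ × ℂ := fun t y => (y.2, ((V t : ℂ) - z) * y.1)
  obtain ⟨K, hK⟩ : ∃ K : NNReal, (K : ℝ) = 1 + B + ‖z‖ := ⟨⟨1 + B + ‖z‖, by positivity⟩, rfl⟩
  have hlip : ∀ t, LipschitzOnWith K (v t) univ := by
    intro t
    refine (LipschitzWith.of_dist_le_mul fun y w => ?_).lipschitzOnWith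
    rw [dist_eq_norm, dist_eq_norm]
    have h1 : ‖y.1 - w.1‖ ≤ ‖y - w‖ := norm_fst_le (y - w)
    have h2 : ‖y.2 - w.2‖ ≤ ‖y - w‖ := norm_snd_le (y - w)
    have h3 : ‖(V t : ℂ) - z‖ ≤ B + ‖z‖ := by
      refine (norm_sub_le _ _).trans ?_
      rw [Complex.norm_real]
      gcongr
      exact hV t
    simp only [v, Prod.mk_sub_mk, ← mul_sub]
    rw [hK, Prod.norm_mk, norm_mul]
    refine max_le ?_ ?_
    · refine h2.trans (le_mul_of_one_le_left (norm_nonneg _) ?_)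
      linarith [norm_nonneg z]
    · exact mul_le_mul (by linarith) h1 (norm_nonneg _) (by positivity)
  have := ODE_solution_unique_univ (v := v) (s := fun _ => univ) (t₀ := a)
    (f := fun t => (ψ t, ψ' t)) (g := fun t => (χ t, χ' t)) hlip
    (fun t => ⟨(h.hasDerivAt t).prodMk (h.hasDerivAt' t), mem_univ _⟩)
    (fun t => ⟨(h₁.hasDerivAt t).prodMk (h₁.hasDerivAt' t), mem_univ _⟩) (by simp [h0, h0'])
  have hx := congrFun this x
  exact ⟨congrArg Prod.fst hx, congrArg Prod.snd hx⟩

/-- The flux `Im (conj ψ · ψ')` of a solution is strictly monotone, for non-real `z`. -/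
theorem hasDerivAt_flux (h : IsHillSol V z ψ ψ') (x : ℝ) :
    HasDerivAt (fun x => (starRingEnd ℂ (ψ x) * ψ' x).im) (-(z.im * ‖ψ x‖ ^ 2)) x := by
  have h1 : HasDerivAt (fun x => starRingEnd ℂ (ψ x)) (starRingEnd ℂ (ψ' x)) x :=
    (h.hasDerivAt x).star
  have h2 := h1.mul (h.hasDerivAt' x)
  have h3 := (Complex.imCLM.hasFDerivAt.comp_hasDerivAt x h2)
  refine h3.congr_deriv ?_
  simp only [Complex.imCLM_apply, Complex.add_im, Complex.mul_im, Complex.conj_re, Complex.conj_im,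
    Complex.mul_re, Complex.sub_re, Complex.sub_im, Complex.ofReal_re, Complex.ofReal_im]
  rw [← Complex.normSq_eq_norm_sq, Complex.normSq_apply]
  ring

/-- The flux has derivative `-Im z |ψ|²`. If it agrees at two points, monotonicity makes it constant
between them, so `ψ` vanishes on an interval, hence everywhere by uniqueness. This is the only place
where non-reality of `z` enters, and it replaces spectral theory. -/
theorem eq_zero_of_flux_eq {B : ℝ} (hV : ∀ x, |V x| ≤ B) (hz : z.im ≠ 0)
    (h : IsHillSol V z ψ ψ') {a b : ℝ} (hab : a < b)
    (hflux : (starRingEnd ℂ (ψ a) * ψ' a).im = (starRingEnd ℂ (ψ b) * ψ' b).im) (x : ℝ) :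
    ψ x = 0 := by
  -- Dividing by `-Im z` makes the derivative `|ψ|²`, so both signs of `Im z` are treated at once.
  set f : ℝ → ℝ := fun x => (starRingEnd ℂ (ψ x) * ψ' x).im / (-z.im) with hf
  have hd : ∀ x, HasDerivAt f (‖ψ x‖ ^ 2) x := fun x =>
    ((h.hasDerivAt_flux x).div_const _).congr_deriv (by field_simp)
  have hmono : Monotone f := monotone_of_deriv_nonneg (fun x => (hd x).differentiableAt)
    fun x => by rw [(hd x).deriv]; positivity
  have hconst : ∀ y ∈ Ioo a b, f y = f a := fun y hy =>
    le_antisymm ((hmono hy.2.le).trans (by simp only [hf, hflux]; exact le_rfl)) (hmono hy.1.le)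
  have hzero : ∀ y ∈ Ioo a b, ψ y = 0 := by
    intro y hy
    have h1 : HasDerivAt f 0 y := (hasDerivAt_const y (f a)).congr_of_eventuallyEq
      (eventually_of_mem (Ioo_mem_nhds hy.1 hy.2) hconst)
    simpa using (hd y).unique h1
  have hm : (a + b) / 2 ∈ Ioo a b := ⟨by linarith, by linarith⟩
  have hzero' : ψ' ((a + b) / 2) = 0 :=
    (h.hasDerivAt _).unique ((hasDerivAt_const _ (0 : ℂ)).congr_of_eventuallyEq
      (eventually_of_mem (Ioo_mem_nhds hm.1 hm.2) hzero))
  have htriv : IsHillSol V z (fun _ => 0) (fun _ => 0) :=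
    ⟨fun x => hasDerivAt_const x 0, fun x => (hasDerivAt_const x (0 : ℂ)).congr_deriv (by simp)⟩
  exact (h.unique hV htriv (hzero _ hm) hzero' x).1

end IsHillSol

/-- Coefficients of Hill's equation as a first order system. -/
noncomputable def hillMatrix (V : ℝ → ℝ) (z : ℂ) (x : ℝ) (i j : Fin 2) : ℂ :=
  !![0, 1; (V x : ℂ) - z, 0] i j

/-- The solution `ψ` of Hill's equation with `ψ 0 = y₀`, `ψ' 0 = y₁`. -/
noncomputable def hillSol (V : ℝ → ℝ) (y₀ y₁ : ℂ) (z : ℂ) (x : ℝ) : ℂ :=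
  linSol (hillMatrix V z) 0 ![y₀, y₁] x 0

/-- The derivative of `hillSol`. -/
noncomputable def hillSol' (V : ℝ → ℝ) (y₀ y₁ : ℂ) (z : ℂ) (x : ℝ) : ℂ :=
  linSol (hillMatrix V z) 0 ![y₀, y₁] x 1

variable {V : ℝ → ℝ} {B : ℝ}

theorem measurable_hillMatrix (hVc : Continuous V) (z : ℂ) (i j : Fin 2) :
    Measurable fun x => hillMatrix V z x i j := by
  have : Measurable fun x => ((V x : ℂ) - z) := by fun_prop
  fin_cases i <;> fin_cases j <;> simp [hillMatrix, this]

theorem norm_hillMatrix_le (hV : ∀ x, |V x| ≤ B) {R : ℝ} {z : ℂ} (hz : ‖z‖ ≤ R) (x : ℝ)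
    (i j : Fin 2) : ‖hillMatrix V z x i j‖ ≤ 1 + B + R := by
  have hB : 0 ≤ B := (abs_nonneg _).trans (hV 0)
  have hR : 0 ≤ R := (norm_nonneg _).trans hz
  have h3 : ‖(V x : ℂ) - z‖ ≤ 1 + B + R := by
    refine (norm_sub_le _ _).trans ?_
    rw [Complex.norm_real, Real.norm_eq_abs]
    linarith [hV x]
  fin_cases i <;> fin_cases j <;> simp [hillMatrix, h3] <;> linarith

theorem continuous_hillMatrix (hVc : Continuous V) (z : ℂ) (i j : Fin 2) :
    Continuous fun x => hillMatrix V z x i j := by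
  have : Continuous fun x => ((V x : ℂ) - z) := by fun_prop
  fin_cases i <;> fin_cases j <;> simp [hillMatrix, this, continuous_const]

theorem isHillSol_hillSol (hVc : Continuous V) (hV : ∀ x, |V x| ≤ B) (y₀ y₁ z : ℂ) :
    IsHillSol V z (hillSol V y₀ y₁ z) (hillSol' V y₀ y₁ z) := by
  have hB : 0 ≤ B := (abs_nonneg _).trans (hV 0)
  have h := fun x i => hasDerivAt_linSol (y₀ := ![y₀, y₁]) (measurable_hillMatrix hVc z)
    (by positivity : 0 < 1 + B + ‖z‖)
    (norm_hillMatrix_le hV le_rfl) 0 x i (fun j => (continuous_hillMatrix hVc z i j).continuousAt)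
  refine ⟨fun x => (h x 0).congr_deriv ?_, fun x => (h x 1).congr_deriv ?_⟩
  · simp [hillMatrix, hillSol']
  · simp [hillMatrix, hillSol]

theorem hillSol_zero (hVc : Continuous V) (hV : ∀ x, |V x| ≤ B) (y₀ y₁ z : ℂ) :
    hillSol V y₀ y₁ z 0 = y₀ ∧ hillSol' V y₀ y₁ z 0 = y₁ := by
  have hB : 0 ≤ B := (abs_nonneg _).trans (hV 0)
  have h := linSol_self (y₀ := ![y₀, y₁]) (measurable_hillMatrix hVc z)
    (by positivity : 0 < 1 + B + ‖z‖) (norm_hillMatrix_le hV le_rfl) 0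
  exact ⟨h 0, h 1⟩

theorem differentiable_hill_linSol (hVc : Continuous V) (hV : ∀ x, |V x| ≤ B) (y : Fin 2 → ℂ)
    (x : ℝ) (i : Fin 2) : Differentiable ℂ fun z => linSol (hillMatrix V z) 0 y x i := by
  have hB : 0 ≤ B := (abs_nonneg _).trans (hV 0)
  intro z
  have hd := differentiableOn_linSol (y₀ := y) (U := Metric.ball z 1) Metric.isOpen_ball
    (A := hillMatrix V)
    (fun w _ => measurable_hillMatrix hVc w) (by positivity : 0 < 1 + B + (‖z‖ + 1))
    (fun w hw => norm_hillMatrix_le hV (R := ‖z‖ + 1) (by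
      have := norm_le_norm_add_norm_sub' w z
      rw [Metric.mem_ball, dist_eq_norm] at hw
      linarith))
    (fun x i j => by
      have : DifferentiableOn ℂ (fun w => (V x : ℂ) - w) (Metric.ball z 1) := by fun_prop
      fin_cases i <;> fin_cases j <;> simp [hillMatrix, this]) 0 x i
  exact hd.differentiableAt (Metric.ball_mem_nhds z one_pos)

theorem differentiable_hillSol (hVc : Continuous V) (hV : ∀ x, |V x| ≤ B) (y₀ y₁ : ℂ) (x : ℝ) :
    Differentiable ℂ fun z => hillSol V y₀ y₁ z x :=
  differentiable_hill_linSol hVc hV _ x 0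

theorem differentiable_hillSol' (hVc : Continuous V) (hV : ∀ x, |V x| ≤ B) (y₀ y₁ : ℂ) (x : ℝ) :
    Differentiable ℂ fun z => hillSol' V y₀ y₁ z x :=
  differentiable_hill_linSol hVc hV _ x 1

/-- Solutions of Hill's equation are jointly continuous in position and spectral parameter. -/
theorem continuous_hillSol_uncurry (hVc : Continuous V) (hV : ∀ x, |V x| ≤ B) (y₀ y₁ : ℂ) :
    Continuous fun p : ℂ × ℝ => hillSol V y₀ y₁ p.1 p.2 := by
  have hB : 0 ≤ B := (abs_nonneg _).trans (hV 0)
  rw [continuous_iff_continuousAt]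
  rintro ⟨z, x⟩
  set M := 2 * ivpWeight (Fin 2) (1 + B + (‖z‖ + 1)) ‖![y₀, y₁]‖ 0 (|x| + 1) with hM
  have hM0 : 0 ≤ M := by rw [hM]; unfold ivpWeight; positivity
  have hbound : ∀ w ∈ Metric.ball z 1, ∀ y ∈ Metric.ball x 1, ‖hillSol' V y₀ y₁ w y‖ ≤ M := by
    intro w hw y hy
    have hw' : ‖w‖ ≤ ‖z‖ + 1 := by
      have := norm_le_norm_add_norm_sub' w z
      rw [Metric.mem_ball, dist_eq_norm] at hw
      linarith
    refine (norm_linSol_le (by positivity : 0 < 1 + B + (‖z‖ + 1))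
      (norm_hillMatrix_le hV hw') (norm_nonneg ![y₀, y₁]) (norm_le_pi_norm _) 0 y 1).trans ?_
    rw [hM]
    unfold ivpWeight
    have : |y| ≤ |x| + 1 := by
      rw [Metric.mem_ball, Real.dist_eq] at hy
      have := abs_sub_abs_le_abs_sub y x
      linarith
    rw [sub_zero, sub_zero, abs_of_nonneg (by positivity : 0 ≤ |x| + 1)]
    gcongr
  -- A Lipschitz constant in position that is uniform in `w`, together with continuity in `w` at
  -- each position, gives joint continuity.
  have hlip : ∀ w ∈ Metric.ball z 1,
      LipschitzOnWith ⟨M, hM0⟩ (fun y => hillSol V y₀ y₁ w y) (Metric.ball x 1) := by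
    intro w hw
    refine Convex.lipschitzOnWith_of_nnnorm_hasDerivWithin_le (convex_ball x 1)
      (fun y _ => ((isHillSol_hillSol hVc hV y₀ y₁ w).hasDerivAt y).hasDerivWithinAt) ?_
    intro y hy
    exact hbound w hw y hy
  have := continuousOn_prod_of_continuousOn_lipschitzOnWith'
    (f := fun p : ℂ × ℝ => hillSol V y₀ y₁ p.1 p.2) (s := Metric.ball z 1) (t := Metric.ball x 1)
    ⟨M, hM0⟩ hlip (fun y _ => (differentiable_hillSol hVc hV y₀ y₁ y).continuous.continuousOn)
  exact this.continuousAt (prod_mem_nhds (Metric.ball_mem_nhds z one_pos)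
    (Metric.ball_mem_nhds x one_pos))

end Hill

/-! ### Floquet multipliers and the decaying (Weyl) solutions. -/

section Weyl

open Set

/-- A continuous potential of period `d > 0`. -/
structure IsHillPotential (V : ℝ → ℝ) (d : ℝ) : Prop where
  pos : 0 < d
  continuous : Continuous V
  periodic : Function.Periodic V d

namespace IsHillPotential

variable {V : ℝ → ℝ} {d : ℝ}

theorem exists_bound (hV : IsHillPotential V d) : ∃ B, ∀ x, |V x| ≤ B := by
  obtain ⟨B, hB⟩ := (hV.periodic.compact_of_continuous hV.pos.ne' hV.continuous).isBounded.exists_norm_le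
  exact ⟨B, fun x => hB _ (mem_range_self x)⟩

theorem reflect (hV : IsHillPotential V d) : IsHillPotential (fun x => V (-x)) d :=
  ⟨hV.pos, hV.continuous.comp continuous_neg, fun x => by
    simp only [neg_add, ← sub_eq_add_neg, hV.periodic.sub_eq]⟩

theorem translate (hV : IsHillPotential V d) (a : ℝ) : IsHillPotential (fun x => V (x + a)) d :=
  ⟨hV.pos, hV.continuous.comp (continuous_add_const a), fun x => by
    rw [add_right_comm, hV.periodic]⟩

end IsHillPotential

/-- `ψ` is the solution of Hill's equation that decays at `+∞`, normalized by `ψ 0 = 1`, and `ρ`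
is its Floquet multiplier. -/
structure IsWeylSol (V : ℝ → ℝ) (d : ℝ) (z ρ : ℂ) (ψ ψ' : ℝ → ℂ) : Prop where
  hill : IsHillSol V z ψ ψ'
  zero : ψ 0 = 1
  shift : ∀ x, ψ (x + d) = ρ * ψ x
  shift' : ∀ x, ψ' (x + d) = ρ * ψ' x
  norm_lt : ‖ρ‖ < 1

variable {V : ℝ → ℝ} {d : ℝ} {z ρ : ℂ} {ψ ψ' : ℝ → ℂ}

theorem IsHillSol.shift_of_shift (hV : IsHillPotential V d) (h : IsHillSol V z ψ ψ')
    (h0 : ψ d = ρ * ψ 0) (h0' : ψ' d = ρ * ψ' 0) (x : ℝ) :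
    ψ (x + d) = ρ * ψ x ∧ ψ' (x + d) = ρ * ψ' x := by
  obtain ⟨B, hB⟩ := hV.exists_bound
  have h1 := h.translate d
  rw [show (fun x => V (x + d)) = V from funext hV.periodic] at h1
  exact h1.unique hB (h.const_mul ρ) (a := 0) (by simpa using h0) (by simpa using h0') x

theorem flux_mul (ρ a b : ℂ) :
    (starRingEnd ℂ (ρ * a) * (ρ * b)).im = ‖ρ‖ ^ 2 * (starRingEnd ℂ a * b).im := by
  rw [map_mul, show starRingEnd ℂ ρ * starRingEnd ℂ a * (ρ * b) =
    (starRingEnd ℂ ρ * ρ) * (starRingEnd ℂ a * b) by ring, ← Complex.normSq_eq_conj_mul_self,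
    Complex.im_ofReal_mul, Complex.normSq_eq_norm_sq]

namespace IsWeylSol

theorem eq_zero_imp_false (hV : IsHillPotential V d) (hz : z.im ≠ 0)
    (h : IsWeylSol V d z ρ ψ ψ') {a b : ℝ} (hab : a < b)
    (hflux : (starRingEnd ℂ (ψ a) * ψ' a).im = (starRingEnd ℂ (ψ b) * ψ' b).im) : False := by
  obtain ⟨B, hB⟩ := hV.exists_bound
  have := h.hill.eq_zero_of_flux_eq hB hz hab hflux 0
  rw [h.zero] at this
  exact one_ne_zero this

theorem ne_zero (hV : IsHillPotential V d) (hz : z.im ≠ 0) (h : IsWeylSol V d z ρ ψ ψ') (x : ℝ) :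
    ψ x ≠ 0 := by
  intro hx
  refine h.eq_zero_imp_false hV hz (lt_add_of_pos_right x hV.pos) ?_
  rw [h.shift, hx]
  simp

theorem mult_ne_zero (hV : IsHillPotential V d) (hz : z.im ≠ 0) (h : IsWeylSol V d z ρ ψ ψ') :
    ρ ≠ 0 := by
  intro hρ
  refine h.ne_zero hV hz d ?_
  have := h.shift 0
  rwa [zero_add, hρ, zero_mul] at this

/-- Times `Im z`, the flux is strictly smaller one period later, yet it is also multiplied there by
`‖ρ‖² < 1`. Only a positive quantity shrinks in this way. -/
theorem flux_pos (hV : IsHillPotential V d) (hz : z.im ≠ 0) (h : IsWeylSol V d z ρ ψ ψ') (x : ℝ) :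
    0 < z.im * (starRingEnd ℂ (ψ x) * ψ' x).im := by
  set f : ℝ → ℝ := fun x => z.im * (starRingEnd ℂ (ψ x) * ψ' x).im with hf
  have hd : ∀ x, HasDerivAt f (-(z.im ^ 2 * ‖ψ x‖ ^ 2)) x := fun x =>
    ((h.hill.hasDerivAt_flux x).const_mul _).congr_deriv (by ring)
  have hanti : Antitone f := antitone_of_deriv_nonpos (fun x => (hd x).differentiableAt)
    fun x => by rw [(hd x).deriv, neg_nonpos]; positivity
  have hle : f (x + d) ≤ f x := hanti (by linarith [hV.pos])
  have hne : f (x + d) ≠ f x := by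
    intro he
    exact h.eq_zero_imp_false hV hz (lt_add_of_pos_right x hV.pos)
      (mul_left_cancel₀ hz he).symm
  have hshift : f (x + d) = ‖ρ‖ ^ 2 * f x := by
    simp only [hf, h.shift, h.shift', flux_mul]; ring
  have hρ : ‖ρ‖ ^ 2 < 1 := by
    have := h.norm_lt
    have := norm_nonneg ρ
    nlinarith
  have hlt := lt_of_le_of_ne hle hne
  rw [hshift] at hlt
  change 0 < f x
  nlinarith

/-- The Wronskian of two decaying solutions is constant but is multiplied by `ρ σ ≠ 1` over a
period, so it vanishes. The normalization at `0` then equates the Cauchy data. -/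
theorem unique (hV : IsHillPotential V d) {σ : ℂ} {χ χ' : ℝ → ℂ}
    (h : IsWeylSol V d z ρ ψ ψ') (h₁ : IsWeylSol V d z σ χ χ') : ψ = χ ∧ ψ' = χ' ∧ ρ = σ := by
  obtain ⟨B, hB⟩ := hV.exists_bound
  have hw := h.hill.wronskian_eq h₁.hill (0 + d) 0
  rw [h.shift, h₁.shift, h.shift', h₁.shift', h.zero, h₁.zero] at hw
  have h1 : (1 - ρ * σ) * (χ' 0 - ψ' 0) = 0 := by linear_combination -hw
  have h2 : 1 - ρ * σ ≠ 0 := by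
    intro h0
    have : ‖ρ * σ‖ = 1 := by rw [← sub_eq_zero.1 h0, norm_one]
    rw [norm_mul] at this
    nlinarith [h.norm_lt, h₁.norm_lt, norm_nonneg ρ, norm_nonneg σ]
  have h3 : ψ' 0 = χ' 0 := (sub_eq_zero.1 ((mul_eq_zero.1 h1).resolve_left h2)).symm
  have h4 := h.hill.unique hB h₁.hill (a := 0) (by rw [h.zero, h₁.zero]) h3
  refine ⟨funext fun x => (h4 x).1, funext fun x => (h4 x).2, ?_⟩
  have h5 := h.shift 0
  have h6 := h₁.shift 0
  rw [h.zero, zero_add, mul_one] at h5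
  rw [h₁.zero, zero_add, mul_one] at h6
  rw [← h5, ← h6, (h4 d).1]

/-- The Weyl solutions at `+∞` and `-∞` are linearly independent. -/
theorem wronskian_ne_zero (hV : IsHillPotential V d) (hz : z.im ≠ 0) {σ : ℂ} {χ χ' : ℝ → ℂ}
    (h : IsWeylSol V d z ρ ψ ψ') (h₁ : IsWeylSol (fun x => V (-x)) d z σ χ χ') (x : ℝ) :
    ψ x * (-χ' (-x)) - ψ' x * χ (-x) ≠ 0 := by
  intro h0
  have hψ := h.ne_zero hV hz x
  -- If the Wronskian vanished, the two Cauchy data at `x` would be proportional. Reflection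
  -- reverses the derivative, so the two fluxes, both positive after multiplication by `Im z`, would
  -- have opposite signs.
  have e1 : χ (-x) = χ (-x) / ψ x * ψ x := by field_simp
  have e2 : χ' (-x) = χ (-x) / ψ x * (-ψ' x) := by
    field_simp
    linear_combination -h0
  have f1 := h.flux_pos hV hz x
  have f2 := h₁.flux_pos hV.reflect hz (-x)
  rw [e2] at f2
  nth_rewrite 1 [e1] at f2
  rw [flux_mul, mul_neg, Complex.neg_im] at f2
  have : 0 ≤ ‖χ (-x) / ψ x‖ ^ 2 := by positivity
  nlinarith

/-- The Wronskian of the solutions decaying at the two ends is a nonzero constant, while a shift by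
one period multiplies it by `ρ / σ`. -/
theorem mult_reflect (hV : IsHillPotential V d) (hz : z.im ≠ 0) {σ : ℂ} {χ χ' : ℝ → ℂ}
    (h : IsWeylSol V d z ρ ψ ψ') (h₁ : IsWeylSol (fun x => V (-x)) d z σ χ χ') : σ = ρ := by
  have hr := h₁.hill.reflect
  simp only [neg_neg] at hr
  have hw := h.hill.wronskian_eq hr (0 + d) 0
  have s1 := h₁.shift (-(0 + d))
  have s2 := h₁.shift' (-(0 + d))
  rw [show -(0 + d) + d = -0 by ring] at s1 s2
  have hne := h.wronskian_ne_zero hV hz h₁ 0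
  rw [h.shift, h.shift'] at hw
  rw [s1, s2] at hw hne
  have h1 : (σ - ρ) * (ψ 0 * (-(σ * χ' (-(0 + d)))) - ψ' 0 * (σ * χ (-(0 + d)))) = 0 := by
    linear_combination -σ * hw
  exact sub_eq_zero.1 ((mul_eq_zero.1 h1).resolve_right hne)

end IsWeylSol

/-- A solution vanishing at `0` and at `d` has zero flux at both points, hence is trivial. This
makes the quotient `floquetSlope` meaningful. -/
theorem hillSol_dirichlet_ne_zero (hV : IsHillPotential V d) (hz : z.im ≠ 0) :
    hillSol V 0 1 z d ≠ 0 := by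
  obtain ⟨B, hB⟩ := hV.exists_bound
  intro h0
  have hs := isHillSol_hillSol hV.continuous hB 0 1 z
  have hi := hillSol_zero hV.continuous hB 0 1 z
  have hzero := hs.eq_zero_of_flux_eq hB hz hV.pos (by rw [hi.1, h0]; simp)
  have h1 : hillSol' V 0 1 z 0 = 0 :=
    (hs.hasDerivAt 0).unique ((hasDerivAt_const 0 (0 : ℂ)).congr_of_eventuallyEq
      (Eventually.of_forall hzero))
  rw [hi.2] at h1
  exact one_ne_zero h1

/-- The trace of the monodromy matrix of Hill's equation. -/
noncomputable def hillDiscriminant (V : ℝ → ℝ) (d : ℝ) (z : ℂ) : ℂ :=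
  hillSol V 1 0 z d + hillSol' V 0 1 z d

/-- The Floquet multiplier of modulus less than one. -/
noncomputable def floquetMult (V : ℝ → ℝ) (d : ℝ) (z : ℂ) : ℂ :=
  Classical.epsilon fun ρ : ℂ => ‖ρ‖ < 1 ∧ ρ * (hillDiscriminant V d z - ρ) = 1

/-- The logarithmic derivative at `0` of the Floquet solution with multiplier `ρ`. -/
noncomputable def floquetSlope (V : ℝ → ℝ) (d : ℝ) (ρ z : ℂ) : ℂ :=
  (ρ - hillSol V 1 0 z d) / hillSol V 0 1 z d

/-- The Floquet solution with multiplier `ρ`. -/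
noncomputable def floquetSol (V : ℝ → ℝ) (d : ℝ) (ρ z : ℂ) (x : ℝ) : ℂ :=
  hillSol V 1 0 z x + floquetSlope V d ρ z * hillSol V 0 1 z x

/-- The derivative of `floquetSol`. -/
noncomputable def floquetSol' (V : ℝ → ℝ) (d : ℝ) (ρ z : ℂ) (x : ℝ) : ℂ :=
  hillSol' V 1 0 z x + floquetSlope V d ρ z * hillSol' V 0 1 z x

theorem isHillSol_floquetSol (hV : IsHillPotential V d) (ρ z : ℂ) :
    IsHillSol V z (floquetSol V d ρ z) (floquetSol' V d ρ z) := by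
  obtain ⟨B, hB⟩ := hV.exists_bound
  exact (isHillSol_hillSol hV.continuous hB 1 0 z).add
    ((isHillSol_hillSol hV.continuous hB 0 1 z).const_mul _)

theorem floquetSol_zero (hV : IsHillPotential V d) (ρ z : ℂ) :
    floquetSol V d ρ z 0 = 1 ∧ floquetSol' V d ρ z 0 = floquetSlope V d ρ z := by
  obtain ⟨B, hB⟩ := hV.exists_bound
  simp [floquetSol, floquetSol', (hillSol_zero hV.continuous hB 1 0 z).1,
    (hillSol_zero hV.continuous hB 1 0 z).2, (hillSol_zero hV.continuous hB 0 1 z).1,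
    (hillSol_zero hV.continuous hB 0 1 z).2]

/-- The slope is chosen so that the value at `d` is `ρ`. The derivative then matches because the
monodromy matrix has determinant one and `ρ` is a root of its characteristic equation. -/
theorem floquetSol_shift (hV : IsHillPotential V d) (hz : z.im ≠ 0)
    (hρ : ρ * (hillDiscriminant V d z - ρ) = 1) (x : ℝ) :
    floquetSol V d ρ z (x + d) = ρ * floquetSol V d ρ z x ∧
      floquetSol' V d ρ z (x + d) = ρ * floquetSol' V d ρ z x := by
  obtain ⟨B, hB⟩ := hV.exists_bound
  have hs := hillSol_dirichlet_ne_zero hV hz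
  have hc0 := hillSol_zero hV.continuous hB 1 0 z
  have hs0 := hillSol_zero hV.continuous hB 0 1 z
  have hw := (isHillSol_hillSol hV.continuous hB 1 0 z).wronskian_eq
    (isHillSol_hillSol hV.continuous hB 0 1 z) d 0
  rw [hc0.1, hc0.2, hs0.1, hs0.2] at hw
  have h0 := floquetSol_zero hV ρ z
  refine (isHillSol_floquetSol hV ρ z).shift_of_shift hV ?_ ?_ x
  · rw [h0.1]
    unfold floquetSol floquetSlope
    field_simp
    ring
  · rw [h0.2]
    unfold floquetSol' floquetSlope
    field_simp
    unfold hillDiscriminant at hρ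
    linear_combination hρ - hw

/-- A multiplier on the unit circle would leave the flux unchanged over one period. -/
theorem norm_mult_ne_one (hV : IsHillPotential V d) (hz : z.im ≠ 0)
    (hρ : ρ * (hillDiscriminant V d z - ρ) = 1) : ‖ρ‖ ≠ 1 := by
  intro h1
  obtain ⟨B, hB⟩ := hV.exists_bound
  have hs := floquetSol_shift hV hz hρ 0
  have := (isHillSol_floquetSol hV ρ z).eq_zero_of_flux_eq hB hz
    (lt_add_of_pos_right 0 hV.pos) (by rw [hs.1, hs.2, flux_mul, h1]; ring) 0
  rw [(floquetSol_zero hV ρ z).1] at this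
  exact one_ne_zero this

theorem floquetMult_spec (hV : IsHillPotential V d) (hz : z.im ≠ 0) :
    ‖floquetMult V d z‖ < 1 ∧
      floquetMult V d z * (hillDiscriminant V d z - floquetMult V d z) = 1 := by
  refine Classical.epsilon_spec (p := fun ρ : ℂ => ‖ρ‖ < 1 ∧
    ρ * (hillDiscriminant V d z - ρ) = 1) ?_
  set D := hillDiscriminant V d z
  obtain ⟨w, hw⟩ := IsAlgClosed.exists_pow_nat_eq (D ^ 2 - 4) (n := 2) (by norm_num)
  have h1 : (D + w) / 2 * (D - (D + w) / 2) = 1 := by linear_combination -hw / 4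
  have h2 : (D - w) / 2 * (D - (D - w) / 2) = 1 := by linear_combination -hw / 4
  have h3 : (D + w) / 2 * ((D - w) / 2) = 1 := by linear_combination -hw / 4
  -- The two roots have product one and the first is off the unit circle, so one of them lies inside
  -- the disc.
  rcases lt_or_gt_of_ne (norm_mult_ne_one hV hz h1) with h | h
  · exact ⟨_, h, h1⟩
  · refine ⟨_, ?_, h2⟩
    have := congrArg norm h3
    rw [norm_mul, norm_one] at this
    by_contra hc
    push Not at hc
    nlinarith

theorem mult_unique {D σ : ℂ} (h : ‖ρ‖ < 1) (hρ : ρ * (D - ρ) = 1) (h' : ‖σ‖ < 1)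
    (hσ : σ * (D - σ) = 1) : ρ = σ := by
  have h1 : (ρ - σ) * (1 - ρ * σ) = 0 := by linear_combination σ * hρ - ρ * hσ
  have h2 : 1 - ρ * σ ≠ 0 := by
    intro h0
    have : ‖ρ * σ‖ = 1 := by rw [← sub_eq_zero.1 h0, norm_one]
    rw [norm_mul] at this
    nlinarith [norm_nonneg ρ, norm_nonneg σ]
  exact sub_eq_zero.1 ((mul_eq_zero.1 h1).resolve_right h2)

/-- The solution of Hill's equation that decays at `+∞`, with value `1` at `0`. -/
noncomputable def weylSol (V : ℝ → ℝ) (d : ℝ) (z : ℂ) : ℝ → ℂ :=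
  floquetSol V d (floquetMult V d z) z

/-- The derivative of `weylSol`. -/
noncomputable def weylSol' (V : ℝ → ℝ) (d : ℝ) (z : ℂ) : ℝ → ℂ :=
  floquetSol' V d (floquetMult V d z) z

theorem isWeylSol_weylSol (hV : IsHillPotential V d) (hz : z.im ≠ 0) :
    IsWeylSol V d z (floquetMult V d z) (weylSol V d z) (weylSol' V d z) :=
  ⟨isHillSol_floquetSol hV _ z, (floquetSol_zero hV _ z).1,
    fun x => (floquetSol_shift hV hz (floquetMult_spec hV hz).2 x).1,
    fun x => (floquetSol_shift hV hz (floquetMult_spec hV hz).2 x).2, (floquetMult_spec hV hz).1⟩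

theorem isOpen_im_ne_zero : IsOpen {z : ℂ | z.im ≠ 0} :=
  isOpen_ne_fun Complex.continuous_im continuous_const

theorem differentiable_hillDiscriminant (hV : IsHillPotential V d) :
    Differentiable ℂ (hillDiscriminant V d) := by
  obtain ⟨B, hB⟩ := hV.exists_bound
  exact (differentiable_hillSol hV.continuous hB 1 0 d).add
    (differentiable_hillSol' hV.continuous hB 0 1 d)

/-- The multiplier solves `ρ + ρ⁻¹ = D(z)`, and the map `r ↦ r + r⁻¹` is critical only where `r² =
1`, which `‖ρ‖ < 1` excludes. Near `z` the chosen root coincides with a local inverse applied to the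
entire function `D`, because the root inside the disc is unique. -/
theorem differentiableAt_floquetMult (hV : IsHillPotential V d) (hz : z.im ≠ 0) :
    DifferentiableAt ℂ (floquetMult V d) z := by
  obtain ⟨hlt, hroot⟩ := floquetMult_spec hV hz
  set ρ := floquetMult V d z
  have hρ : ρ ≠ 0 := fun h => by rw [h, zero_mul] at hroot; exact zero_ne_one hroot
  have hJ : HasStrictDerivAt (fun r : ℂ => r + r⁻¹) (1 + -(ρ ^ 2)⁻¹) ρ :=
    (hasStrictDerivAt_id ρ).add (hasStrictDerivAt_inv hρ)
  have hJ' : 1 + -(ρ ^ 2)⁻¹ ≠ 0 := by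
    intro h0
    have h1 : ρ ^ 2 = 1 := by
      field_simp at h0
      linear_combination h0
    have := congrArg norm h1
    rw [norm_pow, norm_one] at this
    nlinarith [norm_nonneg ρ]
  have hval : ρ + ρ⁻¹ = hillDiscriminant V d z := by
    field_simp
    linear_combination -hroot
  set ℓ := hJ.localInverse _ _ _ hJ'
  have hℓ : HasStrictDerivAt ℓ (1 + -(ρ ^ 2)⁻¹)⁻¹ (ρ + ρ⁻¹) := hJ.to_localInverse hJ'
  have hℓρ : ℓ (ρ + ρ⁻¹) = ρ := (hJ.eventually_left_inverse hJ').self_of_nhds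
  have hinv : ∀ᶠ w in 𝓝 (ρ + ρ⁻¹), ℓ w + (ℓ w)⁻¹ = w := hJ.eventually_right_inverse hJ'
  have hnear : ∀ᶠ w in 𝓝 (ρ + ρ⁻¹), ‖ℓ w‖ < 1 ∧ ℓ w ≠ 0 := by
    have hc : ContinuousAt ℓ (ρ + ρ⁻¹) := hℓ.hasDerivAt.continuousAt
    refine (hc.norm.eventually_lt continuousAt_const (by rwa [hℓρ])).and ?_
    exact hc.eventually_ne (by rwa [hℓρ])
  have hD := (differentiable_hillDiscriminant hV) z
  have htend : Tendsto (hillDiscriminant V d) (𝓝 z) (𝓝 (ρ + ρ⁻¹)) := by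
    rw [hval]; exact hD.continuousAt
  have heq : floquetMult V d =ᶠ[𝓝 z] fun w => ℓ (hillDiscriminant V d w) := by
    filter_upwards [isOpen_im_ne_zero.mem_nhds hz, htend.eventually hinv,
      htend.eventually hnear] with w hw h1 h2
    obtain ⟨ha, hb⟩ := floquetMult_spec hV hw
    refine mult_unique ha hb h2.1 ?_
    nth_rewrite 2 [← h1]
    rw [add_sub_cancel_left, mul_inv_cancel₀ h2.2]
  refine DifferentiableAt.congr_of_eventuallyEq ?_ heq
  refine DifferentiableAt.comp z ?_ hD
  rw [← hval]
  exact hℓ.hasDerivAt.differentiableAt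

theorem differentiableAt_floquetSlope (hV : IsHillPotential V d) (hz : z.im ≠ 0) :
    DifferentiableAt ℂ (fun w => floquetSlope V d (floquetMult V d w) w) z := by
  obtain ⟨B, hB⟩ := hV.exists_bound
  exact ((differentiableAt_floquetMult hV hz).sub
    (differentiable_hillSol hV.continuous hB 1 0 d z)).div
    (differentiable_hillSol hV.continuous hB 0 1 d z) (hillSol_dirichlet_ne_zero hV hz)

theorem differentiableAt_weylSol (hV : IsHillPotential V d) (hz : z.im ≠ 0) (x : ℝ) :
    DifferentiableAt ℂ (fun w => weylSol V d w x) z := by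
  obtain ⟨B, hB⟩ := hV.exists_bound
  exact (differentiable_hillSol hV.continuous hB 1 0 x z).add
    ((differentiableAt_floquetSlope hV hz).mul (differentiable_hillSol hV.continuous hB 0 1 x z))

theorem differentiableAt_weylSol' (hV : IsHillPotential V d) (hz : z.im ≠ 0) (x : ℝ) :
    DifferentiableAt ℂ (fun w => weylSol' V d w x) z := by
  obtain ⟨B, hB⟩ := hV.exists_bound
  exact (differentiable_hillSol' hV.continuous hB 1 0 x z).add
    ((differentiableAt_floquetSlope hV hz).mul (differentiable_hillSol' hV.continuous hB 0 1 x z))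

theorem continuousAt_weylSol_uncurry (hV : IsHillPotential V d) (hz : z.im ≠ 0) (x : ℝ) :
    ContinuousAt (fun p : ℂ × ℝ => weylSol V d p.1 p.2) (z, x) := by
  obtain ⟨B, hB⟩ := hV.exists_bound
  have hm : ContinuousAt (fun p : ℂ × ℝ => floquetSlope V d (floquetMult V d p.1) p.1) (z, x) :=
    ContinuousAt.comp (f := Prod.fst) (x := (z, x))
      (g := fun w => floquetSlope V d (floquetMult V d w) w)
      (differentiableAt_floquetSlope hV hz).continuousAt continuousAt_fst
  exact (continuous_hillSol_uncurry hV.continuous hB 1 0).continuousAt.add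
    (hm.mul (continuous_hillSol_uncurry hV.continuous hB 0 1).continuousAt)

end Weyl

/-! ### Bounds for Weyl solutions that are locally uniform in the spectral parameter. -/

section WeylBounds

open Set

variable {V : ℝ → ℝ} {d : ℝ} {z ρ : ℂ}

theorem quasiperiodic_zpow {f : ℝ → ℂ} (hρ : ρ ≠ 0) (hf : ∀ x, f (x + d) = ρ * f x) (m : ℤ)
    (x : ℝ) : f (x + m * d) = ρ ^ m * f x := by
  induction m using Int.induction_on with
  | zero => simp
  | succ n ih =>
    have : x + ((n : ℤ) + 1 : ℤ) * d = (x + (n : ℤ) * d) + d := by push_cast; ring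
    rw [this, hf, ih, zpow_add_one₀ hρ]; ring
  | pred n ih =>
    have h1 : x + (-(n : ℤ) : ℤ) * d = (x + (-(n : ℤ) - 1 : ℤ) * d) + d := by push_cast; ring
    rw [h1, hf] at ih
    rw [zpow_sub_one₀ hρ]
    field_simp
    linear_combination ih

/-- A bound over one period of a quasiperiodic function with multiplier in the closed unit disc
propagates to the right. -/
theorem norm_le_of_quasiperiodic {f : ℝ → ℂ} (hd : 0 < d) (hρ : ρ ≠ 0) (hρ1 : ‖ρ‖ ≤ 1)
    (hf : ∀ x, f (x + d) = ρ * f x) {c : ℝ}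
    (hc : ∀ x, ∀ t ∈ Icc x (x + d), ‖f t‖ ≤ c * ‖f x‖) {x t : ℝ} (hxt : x ≤ t) :
    ‖f t‖ ≤ c * ‖f x‖ := by
  set n := ⌊(t - x) / d⌋₊ with hn
  have h0 : 0 ≤ (t - x) / d := div_nonneg (sub_nonneg.2 hxt) hd.le
  have h1 : n * d ≤ t - x := (le_div_iff₀ hd).1 (Nat.floor_le h0)
  have h2 : t - x < (n + 1) * d := (div_lt_iff₀ hd).1 (Nat.lt_floor_add_one _)
  have h3 : t = (t - n * d) + ((n : ℤ) : ℝ) * d := by push_cast; ring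
  rw [h3, quasiperiodic_zpow hρ hf, norm_mul, zpow_natCast, norm_pow]
  calc ‖ρ‖ ^ n * ‖f (t - n * d)‖ ≤ 1 * ‖f (t - n * d)‖ := by
        gcongr
        exact pow_le_one₀ (norm_nonneg _) hρ1
    _ = ‖f (t - n * d)‖ := one_mul _
    _ ≤ c * ‖f x‖ := hc x _ ⟨by linarith, by linarith⟩

theorem norm_le_of_quasiperiodic_of_bounds {f : ℝ → ℂ} (hd : 0 < d) (hρ : ρ ≠ 0) (hρ1 : ‖ρ‖ ≤ 1)
    (hf : ∀ x, f (x + d) = ρ * f x) {a b : ℝ} (ha : 0 < a)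
    (hab : ∀ x ∈ Icc 0 (2 * d), a ≤ ‖f x‖ ∧ ‖f x‖ ≤ b) {x t : ℝ} (hxt : x ≤ t) :
    ‖f t‖ ≤ b / a * ‖f x‖ := by
  refine norm_le_of_quasiperiodic hd hρ hρ1 hf (fun x t ht => ?_) hxt
  -- Shifting `x` into `[0, d)` takes `t ∈ [x, x + d]` into `[0, 2d]`, hence the window of two
  -- periods. The common factor `ρ ^ m` drops out of the comparison.
  obtain ⟨m, hm, -⟩ := existsUnique_sub_zsmul_mem_Ico hd x 0
  simp only [zsmul_eq_mul, zero_add] at hm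
  have e1 : x = (x - m * d) + m * d := by ring
  have e2 : t = (t - m * d) + m * d := by ring
  rw [e1, e2, quasiperiodic_zpow hρ hf, quasiperiodic_zpow hρ hf, norm_mul, norm_mul]
  have b1 := (hab (x - m * d) ⟨hm.1, by linarith [hm.2]⟩).1
  have b2 := (hab (t - m * d) ⟨by linarith [hm.1, ht.1], by linarith [hm.2, ht.2]⟩).2
  have hb : 0 ≤ b := (norm_nonneg _).trans b2
  calc ‖ρ ^ m‖ * ‖f (t - m * d)‖ ≤ ‖ρ ^ m‖ * b := by gcongr
    _ = b / a * (‖ρ ^ m‖ * a) := by field_simp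
    _ ≤ b / a * (‖ρ ^ m‖ * ‖f (x - m * d)‖) := by gcongr

/-- The solution of Hill's equation that decays at `-∞`, with value `1` at `0`. -/
noncomputable def weylMinus (V : ℝ → ℝ) (d : ℝ) (z : ℂ) (x : ℝ) : ℂ :=
  weylSol (fun x => V (-x)) d z (-x)

/-- The derivative of `weylMinus`. -/
noncomputable def weylMinus' (V : ℝ → ℝ) (d : ℝ) (z : ℂ) (x : ℝ) : ℂ :=
  -weylSol' (fun x => V (-x)) d z (-x)

/-- The Wronskian of the two decaying solutions of Hill's equation. -/
noncomputable def weylWronskian (V : ℝ → ℝ) (d : ℝ) (z : ℂ) : ℂ :=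
  weylSol V d z 0 * weylMinus' V d z 0 - weylSol' V d z 0 * weylMinus V d z 0

theorem isHillSol_weylMinus (hV : IsHillPotential V d) (hz : z.im ≠ 0) :
    IsHillSol V z (weylMinus V d z) (weylMinus' V d z) := by
  have := (isWeylSol_weylSol hV.reflect hz).hill.reflect
  simp only [neg_neg] at this
  exact this

theorem weylMinus_ne_zero (hV : IsHillPotential V d) (hz : z.im ≠ 0) (x : ℝ) :
    weylMinus V d z x ≠ 0 :=
  (isWeylSol_weylSol hV.reflect hz).ne_zero hV.reflect hz (-x)

theorem weylSol_ne_zero (hV : IsHillPotential V d) (hz : z.im ≠ 0) (x : ℝ) :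
    weylSol V d z x ≠ 0 :=
  (isWeylSol_weylSol hV hz).ne_zero hV hz x

theorem floquetMult_ne_zero (hV : IsHillPotential V d) (hz : z.im ≠ 0) : floquetMult V d z ≠ 0 :=
  (isWeylSol_weylSol hV hz).mult_ne_zero hV hz

theorem floquetMult_reflect (hV : IsHillPotential V d) (hz : z.im ≠ 0) :
    floquetMult (fun x => V (-x)) d z = floquetMult V d z :=
  (isWeylSol_weylSol hV hz).mult_reflect hV hz (isWeylSol_weylSol hV.reflect hz)

theorem weylMinus_shift (hV : IsHillPotential V d) (hz : z.im ≠ 0) (x : ℝ) :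
    weylMinus V d z (x + d) = (floquetMult V d z)⁻¹ * weylMinus V d z x ∧
      weylMinus' V d z (x + d) = (floquetMult V d z)⁻¹ * weylMinus' V d z x := by
  have h := isWeylSol_weylSol hV.reflect hz
  have h1 := h.shift (-(x + d))
  have h2 := h.shift' (-(x + d))
  rw [show -(x + d) + d = -x by ring, floquetMult_reflect hV hz] at h1 h2
  have h0 := floquetMult_ne_zero hV hz
  constructor
  · rw [weylMinus, weylMinus, h1, inv_mul_cancel_left₀ h0]
  · rw [weylMinus', weylMinus', h2, ← mul_neg, inv_mul_cancel_left₀ h0]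

theorem weylWronskian_eq (hV : IsHillPotential V d) (hz : z.im ≠ 0) (x : ℝ) :
    weylSol V d z x * weylMinus' V d z x - weylSol' V d z x * weylMinus V d z x =
      weylWronskian V d z :=
  (isWeylSol_weylSol hV hz).hill.wronskian_eq (isHillSol_weylMinus hV hz) x 0

theorem weylWronskian_ne_zero (hV : IsHillPotential V d) (hz : z.im ≠ 0) :
    weylWronskian V d z ≠ 0 :=
  (isWeylSol_weylSol hV hz).wronskian_ne_zero hV hz (isWeylSol_weylSol hV.reflect hz) 0

theorem differentiableAt_weylMinus (hV : IsHillPotential V d) (hz : z.im ≠ 0) (x : ℝ) :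
    DifferentiableAt ℂ (fun w => weylMinus V d w x) z :=
  differentiableAt_weylSol hV.reflect hz (-x)

theorem differentiableAt_weylWronskian (hV : IsHillPotential V d) (hz : z.im ≠ 0) :
    DifferentiableAt ℂ (weylWronskian V d) z :=
  ((differentiableAt_weylSol hV hz 0).mul (differentiableAt_weylSol' hV.reflect hz (-0)).neg).sub
    ((differentiableAt_weylSol' hV hz 0).mul (differentiableAt_weylMinus hV hz 0))

/-- The diagonal of the resolvent kernel of the Hill operator, up to sign. -/
noncomputable def greenDiag (V : ℝ → ℝ) (d : ℝ) (z : ℂ) (x : ℝ) : ℂ :=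
  weylSol V d z x * weylMinus V d z x / weylWronskian V d z

/-- Quantitative control of the two decaying solutions of Hill's equation. -/
structure HillBound (V : ℝ → ℝ) (d : ℝ) (z : ℂ) (c g : ℝ) : Prop where
  plus : ∀ x t, x ≤ t → ‖weylSol V d z t‖ ≤ c * ‖weylSol V d z x‖
  minus : ∀ x t, x ≤ t → ‖weylMinus V d z x‖ ≤ c * ‖weylMinus V d z t‖
  green : ∀ x, ‖greenDiag V d z x‖ ≤ g

theorem HillBound.mono {c g c₁ g₁ : ℝ} (h : HillBound V d z c g) (hc : c ≤ c₁) (hg : g ≤ g₁) :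
    HillBound V d z c₁ g₁ :=
  ⟨fun x t hxt => (h.plus x t hxt).trans (by gcongr),
    fun x t hxt => (h.minus x t hxt).trans (by gcongr), fun x => (h.green x).trans hg⟩

theorem exists_local_weylSol_bounds (hV : IsHillPotential V d) (hz : z.im ≠ 0) {s : Set ℝ}
    (hs : IsCompact s) : ∃ a b : ℝ, 0 < a ∧
      ∀ᶠ w in 𝓝 z, ∀ x ∈ s, a ≤ ‖weylSol V d w x‖ ∧ ‖weylSol V d w x‖ ≤ b := by
  have hc : Continuous (weylSol V d z) := (isWeylSol_weylSol hV hz).hill.continuous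
  obtain ⟨b, hb⟩ := hs.exists_bound_of_continuousOn hc.continuousOn
  obtain ⟨a, ha, ha'⟩ : ∃ a : ℝ, 0 < a ∧ ∀ x ∈ s, a ≤ ‖weylSol V d z x‖ := by
    rcases s.eq_empty_or_nonempty with rfl | hne
    · exact ⟨1, one_pos, by simp⟩
    · obtain ⟨x₀, _, hx₀⟩ := hs.exists_isMinOn hne hc.norm.continuousOn
      exact ⟨_, norm_pos_iff.2 (weylSol_ne_zero hV hz x₀), fun x hx => hx₀ hx⟩
  refine ⟨a / 2, b + 1, by positivity, ?_⟩
  refine hs.eventually_forall_of_forall_eventually fun x hx => ?_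
  have hcont := (continuousAt_weylSol_uncurry hV hz x).norm
  have h1 := hcont.eventually_lt (continuousAt_const (y := b + 1)) (by
    have := hb x hx
    simp only
    linarith)
  have h2 := (continuousAt_const (y := a / 2)).eventually_lt hcont (by
    have := ha' x hx
    simp only
    linarith)
  filter_upwards [h1, h2] with p hp1 hp2
  exact ⟨hp2.le, hp1.le⟩

/-- Joint continuity and non-vanishing bound the Weyl solutions above and below on a compact set,
for all parameters near `z`, and quasiperiodicity extends the bounds to the line. The constants must
work on a whole neighbourhood so that one majorant controls the Neumann series there. -/
theorem eventually_hillBound (hV : IsHillPotential V d) (hz : z.im ≠ 0) :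
    ∃ c g : ℝ, ∀ᶠ w in 𝓝 z, HillBound V d w c g := by
  obtain ⟨a, b, ha, hab⟩ := exists_local_weylSol_bounds hV hz (isCompact_Icc (a := -(2 * d)) (b := 2 * d))
  obtain ⟨a', b', ha', hab'⟩ :=
    exists_local_weylSol_bounds hV.reflect hz (isCompact_Icc (a := -(2 * d)) (b := 2 * d))
  have hW : ∀ᶠ w in 𝓝 z, ‖weylWronskian V d z‖ / 2 < ‖weylWronskian V d w‖ :=
    (continuousAt_const).eventually_lt (differentiableAt_weylWronskian hV hz).continuousAt.norm
      (half_lt_self (norm_pos_iff.2 (weylWronskian_ne_zero hV hz)))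
  refine ⟨max (b / a) (b' / a'), b * b' / (‖weylWronskian V d z‖ / 2), ?_⟩
  filter_upwards [hab, hab', hW, isOpen_im_ne_zero.mem_nhds hz] with w h1 h2 h3 hw
  have hψ := isWeylSol_weylSol hV hw
  have hχ := isWeylSol_weylSol hV.reflect hw
  have hd := hV.pos
  have hWpos := norm_pos_iff.2 (weylWronskian_ne_zero hV hz)
  refine ⟨fun x t hxt => ?_, fun x t hxt => ?_, fun x => ?_⟩
  · refine (norm_le_of_quasiperiodic_of_bounds hd (floquetMult_ne_zero hV hw) hψ.norm_lt.le hψ.shift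
      ha (fun x hx => h1 x ⟨by linarith [hx.1], hx.2⟩) hxt).trans ?_
    gcongr
    exact le_max_left _ _
  · refine (norm_le_of_quasiperiodic_of_bounds hd (floquetMult_ne_zero hV.reflect hw)
      hχ.norm_lt.le hχ.shift
      ha' (fun x hx => h2 x ⟨by linarith [hx.1], hx.2⟩) (neg_le_neg hxt)).trans ?_
    unfold weylMinus
    gcongr
    exact le_max_right _ _
  -- The multipliers `ρ` and `ρ⁻¹` of the two factors cancel, so one period suffices.
  · have hper : Function.Periodic (greenDiag V d w) d := fun y => by
      rw [greenDiag, greenDiag, hψ.shift, (weylMinus_shift hV hw y).1]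
      have := floquetMult_ne_zero hV hw
      field_simp
    obtain ⟨y, hy, hxy⟩ := hper.exists_mem_Ico₀ hd x
    rw [hxy, greenDiag, norm_div, norm_mul]
    have b1 := (h1 y ⟨by linarith [hy.1], by linarith [hy.2]⟩).2
    have b2 := (h2 (-y) ⟨by linarith [hy.2], by linarith [hy.1]⟩).2
    have hb : 0 ≤ b := (norm_nonneg _).trans b1
    have hb' : 0 ≤ b' := (norm_nonneg _).trans b2
    unfold weylMinus
    gcongr

end WeylBounds

/-! ### A Riemann-Lebesgue lemma for complex frequencies. -/

section LargeEnergy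

open Set MeasureTheory intervalIntegral

variable {V : ℝ → ℝ} {d : ℝ}

theorem IsHillPotential.uniformContinuous (hV : IsHillPotential V d) : UniformContinuous V := by
  have hd := hV.pos
  rw [Metric.uniformContinuous_iff]
  intro ε hε
  have hK := isCompact_Icc (a := -d) (b := 2 * d)
  obtain ⟨δ, hδ, h⟩ := Metric.uniformContinuousOn_iff.1
    (hK.uniformContinuousOn_of_continuous hV.continuous.continuousOn) ε hε
  refine ⟨min δ d, lt_min hδ hd, fun {x y} hxy => ?_⟩
  obtain ⟨m, hm, -⟩ := existsUnique_sub_zsmul_mem_Ico hd x 0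
  have hx : V x = V (x - m • d) := (hV.periodic.sub_zsmul_eq m).symm
  have hy : V y = V (y - m • d) := (hV.periodic.sub_zsmul_eq m).symm
  rw [Real.dist_eq] at hxy
  have hxy' := abs_lt.1 (hxy.trans_le (min_le_right _ _))
  rw [hx, hy]
  refine h _ ⟨by linarith [hm.1], by linarith [hm.2]⟩ _
    ⟨by linarith [hm.1, hxy'.2], by linarith [hm.2, hxy'.1]⟩ ?_
  rw [Real.dist_eq, sub_sub_sub_cancel_right]
  exact hxy.trans_le (min_le_left _ _)

theorem norm_exp_two_I_mul_le {k : ℂ} (hk : 0 ≤ k.im) {t : ℝ} (ht : 0 ≤ t) :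
    ‖Complex.exp (2 * Complex.I * k * t)‖ ≤ 1 := by
  rw [Complex.norm_exp]
  refine Real.exp_le_one_iff.2 ?_
  simp
  positivity

/-- Integration by parts gains `1/(2|k|)`; the exponential has modulus at most one since `Im k ≥ 0`
and `t ≥ 0`. -/
theorem norm_integral_exp_mul_le {k : ℂ} (hk : 0 ≤ k.im) (hk0 : k ≠ 0) {d B C : ℝ} (hd : 0 ≤ d)
    {f f' : ℝ → ℂ} (hf : ∀ t, HasDerivAt f (f' t) t) (hf'c : Continuous f')
    (hB : ∀ t, ‖f t‖ ≤ B) (hC : ∀ t, ‖f' t‖ ≤ C) :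
    ‖∫ t in (0 : ℝ)..d, Complex.exp (2 * Complex.I * k * t) * f t‖ ≤ (2 * B + C * d) / ‖k‖ := by
  have hc : 2 * Complex.I * k ≠ 0 := by simp [hk0]
  have hkpos : 0 < ‖k‖ := norm_pos_iff.2 hk0
  have hE : ∀ t : ℝ, HasDerivAt (fun t : ℝ => Complex.exp (2 * Complex.I * k * t) /
      (2 * Complex.I * k)) (Complex.exp (2 * Complex.I * k * t)) t := by
    intro t
    have h1 : HasDerivAt (fun t : ℝ => 2 * Complex.I * k * (t : ℂ)) (2 * Complex.I * k) t := by
      simpa using (Complex.ofRealCLM.hasDerivAt (x := t)).const_mul (2 * Complex.I * k)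
    exact (h1.cexp.div_const _).congr_deriv (by field_simp)
  have hibp := integral_mul_deriv_eq_deriv_mul (a := 0) (b := d) (u := f) (u' := f')
    (v := fun t : ℝ => Complex.exp (2 * Complex.I * k * t) / (2 * Complex.I * k))
    (v' := fun t : ℝ => Complex.exp (2 * Complex.I * k * t)) (fun t _ => hf t) (fun t _ => hE t)
    (hf'c.intervalIntegrable _ _) (Continuous.intervalIntegrable (by fun_prop) _ _)
  have hEb : ∀ t, 0 ≤ t → ‖Complex.exp (2 * Complex.I * k * (t : ℝ)) / (2 * Complex.I * k)‖ ≤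
      1 / (2 * ‖k‖) := by
    intro t ht
    rw [norm_div]
    have : ‖2 * Complex.I * k‖ = 2 * ‖k‖ := by simp
    rw [this]
    gcongr
    exact norm_exp_two_I_mul_le hk ht
  have h1 : ‖∫ t in (0 : ℝ)..d, f' t * (Complex.exp (2 * Complex.I * k * t) /
      (2 * Complex.I * k))‖ ≤ C * (1 / (2 * ‖k‖)) * |d - 0| := by
    refine norm_integral_le_of_norm_le_const fun t ht => ?_
    rw [uIoc_of_le hd] at ht
    rw [norm_mul]
    exact mul_le_mul (hC t) (hEb t ht.1.le) (norm_nonneg _) ((norm_nonneg _).trans (hC t))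
  have h2 : ∀ t, 0 ≤ t → ‖f t * (Complex.exp (2 * Complex.I * k * (t : ℝ)) / (2 * Complex.I * k))‖ ≤
      B * (1 / (2 * ‖k‖)) := by
    intro t ht
    rw [norm_mul]
    exact mul_le_mul (hB t) (hEb t ht) (norm_nonneg _) ((norm_nonneg _).trans (hB t))
  have hB0 : 0 ≤ B := (norm_nonneg _).trans (hB 0)
  have hC0 : 0 ≤ C := (norm_nonneg _).trans (hC 0)
  simp only [mul_comm (Complex.exp _)]
  rw [hibp]
  refine (norm_sub_le _ _).trans ((add_le_add ((norm_sub_le _ _).trans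
    (add_le_add (h2 d hd) (h2 0 le_rfl))) h1).trans ?_)
  rw [sub_zero, abs_of_nonneg hd, le_div_iff₀ hkpos]
  field_simp
  nlinarith [mul_nonneg hC0 hd]

/-- A Riemann-Lebesgue lemma for complex frequencies in the upper half plane, uniform under
translation of the function. -/
theorem IsHillPotential.riemann_lebesgue (hV : IsHillPotential V d) {ε : ℝ} (hε : 0 < ε) :
    ∃ K : ℝ, ∀ k : ℂ, 0 ≤ k.im → K ≤ ‖k‖ → ∀ a : ℝ,
      ‖∫ t in (0 : ℝ)..d, Complex.exp (2 * Complex.I * k * t) * (V (t + a) : ℂ)‖ ≤ ε := by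
  have hd := hV.pos
  obtain ⟨B, hB⟩ := hV.exists_bound
  have hB0 : 0 ≤ B := (abs_nonneg _).trans (hB 0)
  have hε' : 0 < ε / (2 * d) := by positivity
  obtain ⟨h₀, hh₀, huc⟩ := Metric.uniformContinuous_iff.1 hV.uniformContinuous _ hε'
  set h := h₀ / 2 with hh
  have hpos : 0 < h := by positivity
  have hintg : ∀ a b, IntervalIntegrable V volume a b := fun a b =>
    hV.continuous.intervalIntegrable a b
  -- `V` is only continuous, so it is replaced by its moving average. This is `C¹` with bounded
  -- derivative and uniformly close to `V`; all bounds are global, hence unaffected by translation.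
  set F : ℝ → ℝ := fun x => (∫ t in x..(x + h), V t) / h with hF
  have hFV : ∀ x, |V x - F x| ≤ ε / (2 * d) := by
    intro x
    have : V x - F x = (∫ t in x..(x + h), (V x - V t)) / h := by
      rw [integral_sub (by simp) (hintg _ _), intervalIntegral.integral_const]
      simp only [hF, add_sub_cancel_left, smul_eq_mul]
      field_simp
    rw [this, abs_div, abs_of_pos hpos, div_le_iff₀ hpos]
    have := norm_integral_le_of_norm_le_const (a := x) (b := x + h) (C := ε / (2 * d))
      (f := fun t => V x - V t) (fun t ht => by
        rw [uIoc_of_le (by linarith)] at ht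
        refine (huc (a := x) (b := t) ?_).le
        rw [Real.dist_eq, abs_lt]
        constructor <;> linarith [ht.1, ht.2])
    rwa [add_sub_cancel_left, abs_of_pos hpos] at this
  have hFd : ∀ x, HasDerivAt F ((V (x + h) - V x) / h) x := by
    intro x
    have hp : ∀ y, HasDerivAt (fun u => ∫ t in (0 : ℝ)..u, V t) (V y) y := fun y =>
      integral_hasDerivAt_right (hintg _ _) (hV.continuous.stronglyMeasurableAtFilter _ _)
        hV.continuous.continuousAt
    have heq : F = fun x => ((∫ t in (0 : ℝ)..(x + h), V t) - ∫ t in (0 : ℝ)..x, V t) / h := by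
      ext x
      rw [hF, integral_interval_sub_left (hintg _ _) (hintg _ _)]
    rw [heq]
    exact (((hp (x + h)).comp_add_const x h).sub (hp x)).div_const h
  have hFb : ∀ x, |F x| ≤ B + ε / (2 * d) := fun x => by
    have h1 := hFV x
    have h2 := abs_sub_abs_le_abs_sub (F x) (V x)
    rw [abs_sub_comm] at h2
    linarith [hB x]
  have hFb' : ∀ x, |(V (x + h) - V x) / h| ≤ 2 * B / h := fun x => by
    rw [abs_div, abs_of_pos hpos]
    gcongr
    refine (abs_sub _ _).trans ?_
    linarith [hB x, hB (x + h)]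
  set M := 2 * (B + ε / (2 * d)) + 2 * B / h * d with hM
  refine ⟨max 1 (M / (ε / 2)), fun k hk hkK a => ?_⟩
  have hk1 : 1 ≤ ‖k‖ := (le_max_left _ _).trans hkK
  have hk0 : k ≠ 0 := norm_pos_iff.1 (by linarith)
  have hsplit : ∫ t in (0 : ℝ)..d, Complex.exp (2 * Complex.I * k * t) * (V (t + a) : ℂ) =
      (∫ t in (0 : ℝ)..d, Complex.exp (2 * Complex.I * k * t) * (F (t + a) : ℂ)) +
      ∫ t in (0 : ℝ)..d, Complex.exp (2 * Complex.I * k * t) * ((V (t + a) - F (t + a) : ℝ) : ℂ) := by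
    have hFc : Continuous F := continuous_iff_continuousAt.2 fun x => (hFd x).continuousAt
    have hVc := hV.continuous
    rw [← integral_add (Continuous.intervalIntegrable (by fun_prop) _ _)
      (Continuous.intervalIntegrable (by fun_prop) _ _)]
    congr 1; ext t; push_cast; ring
  have hVc := hV.continuous
  have b1 := norm_integral_exp_mul_le hk hk0 hd.le (f := fun t => (F (t + a) : ℂ))
    (f' := fun t => (((V (t + a + h) - V (t + a)) / h : ℝ) : ℂ))
    (fun t => ((hFd (t + a)).comp_add_const t a).ofReal_comp) (by fun_prop)
    (fun t => by rw [Complex.norm_real]; exact hFb _)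
    (fun t => by rw [Complex.norm_real]; exact hFb' _)
  have b2 : ‖∫ t in (0 : ℝ)..d, Complex.exp (2 * Complex.I * k * t) *
      ((V (t + a) - F (t + a) : ℝ) : ℂ)‖ ≤ ε / (2 * d) * |d - 0| := by
    refine norm_integral_le_of_norm_le_const fun t ht => ?_
    rw [uIoc_of_le hd.le] at ht
    rw [norm_mul, Complex.norm_real]
    calc _ ≤ 1 * (ε / (2 * d)) := mul_le_mul (norm_exp_two_I_mul_le hk ht.1.le) (hFV _)
            (abs_nonneg _) zero_le_one
      _ = _ := one_mul _
  have b3 : M / ‖k‖ ≤ ε / 2 := by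
    rw [div_le_iff₀ (by linarith)]
    have := (le_max_right 1 (M / (ε / 2))).trans hkK
    rw [div_le_iff₀ (by positivity)] at this
    linarith
  rw [hsplit]
  refine (norm_add_le _ _).trans ((add_le_add (b1.trans b3) b2).trans (le_of_eq ?_))
  rw [sub_zero, abs_of_pos hd]
  field_simp
  norm_num

end LargeEnergy

/-! ### Splitting a solution into right-moving and left-moving waves. -/

section LargeEnergy

open Set MeasureTheory intervalIntegral

/-- The right-moving part of a solution, with respect to the frequency `k`. -/
noncomputable def rightPart (k : ℂ) (ψ ψ' : ℝ → ℂ) (x : ℝ) : ℂ :=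
  (ψ x + ψ' x / (Complex.I * k)) / 2

/-- The left-moving part of a solution, with respect to the frequency `k`. -/
noncomputable def leftPart (k : ℂ) (ψ ψ' : ℝ → ℂ) (x : ℝ) : ℂ :=
  (ψ x - ψ' x / (Complex.I * k)) / 2

theorem rightPart_add_leftPart (k : ℂ) (ψ ψ' : ℝ → ℂ) (x : ℝ) :
    rightPart k ψ ψ' x + leftPart k ψ ψ' x = ψ x := by
  unfold rightPart leftPart; ring

variable {V : ℝ → ℝ} {d B : ℝ} {z k ρ : ℂ} {ψ ψ' : ℝ → ℂ}

theorem IsHillSol.hasDerivAt_rightPart (h : IsHillSol V z ψ ψ') (hk : k ^ 2 = z) (hk0 : k ≠ 0)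
    (x : ℝ) : HasDerivAt (rightPart k ψ ψ')
      (Complex.I * k * rightPart k ψ ψ' x + V x * ψ x / (2 * Complex.I * k)) x := by
  refine (((h.hasDerivAt x).add ((h.hasDerivAt' x).div_const _)).div_const 2).congr_deriv ?_
  unfold rightPart
  rw [← hk]
  field_simp
  linear_combination -k ^ 2 * ψ x * Complex.I_sq

theorem IsHillSol.hasDerivAt_leftPart (h : IsHillSol V z ψ ψ') (hk : k ^ 2 = z) (hk0 : k ≠ 0)
    (x : ℝ) : HasDerivAt (leftPart k ψ ψ')
      (-(Complex.I * k * leftPart k ψ ψ' x) - V x * ψ x / (2 * Complex.I * k)) x := by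
  refine (((h.hasDerivAt x).sub ((h.hasDerivAt' x).div_const _)).div_const 2).congr_deriv ?_
  unfold leftPart
  rw [← hk]
  field_simp
  linear_combination k ^ 2 * ψ x * Complex.I_sq

theorem hasDerivAt_cexp_mul (a : ℂ) (x : ℝ) :
    HasDerivAt (fun t : ℝ => Complex.exp (a * t)) (a * Complex.exp (a * x)) x := by
  have h1 : HasDerivAt (fun t : ℝ => a * (t : ℂ)) a x := by
    simpa using (Complex.ofRealCLM.hasDerivAt (x := x)).const_mul a
  exact h1.cexp.congr_deriv (by ring)

/-- The factor `exp (i k t)` removes the free evolution of the left-moving part, leaving only the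
integrated effect of the potential. -/
theorem IsHillSol.exp_mul_leftPart (hVc : Continuous V) (h : IsHillSol V z ψ ψ') (hk : k ^ 2 = z)
    (hk0 : k ≠ 0) (t : ℝ) : Complex.exp (Complex.I * k * t) * leftPart k ψ ψ' t =
      leftPart k ψ ψ' 0 -
        (∫ s in (0 : ℝ)..t, Complex.exp (Complex.I * k * s) * (V s * ψ s)) / (2 * Complex.I * k) := by
  have hd : ∀ s : ℝ, HasDerivAt (fun s : ℝ => Complex.exp (Complex.I * k * s) * leftPart k ψ ψ' s)
      (-(Complex.exp (Complex.I * k * s) * (V s * ψ s) / (2 * Complex.I * k))) s := fun s =>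
    ((hasDerivAt_cexp_mul (Complex.I * k) s).mul (h.hasDerivAt_leftPart hk hk0 s)).congr_deriv
      (by ring)
  have hc := h.continuous
  have := integral_eq_sub_of_hasDerivAt (a := 0) (b := t) (fun s _ => hd s)
    (Continuous.intervalIntegrable (by fun_prop) _ _)
  rw [intervalIntegral.integral_neg, intervalIntegral.integral_div] at this
  simp only [Complex.ofReal_zero, mul_zero, Complex.exp_zero, one_mul] at this
  linear_combination -this

theorem IsHillSol.exp_mul_rightPart (hVc : Continuous V) (h : IsHillSol V z ψ ψ') (hk : k ^ 2 = z)
    (hk0 : k ≠ 0) (t : ℝ) : Complex.exp (-(Complex.I * k) * t) * rightPart k ψ ψ' t =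
      rightPart k ψ ψ' 0 + (∫ s in (0 : ℝ)..t, Complex.exp (-(Complex.I * k) * s) * (V s * ψ s)) /
        (2 * Complex.I * k) := by
  have hd : ∀ s : ℝ, HasDerivAt
      (fun s : ℝ => Complex.exp (-(Complex.I * k) * s) * rightPart k ψ ψ' s)
      (Complex.exp (-(Complex.I * k) * s) * (V s * ψ s) / (2 * Complex.I * k)) s := fun s =>
    ((hasDerivAt_cexp_mul (-(Complex.I * k)) s).mul (h.hasDerivAt_rightPart hk hk0 s)).congr_deriv
      (by ring)
  have hc := h.continuous
  have := integral_eq_sub_of_hasDerivAt (a := 0) (b := t) (fun s _ => hd s)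
    (Continuous.intervalIntegrable (by fun_prop) _ _)
  rw [intervalIntegral.integral_div] at this
  simp only [Complex.ofReal_zero, mul_zero, Complex.exp_zero, one_mul] at this
  linear_combination -this

theorem norm_exp_I_mul (k : ℂ) (t : ℝ) :
    ‖Complex.exp (Complex.I * k * t)‖ = Real.exp (-(k.im * t)) := by
  rw [Complex.norm_exp]; simp

theorem norm_exp_neg_I_mul (k : ℂ) (t : ℝ) :
    ‖Complex.exp (-(Complex.I * k) * t)‖ = Real.exp (k.im * t) := by
  rw [Complex.norm_exp]; simp

theorem norm_two_I_mul (k : ℂ) : ‖2 * Complex.I * k‖ = 2 * ‖k‖ := by simp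

/-- Over one period a solution differs from a free wave by a term of relative order `1/k`. -/
theorem IsHillSol.norm_sub_free_le (hVc : Continuous V) (hB : ∀ x, |V x| ≤ B) (hd : 0 < d)
    (h : IsHillSol V z ψ ψ') (hk : k ^ 2 = z) (hk0 : k ≠ 0) (him : 0 ≤ k.im)
    (hkB : 2 * B * d ≤ ‖k‖) {t : ℝ} (ht : t ∈ Icc 0 d) :
    ‖Complex.exp (Complex.I * k * t) * ψ t -
      (Complex.exp (2 * Complex.I * k * t) * rightPart k ψ ψ' 0 + leftPart k ψ ψ' 0)‖ ≤
      2 * B * d / ‖k‖ * (‖rightPart k ψ ψ' 0‖ + ‖leftPart k ψ ψ' 0‖) := by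
  have hB0 : 0 ≤ B := (abs_nonneg _).trans (hB 0)
  have hkpos : 0 < ‖k‖ := norm_pos_iff.2 hk0
  set S := ‖rightPart k ψ ψ' 0‖ + ‖leftPart k ψ ψ' 0‖ with hS
  -- A bootstrap: the deviation from the free wave is bounded by the maximum `M` of the rescaled
  -- solution over the period, and `M` is afterwards bounded by the data at `0`.
  obtain ⟨t₀, ht₀, hmax⟩ := (isCompact_Icc (a := 0) (b := d)).exists_isMaxOn
    (nonempty_Icc.2 hd.le) (f := fun t => Real.exp (-(k.im * t)) * ‖ψ t‖)
    (by have := h.continuous; fun_prop)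
  set M := Real.exp (-(k.im * t₀)) * ‖ψ t₀‖ with hM
  have hMle : ∀ s ∈ Icc 0 d, Real.exp (-(k.im * s)) * ‖ψ s‖ ≤ M := fun s hs => hmax hs
  have hM0 : 0 ≤ M := by positivity
  have hVψ : ∀ s, ‖(V s : ℂ) * ψ s‖ ≤ B * ‖ψ s‖ := fun s => by
    rw [norm_mul, Complex.norm_real]
    gcongr
    exact hB s
  have hL : ∀ t ∈ Icc 0 d, ‖(∫ s in (0 : ℝ)..t, Complex.exp (Complex.I * k * s) * (V s * ψ s)) /
      (2 * Complex.I * k)‖ ≤ B * d / (2 * ‖k‖) * M := by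
    intro t ht
    rw [norm_div, norm_two_I_mul]
    have := norm_integral_le_of_norm_le_const (a := 0) (b := t) (C := B * M)
      (f := fun s => Complex.exp (Complex.I * k * s) * (V s * ψ s)) (fun s hs => by
        rw [uIoc_of_le ht.1] at hs
        rw [norm_mul, norm_exp_I_mul]
        calc Real.exp (-(k.im * s)) * ‖(V s : ℂ) * ψ s‖
            ≤ Real.exp (-(k.im * s)) * (B * ‖ψ s‖) := by gcongr; exact hVψ s
          _ = B * (Real.exp (-(k.im * s)) * ‖ψ s‖) := by ring
          _ ≤ B * M := by gcongr; exact hMle s ⟨hs.1.le, hs.2.trans ht.2⟩)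
    rw [sub_zero, abs_of_nonneg ht.1] at this
    calc _ ≤ B * M * t / (2 * ‖k‖) := by gcongr
      _ ≤ B * M * d / (2 * ‖k‖) := by gcongr; exact ht.2
      _ = _ := by ring
  have hU : ∀ t ∈ Icc 0 d, ‖Complex.exp (2 * Complex.I * k * t) *
      ((∫ s in (0 : ℝ)..t, Complex.exp (-(Complex.I * k) * s) * (V s * ψ s)) /
      (2 * Complex.I * k))‖ ≤ B * d / (2 * ‖k‖) * M := by
    intro t ht
    rw [norm_mul, norm_div, norm_two_I_mul]
    have hexp : ‖Complex.exp (2 * Complex.I * k * t)‖ = Real.exp (-(2 * k.im * t)) := by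
      rw [Complex.norm_exp]; simp
    have := norm_integral_le_of_norm_le_const (a := 0) (b := t)
      (C := Real.exp (2 * k.im * t) * (B * M))
      (f := fun s => Complex.exp (-(Complex.I * k) * s) * (V s * ψ s)) (fun s hs => by
        rw [uIoc_of_le ht.1] at hs
        rw [norm_mul, norm_exp_neg_I_mul]
        calc Real.exp (k.im * s) * ‖(V s : ℂ) * ψ s‖
            ≤ Real.exp (k.im * s) * (B * ‖ψ s‖) := by gcongr; exact hVψ s
          _ = Real.exp (2 * k.im * s) * (B * (Real.exp (-(k.im * s)) * ‖ψ s‖)) := by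
              rw [show k.im * s = 2 * k.im * s + -(k.im * s) by ring, Real.exp_add,
                show 2 * k.im * s + -(k.im * s) = k.im * s by ring]
              ring
          _ ≤ Real.exp (2 * k.im * t) * (B * M) := by
              gcongr
              · exact hs.2
              · exact hMle s ⟨hs.1.le, hs.2.trans ht.2⟩)
    rw [sub_zero, abs_of_nonneg ht.1] at this
    rw [hexp]
    calc _ ≤ Real.exp (-(2 * k.im * t)) *
          (Real.exp (2 * k.im * t) * (B * M) * t / (2 * ‖k‖)) := by gcongr
      _ = (Real.exp (-(2 * k.im * t)) * Real.exp (2 * k.im * t)) * (B * M * t / (2 * ‖k‖)) := by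
          ring
      _ = B * M * t / (2 * ‖k‖) := by rw [← Real.exp_add]; simp
      _ ≤ B * M * d / (2 * ‖k‖) := by gcongr; exact ht.2
      _ = _ := by ring
  have hkey : ∀ t ∈ Icc 0 d, ‖Complex.exp (Complex.I * k * t) * ψ t -
      (Complex.exp (2 * Complex.I * k * t) * rightPart k ψ ψ' 0 + leftPart k ψ ψ' 0)‖ ≤
      B * d / ‖k‖ * M := by
    intro t ht
    have e1 := h.exp_mul_leftPart hVc hk hk0 t
    have e2 := h.exp_mul_rightPart hVc hk hk0 t
    have e3 : Complex.exp (Complex.I * k * t) = Complex.exp (2 * Complex.I * k * t) *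
        Complex.exp (-(Complex.I * k) * t) := by
      rw [← Complex.exp_add]; congr 1; ring
    have : Complex.exp (Complex.I * k * t) * ψ t -
      (Complex.exp (2 * Complex.I * k * t) * rightPart k ψ ψ' 0 + leftPart k ψ ψ' 0) =
      Complex.exp (2 * Complex.I * k * t) *
      ((∫ s in (0 : ℝ)..t, Complex.exp (-(Complex.I * k) * s) * (V s * ψ s)) /
      (2 * Complex.I * k)) - (∫ s in (0 : ℝ)..t, Complex.exp (Complex.I * k * s) * (V s * ψ s)) /
      (2 * Complex.I * k) := by
      rw [← rightPart_add_leftPart k ψ ψ' t]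
      linear_combination e1 + Complex.exp (2 * Complex.I * k * t) * e2 +
        rightPart k ψ ψ' t * e3
    rw [this]
    refine (norm_sub_le _ _).trans ((add_le_add (hU t ht) (hL t ht)).trans (le_of_eq ?_))
    field_simp
    ring
  -- At the maximum point `M ≤ S + (B d / |k|) M`, where the factor is at most one half since `2 B d
  -- ≤ |k|`.
  have hMS : M ≤ 2 * S := by
    have h1 : M ≤ S + B * d / ‖k‖ * M := by
      have e : ‖Complex.exp (Complex.I * k * t₀) * ψ t₀‖ = M := by
        rw [norm_mul, norm_exp_I_mul]
      have h2 := hkey t₀ ht₀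
      have h3 := norm_le_norm_add_norm_sub' (Complex.exp (Complex.I * k * t₀) * ψ t₀)
        (Complex.exp (2 * Complex.I * k * t₀) * rightPart k ψ ψ' 0 + leftPart k ψ ψ' 0)
      rw [e] at h3
      have h4 : ‖Complex.exp (2 * Complex.I * k * t₀) * rightPart k ψ ψ' 0 + leftPart k ψ ψ' 0‖ ≤
          S := by
        refine (norm_add_le _ _).trans ?_
        rw [norm_mul, hS]
        gcongr
        exact mul_le_of_le_one_left (norm_nonneg _) (norm_exp_two_I_mul_le him ht₀.1)
      linarith
    have h2 : B * d / ‖k‖ ≤ 1 / 2 := by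
      rw [div_le_iff₀ hkpos]; linarith
    nlinarith
  refine (hkey t ht).trans ?_
  calc B * d / ‖k‖ * M ≤ B * d / ‖k‖ * (2 * S) := by gcongr
    _ = _ := by ring

end LargeEnergy

/-! ### The left-moving part of a decaying solution is small at high energy. -/

section LargeEnergy

open Set MeasureTheory intervalIntegral

variable {V : ℝ → ℝ} {d B : ℝ} {z k ρ : ℂ} {ψ ψ' : ℝ → ℂ}

theorem one_sub_exp_neg_ge {s : ℝ} (hs : 0 ≤ s) : s / (1 + s) ≤ 1 - Real.exp (-s) := by
  have h1 : 1 + s ≤ Real.exp s := by linarith [Real.add_one_le_exp s]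
  have h2 : Real.exp (-s) ≤ 1 / (1 + s) := by
    rw [Real.exp_neg, inv_eq_one_div]
    gcongr
  have h3 : s / (1 + s) = 1 - 1 / (1 + s) := by field_simp; ring
  linarith

/-- The real part already suffices. With `κ = Im k`, `|ρ exp (i k d)| ≤ exp (-κ d)`, while for real
`v` the real part of `v / (2 i k)` is only `-v κ / (2|k|²)` and is absorbed by half of `1 - exp (-κ
d)`. A non-real mean value would contribute at the competing order `1/|k|`. -/
theorem norm_resonance_ge {δ v : ℝ} (hd : 0 < d) (hB : 0 ≤ B) (hρ : ‖ρ‖ ≤ 1) (him : 0 < k.im)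
    (hδk : δ / 2 ≤ k.im * ‖k‖) (hv : |v| ≤ B * d) (hk1 : 1 ≤ ‖k‖)
    (hkB : B + B * d ≤ ‖k‖) (hkδ : δ * d / 2 ≤ ‖k‖) :
    δ * d / 8 ≤
      ‖k‖ * ‖1 - ρ * Complex.exp (Complex.I * k * d) - v / (2 * Complex.I * k)‖ := by
  have hkpos : 0 < ‖k‖ := by linarith
  have hk0 : k ≠ 0 := norm_pos_iff.1 hkpos
  set κ := k.im with hκ
  have hκk : κ ≤ ‖k‖ := (le_abs_self _).trans (Complex.abs_im_le_norm k)
  have h1 : ‖ρ * Complex.exp (Complex.I * k * d)‖ ≤ Real.exp (-(κ * d)) := by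
    rw [norm_mul, norm_exp_I_mul]
    exact mul_le_of_le_one_left (Real.exp_pos _).le hρ
  have h2 : ((v : ℂ) / (2 * Complex.I * k)).re = -(v * κ / (2 * ‖k‖ ^ 2)) := by
    have : (v : ℂ) / (2 * Complex.I * k) = ((v / 2 : ℝ) : ℂ) * (-Complex.I * k⁻¹) := by
      field_simp
      push_cast
      linear_combination (v : ℂ) * Complex.I_sq
    rw [this, Complex.re_ofReal_mul, Complex.mul_re, Complex.inv_re, Complex.inv_im,
      Complex.normSq_eq_norm_sq]
    simp
    field_simp
    rfl
  have h3 : 1 - Real.exp (-(κ * d)) - B * d * κ / (2 * ‖k‖ ^ 2) ≤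
      ‖1 - ρ * Complex.exp (Complex.I * k * d) - v / (2 * Complex.I * k)‖ := by
    refine le_trans ?_ (Complex.re_le_norm _)
    rw [Complex.sub_re, Complex.sub_re, Complex.one_re, h2]
    have h4 := (Complex.re_le_norm _).trans h1
    have h5 : -(B * d * κ / (2 * ‖k‖ ^ 2)) ≤ v * κ / (2 * ‖k‖ ^ 2) := by
      rw [← neg_div]
      gcongr
      nlinarith [(abs_le.1 hv).1]
    linarith
  have h4 := one_sub_exp_neg_ge (mul_pos him hd).le
  have h5 : B * d * κ / (2 * ‖k‖ ^ 2) ≤ κ * d / (1 + κ * d) / 2 := by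
    rw [div_div, div_le_div_iff₀ (by positivity) (by positivity)]
    have h6 : B * (1 + κ * d) ≤ ‖k‖ ^ 2 := by
      have : B * (1 + κ * d) ≤ B * (1 + ‖k‖ * d) := by gcongr
      have : B * (1 + ‖k‖ * d) ≤ (B + B * d) * ‖k‖ := by nlinarith [mul_nonneg hB hd.le]
      nlinarith
    have h7 : 0 ≤ κ * d := by positivity
    nlinarith [mul_le_mul_of_nonneg_left h6 h7]
  have h6 : κ * d / (1 + κ * d) / 2 ≤
      ‖1 - ρ * Complex.exp (Complex.I * k * d) - v / (2 * Complex.I * k)‖ := by linarith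
  refine le_trans ?_ (mul_le_mul_of_nonneg_left h6 hkpos.le)
  -- For small `κ d` the bound comes from `κ |k| ≥ δ / 2`; otherwise `1 - exp (-κ d)` is bounded
  -- below and the size of `|k|` is enough.
  rcases le_total (κ * d) 1 with h | h
  · have : κ * d / 2 / 2 ≤ κ * d / (1 + κ * d) / 2 := by
      gcongr
      linarith
    calc δ * d / 8 = (δ / 2) * d / 4 := by ring
      _ ≤ (κ * ‖k‖) * d / 4 := by gcongr
      _ = ‖k‖ * (κ * d / 2 / 2) := by ring
      _ ≤ _ := by gcongr
  · have : (1 : ℝ) / 2 / 2 ≤ κ * d / (1 + κ * d) / 2 := by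
      gcongr ?_ / 2
      rw [div_le_div_iff₀ (by norm_num) (by positivity)]
      linarith
    calc δ * d / 8 = (δ * d / 2) * (1 / 2 / 2) := by ring
      _ ≤ ‖k‖ * (1 / 2 / 2) := by gcongr
      _ ≤ _ := by gcongr

theorem half_im_le {δ : ℝ} (hk : k ^ 2 = z) (him : 0 < k.im) (hz : δ ≤ |z.im|) :
    δ / 2 ≤ k.im * ‖k‖ := by
  have h1 : z.im = 2 * (k.re * k.im) := by
    rw [← hk, pow_two, Complex.mul_im]; ring
  rw [h1, abs_mul, abs_mul, abs_of_pos him, abs_two] at hz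
  have := Complex.abs_re_le_norm k
  nlinarith

/-- Integrating the left-moving equation over one period and using quasiperiodicity gives a scalar
equation for `L`. Its coefficient is at least of order `1/|k|`. On the right, also divided by `k`,
stand a Riemann-Lebesgue integral times `U` and a remainder that is itself `O(1/|k|)`. -/
theorem IsHillSol.leftPart_le (hVc : Continuous V) (hB : ∀ x, |V x| ≤ B) (hd : 0 < d)
    (h : IsHillSol V z ψ ψ') (hk : k ^ 2 = z) (him : 0 < k.im) (hρ : ‖ρ‖ ≤ 1)
    (h0 : ψ d = ρ * ψ 0) (h0' : ψ' d = ρ * ψ' 0) {δ η : ℝ} (hδ : 0 < δ) (hz : δ ≤ |z.im|)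
    (hη : 0 < η) (hη1 : η ≤ 1)
    (hRL : ‖∫ t in (0 : ℝ)..d, Complex.exp (2 * Complex.I * k * t) * (V t : ℂ)‖ ≤ δ * d / 16 * η)
    (hk1 : 1 ≤ ‖k‖) (hkB : B + B * d ≤ ‖k‖) (hkδ : δ * d / 2 ≤ ‖k‖) (hkB' : 2 * B * d ≤ ‖k‖)
    (hkη : 32 * B ^ 2 * d / (δ * η) ≤ ‖k‖) :
    ‖leftPart k ψ ψ' 0‖ ≤ η * ‖rightPart k ψ ψ' 0‖ := by
  have hB0 : 0 ≤ B := (abs_nonneg _).trans (hB 0)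
  have hkpos : 0 < ‖k‖ := by linarith
  have hk0 : k ≠ 0 := norm_pos_iff.1 hkpos
  set L := leftPart k ψ ψ' 0 with hL
  set U := rightPart k ψ ψ' 0 with hU
  have hψc := h.continuous
  have hLd : leftPart k ψ ψ' d = ρ * L := by
    rw [hL]; unfold leftPart; rw [h0, h0']; ring
  have e1 := h.exp_mul_leftPart hVc hk hk0 d
  rw [hLd, ← hL] at e1
  set R : ℝ → ℂ := fun t => Complex.exp (Complex.I * k * t) * ψ t -
      (Complex.exp (2 * Complex.I * k * t) * U + L) with hR
  have hRc : Continuous R := by rw [hR]; fun_prop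
  have e2 : ∫ s in (0 : ℝ)..d, Complex.exp (Complex.I * k * s) * (V s * ψ s) =
      U * (∫ t in (0 : ℝ)..d, Complex.exp (2 * Complex.I * k * t) * (V t : ℂ)) +
      L * (∫ t in (0 : ℝ)..d, (V t : ℂ)) + ∫ t in (0 : ℝ)..d, (V t : ℂ) * R t := by
    rw [← intervalIntegral.integral_const_mul, ← intervalIntegral.integral_const_mul,
      ← integral_add (Continuous.intervalIntegrable (by fun_prop) _ _)
      (Continuous.intervalIntegrable (by fun_prop) _ _),
      ← integral_add (Continuous.intervalIntegrable (by fun_prop) _ _)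
      (Continuous.intervalIntegrable (by fun_prop) _ _)]
    congr 1; ext t
    rw [hR]; ring
  rw [intervalIntegral.integral_ofReal] at e2
  set v := ∫ t in (0 : ℝ)..d, V t with hv
  have hvB : |v| ≤ B * d := by
    have := norm_integral_le_of_norm_le_const (a := 0) (b := d) (C := B) (f := V)
      (fun t _ => hB t)
    rwa [sub_zero, abs_of_pos hd] at this
  have hRb : ‖∫ t in (0 : ℝ)..d, (V t : ℂ) * R t‖ ≤ B * (2 * B * d / ‖k‖ * (‖U‖ + ‖L‖)) * d := by
    have := norm_integral_le_of_norm_le_const (a := 0) (b := d)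
      (C := B * (2 * B * d / ‖k‖ * (‖U‖ + ‖L‖))) (f := fun t => (V t : ℂ) * R t)
      (fun t ht => by
        rw [uIoc_of_le hd.le] at ht
        rw [norm_mul, Complex.norm_real]
        exact mul_le_mul (hB t) (h.norm_sub_free_le hVc hB hd hk hk0 him.le hkB' ⟨ht.1.le, ht.2⟩)
          (norm_nonneg _) hB0)
    rwa [sub_zero, abs_of_pos hd] at this
  set I₁ := ∫ t in (0 : ℝ)..d, Complex.exp (2 * Complex.I * k * t) * (V t : ℂ) with hI₁
  set I₂ := ∫ t in (0 : ℝ)..d, (V t : ℂ) * R t with hI₂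
  -- The free wave `exp (2 i k t) U + L` is inserted into the integral: its non-oscillating part
  -- contributes the mean `v` of `V`, which moves to the left-hand side.
  have e3 : L * (1 - ρ * Complex.exp (Complex.I * k * d) - v / (2 * Complex.I * k)) =
      (U * I₁ + I₂) / (2 * Complex.I * k) := by
    rw [e2] at e1
    linear_combination -e1
  have h1 := norm_resonance_ge hd hB0 hρ him (half_im_le hk him hz) hvB hk1 hkB hkδ
  set D := 1 - ρ * Complex.exp (Complex.I * k * d) - v / (2 * Complex.I * k) with hD
  have h2 : ‖L‖ * (‖k‖ * ‖D‖) ≤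
      (‖U‖ * (δ * d / 16 * η) + B * (2 * B * d / ‖k‖ * (‖U‖ + ‖L‖)) * d) / 2 := by
    have := congrArg norm e3
    rw [norm_mul, norm_div, norm_two_I_mul, eq_div_iff (by positivity)] at this
    have h3 : ‖U * I₁ + I₂‖ ≤ ‖U‖ * (δ * d / 16 * η) +
        B * (2 * B * d / ‖k‖ * (‖U‖ + ‖L‖)) * d := by
      refine (norm_add_le _ _).trans (add_le_add ?_ hRb)
      rw [norm_mul]
      gcongr
    linarith
  have h3 : B * (2 * B * d / ‖k‖ * (‖U‖ + ‖L‖)) * d ≤ δ * d / 16 * η * (‖U‖ + ‖L‖) := by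
    have : B * (2 * B * d / ‖k‖) * d ≤ δ * d / 16 * η := by
      rw [div_le_iff₀ (by positivity)] at hkη
      have : B * (2 * B * d / ‖k‖) * d = 2 * B ^ 2 * d * d / ‖k‖ := by ring
      rw [this, div_le_iff₀ hkpos]
      nlinarith
    calc _ = B * (2 * B * d / ‖k‖) * d * (‖U‖ + ‖L‖) := by ring
      _ ≤ _ := by gcongr
  have h4 : ‖L‖ * (δ * d / 8) ≤ ‖L‖ * (‖k‖ * ‖D‖) := by gcongr
  have h5 : (δ * d) * ‖L‖ ≤ (δ * d) * (η * ‖U‖) := by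
    have : (δ * d) * (η * ‖L‖) ≤ (δ * d) * (1 * ‖L‖) := by gcongr
    nlinarith [norm_nonneg L, norm_nonneg U, mul_pos hδ hd]
  exact le_of_mul_le_mul_left h5 (by positivity)

/-- At high energy, away from the real axis, the Weyl solution is a right-moving wave up to a small
relative error, uniformly in the base point. -/
theorem IsHillPotential.exists_leftPart_le (hV : IsHillPotential V d) {δ η : ℝ} (hδ : 0 < δ)
    (hη : 0 < η) (hη1 : η ≤ 1) :
    ∃ K : ℝ, 1 ≤ K ∧ ∀ z k : ℂ, k ^ 2 = z → 0 < k.im → δ ≤ |z.im| → K ≤ ‖k‖ → ∀ x,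
      ‖leftPart k (weylSol V d z) (weylSol' V d z) x‖ ≤
        η * ‖rightPart k (weylSol V d z) (weylSol' V d z) x‖ := by
  have hd := hV.pos
  obtain ⟨B, hB⟩ := hV.exists_bound
  obtain ⟨K₀, hK₀⟩ := hV.riemann_lebesgue (by positivity : 0 < δ * d / 16 * η)
  refine ⟨max 1 (max K₀ (max (B + B * d) (max (δ * d / 2) (max (2 * B * d)
    (32 * B ^ 2 * d / (δ * η)))))), le_max_left _ _, fun z k hk him hz hkK x => ?_⟩
  simp only [max_le_iff] at hkK
  obtain ⟨h1, h2, h3, h4, h5, h6⟩ := hkK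
  have hzim : z.im ≠ 0 := fun h0 => by rw [h0, abs_zero] at hz; linarith
  have hψ := isWeylSol_weylSol hV hzim
  -- The one-period estimate is stated at the base point `0`; translating the potential moves it to
  -- `x` with the same constants.
  have := (hψ.hill.translate x).leftPart_le (V := fun t => V (t + x)) (hV.translate x).continuous
    (fun t => hB (t + x)) hd hk him (floquetMult_spec hV hzim).1.le
    (by rw [add_comm d x, hψ.shift, zero_add])
    (by rw [add_comm d x, hψ.shift', zero_add])
    hδ hz hη hη1 (hK₀ k him.le h2 x) h1 h3 h4 h5 h6
  simpa [leftPart, rightPart] using this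

end LargeEnergy

/-! ### High-energy control of the Weyl solutions, the Wronskian and the Green function. -/

section LargeEnergy

open Set MeasureTheory

variable {V : ℝ → ℝ} {d B : ℝ} {z k ρ : ℂ} {ψ ψ' : ℝ → ℂ}

theorem norm_le_of_leftPart_le {x : ℝ} (h : ‖leftPart k ψ ψ' x‖ ≤ 1 / 2 * ‖rightPart k ψ ψ' x‖) :
    ‖ψ x‖ ≤ 3 / 2 * ‖rightPart k ψ ψ' x‖ ∧ ‖rightPart k ψ ψ' x‖ ≤ 2 * ‖ψ x‖ := by
  rw [← rightPart_add_leftPart k ψ ψ' x]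
  have h1 := norm_add_le (rightPart k ψ ψ' x) (leftPart k ψ ψ' x)
  have h2 := norm_sub_norm_le (rightPart k ψ ψ' x) (-leftPart k ψ ψ' x)
  rw [sub_neg_eq_add, norm_neg] at h2
  constructor <;> linarith

/-- An energy estimate: the free evolution does not increase `|U|²` since `Im k ≥ 0`, and the
potential adds at most `2 · 3/4 · |U|²` to its derivative. The resulting growth rate is independent
of `k`. -/
theorem IsHillSol.norm_rightPart_le (hB : ∀ x, |V x| ≤ B) (h : IsHillSol V z ψ ψ')
    (hk : k ^ 2 = z) (hk0 : k ≠ 0) (him : 0 ≤ k.im) (hkB : B ≤ ‖k‖)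
    (hL : ∀ x, ‖leftPart k ψ ψ' x‖ ≤ 1 / 2 * ‖rightPart k ψ ψ' x‖) {x t : ℝ} (hxt : x ≤ t) :
    ‖rightPart k ψ ψ' t‖ ≤ Real.exp (t - x) * ‖rightPart k ψ ψ' x‖ := by
  have hkpos : 0 < ‖k‖ := norm_pos_iff.2 hk0
  set U := rightPart k ψ ψ' with hU
  have hUd := h.hasDerivAt_rightPart hk hk0
  set D : ℝ → ℂ := fun x => Complex.I * k * U x + V x * ψ x / (2 * Complex.I * k) with hD
  have hn : ∀ y, HasDerivAt (fun y => ‖U y‖ ^ 2) (2 * (starRingEnd ℂ (U y) * D y).re) y := by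
    intro y
    have h1 := ((hUd y).star.mul (hUd y))
    have h2 := Complex.reCLM.hasFDerivAt.comp_hasDerivAt y h1
    have h3 : (fun y => ‖U y‖ ^ 2) = fun y => Complex.reCLM (star (U y) * U y) := by
      ext y
      rw [Complex.reCLM_apply, ← Complex.normSq_eq_norm_sq, Complex.star_def,
        ← Complex.normSq_eq_conj_mul_self, Complex.ofReal_re]
    rw [h3]
    refine h2.congr_deriv ?_
    simp only [Complex.reCLM_apply, Complex.star_def]
    change (starRingEnd ℂ (D y) * U y + starRingEnd ℂ (U y) * D y).re = _
    simp only [Complex.add_re, Complex.mul_re, Complex.conj_re, Complex.conj_im]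
    ring
  have hDle : ∀ y, (starRingEnd ℂ (U y) * D y).re ≤ ‖U y‖ ^ 2 := by
    intro y
    have e : starRingEnd ℂ (U y) * D y = ((‖U y‖ ^ 2 : ℝ) : ℂ) * (Complex.I * k) +
        starRingEnd ℂ (U y) * (V y * ψ y / (2 * Complex.I * k)) := by
      rw [← Complex.normSq_eq_norm_sq, Complex.normSq_eq_conj_mul_self, hD]; ring
    rw [e, Complex.add_re, Complex.re_ofReal_mul]
    have h1 : (Complex.I * k).re = -k.im := by simp
    have h2 : (starRingEnd ℂ (U y) * (V y * ψ y / (2 * Complex.I * k))).re ≤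
        ‖U y‖ * (‖k‖ * (3 / 2 * ‖U y‖) / (2 * ‖k‖)) := by
      refine (Complex.re_le_norm _).trans ?_
      rw [norm_mul, RCLike.norm_conj, norm_div, norm_two_I_mul, norm_mul, Complex.norm_real]
      gcongr
      · exact (hB y).trans hkB
      · exact (norm_le_of_leftPart_le (hL y)).1
    have h3 : ‖U y‖ * (‖k‖ * (3 / 2 * ‖U y‖) / (2 * ‖k‖)) = 3 / 4 * ‖U y‖ ^ 2 := by
      field_simp; ring
    rw [h1]
    nlinarith [mul_nonneg (sq_nonneg ‖U y‖) him, sq_nonneg ‖U y‖]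
  have hanti : Antitone fun y => Real.exp (-2 * y) * ‖U y‖ ^ 2 := by
    have hd : ∀ y, HasDerivAt (fun y => Real.exp (-2 * y) * ‖U y‖ ^ 2)
        (Real.exp (-2 * y) * (2 * (starRingEnd ℂ (U y) * D y).re - 2 * ‖U y‖ ^ 2)) y := by
      intro y
      have h1 : HasDerivAt (fun y : ℝ => Real.exp (-2 * y)) (Real.exp (-2 * y) * (-2 * 1)) y :=
        ((hasDerivAt_id y).const_mul (-2)).exp
      exact (h1.mul (hn y)).congr_deriv (by ring)
    refine antitone_of_deriv_nonpos (fun y => (hd y).differentiableAt) fun y => ?_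
    rw [(hd y).deriv]
    exact mul_nonpos_of_nonneg_of_nonpos (Real.exp_pos _).le (by linarith [hDle y])
  have h1 := hanti hxt
  simp only at h1
  have h2 : ‖U t‖ ^ 2 ≤ (Real.exp (t - x) * ‖U x‖) ^ 2 := by
    have e1 : Real.exp (2 * t) * Real.exp (-2 * t) = 1 := by rw [← Real.exp_add]; simp
    have e2 : Real.exp (2 * t) * Real.exp (-2 * x) = Real.exp (t - x) ^ 2 := by
      rw [← Real.exp_add, ← Real.exp_nat_mul]; congr 1; push_cast; ring
    have := mul_le_mul_of_nonneg_left h1 (Real.exp_pos (2 * t)).le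
    rw [← mul_assoc, ← mul_assoc, e1, e2] at this
    rw [mul_pow]
    linarith
  exact (sq_le_sq₀ (norm_nonneg _) (by positivity)).1 h2

theorem norm_logDeriv_sub_le {x η : ℝ} (hη : η ≤ 1 / 2) (hk0 : k ≠ 0) (hψ : ψ x ≠ 0)
    (h : ‖leftPart k ψ ψ' x‖ ≤ η * ‖rightPart k ψ ψ' x‖) :
    ‖ψ' x / ψ x / (Complex.I * k) - 1‖ ≤ 4 * η := by
  have h' : ‖leftPart k ψ ψ' x‖ ≤ 1 / 2 * ‖rightPart k ψ ψ' x‖ :=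
    h.trans (by gcongr)
  have h1 := (norm_le_of_leftPart_le h').2
  have hψpos := norm_pos_iff.2 hψ
  have e : ψ' x / ψ x / (Complex.I * k) - 1 = -2 * leftPart k ψ ψ' x / ψ x := by
    unfold leftPart
    field_simp
    ring
  have hη0 : 0 ≤ η := by
    by_contra hc
    push Not at hc
    have := (norm_nonneg _).trans h
    have : 0 < ‖rightPart k ψ ψ' x‖ := by
      have := (norm_le_of_leftPart_le h').1
      linarith
    nlinarith
  rw [e, norm_div, norm_mul, norm_neg, Complex.norm_two, div_le_iff₀ hψpos]
  nlinarith

/-- Over one period the right-moving part grows at most by `exp d`; passing from `ψ` to `U` and back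
costs `2` and `3/2`. Later periods only add powers of a multiplier inside the disc. -/
theorem exists_plus_bound (hV : IsHillPotential V d) {δ : ℝ} (hδ : 0 < δ) :
    ∃ K : ℝ, ∀ z k : ℂ, k ^ 2 = z → 0 < k.im → δ ≤ |z.im| → K ≤ ‖k‖ → ∀ x t, x ≤ t →
      ‖weylSol V d z t‖ ≤ 3 * Real.exp d * ‖weylSol V d z x‖ := by
  obtain ⟨B, hB⟩ := hV.exists_bound
  obtain ⟨K, hK1, hK⟩ := hV.exists_leftPart_le hδ (by norm_num : (0 : ℝ) < 1 / 2) (by norm_num)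
  refine ⟨max K B, fun z k hk him hz hkK x t hxt => ?_⟩
  have hk0 : k ≠ 0 := norm_pos_iff.1 (by linarith [(le_max_left K B).trans hkK])
  have hzim : z.im ≠ 0 := fun h0 => by rw [h0, abs_zero] at hz; linarith
  have hL := hK z k hk him hz ((le_max_left _ _).trans hkK)
  have hψ := isWeylSol_weylSol hV hzim
  refine norm_le_of_quasiperiodic hV.pos (floquetMult_ne_zero hV hzim) hψ.norm_lt.le hψ.shift
    (fun x t ht => ?_) hxt
  have h1 := (norm_le_of_leftPart_le (hL t)).1
  have h2 := hψ.hill.norm_rightPart_le hB hk hk0 him.le ((le_max_right _ _).trans hkK) hL ht.1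
  have h3 := (norm_le_of_leftPart_le (hL x)).2
  calc ‖weylSol V d z t‖ ≤ 3 / 2 * (Real.exp (t - x) * (2 * ‖weylSol V d z x‖)) := by
        refine h1.trans ?_
        gcongr
        exact h2.trans (by gcongr)
    _ ≤ 3 / 2 * (Real.exp d * (2 * ‖weylSol V d z x‖)) := by
        gcongr
        linarith [ht.2]
    _ = _ := by ring

theorem wronskian_div_eq {a b : ℂ} (a' b' : ℂ) (ha : a ≠ 0) (hb : b ≠ 0) (hk0 : k ≠ 0) :
    (a * -b' - a' * b) / (a * b) / (-2 * Complex.I * k) - 1 =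
      ((a' / a / (Complex.I * k) - 1) + (b' / b / (Complex.I * k) - 1)) / 2 := by
  field_simp
  ring

/-- High-energy asymptotics of the two decaying solutions of Hill's equation. -/
theorem exists_hillBound_large (hV : IsHillPotential V d) {δ ε : ℝ} (hδ : 0 < δ) (hε : 0 < ε)
    (hε1 : ε ≤ 1 / 2) :
    ∃ K : ℝ, ∀ z k : ℂ, k ^ 2 = z → 0 < k.im → δ ≤ |z.im| → K ≤ ‖k‖ →
      HillBound V d z (3 * Real.exp d) (1 / ‖k‖) ∧
      ‖weylWronskian V d z / (-2 * Complex.I * k) - 1‖ ≤ ε := by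
  obtain ⟨K₁, hK₁⟩ := exists_plus_bound hV hδ
  obtain ⟨K₂, hK₂⟩ := exists_plus_bound hV.reflect hδ
  obtain ⟨K₃, hK₃1, hK₃⟩ := hV.exists_leftPart_le hδ (by positivity : 0 < ε / 4) (by linarith)
  obtain ⟨K₄, hK₄1, hK₄⟩ := hV.reflect.exists_leftPart_le hδ (by positivity : 0 < ε / 4) (by linarith)
  refine ⟨max K₁ (max K₂ (max K₃ K₄)), fun z k hk him hz hkK => ?_⟩
  simp only [max_le_iff] at hkK
  obtain ⟨hk₁, hk₂, hk₃, hk₄⟩ := hkK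
  have hkpos : 0 < ‖k‖ := by linarith
  have hk0 : k ≠ 0 := norm_pos_iff.1 hkpos
  have hzim : z.im ≠ 0 := fun h0 => by rw [h0, abs_zero] at hz; linarith
  have hW0 := weylWronskian_ne_zero hV hzim
  -- Divided by the product of the two solutions, the Wronskian is minus the sum of the logarithmic
  -- derivatives of `ψ` at `x` and of the reflected solution at `-x`, each close to `i k`. General
  -- `x` bounds the Green function, and `x = 0` gives the Wronskian itself.
  have hmain : ∀ x, ‖weylWronskian V d z / (weylSol V d z x * weylMinus V d z x) /
      (-2 * Complex.I * k) - 1‖ ≤ ε := by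
    intro x
    have hψ0 := weylSol_ne_zero hV hzim x
    have hχ0 : weylSol (fun x => V (-x)) d z (-x) ≠ 0 := weylMinus_ne_zero hV hzim x
    have h1 := norm_logDeriv_sub_le (by linarith) hk0 hψ0 (hK₃ z k hk him hz hk₃ x)
    have h2 := norm_logDeriv_sub_le (ψ := weylSol (fun x => V (-x)) d z)
      (ψ' := weylSol' (fun x => V (-x)) d z) (x := -x) (by linarith) hk0 hχ0
      (hK₄ z k hk him hz hk₄ (-x))
    rw [← weylWronskian_eq hV hzim x, weylMinus, weylMinus', wronskian_div_eq _ _ hψ0 hχ0 hk0,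
      norm_div, Complex.norm_two, div_le_iff₀ (by norm_num)]
    refine (norm_add_le _ _).trans ?_
    linarith
  refine ⟨⟨hK₁ z k hk him hz hk₁, fun x t hxt => ?_, fun x => ?_⟩, ?_⟩
  · exact hK₂ z k hk him hz hk₂ (-t) (-x) (neg_le_neg hxt)
  · have h1 := hmain x
    have hψ0 := weylSol_ne_zero hV hzim x
    have hχ0 := weylMinus_ne_zero hV hzim x
    have e : weylWronskian V d z / (weylSol V d z x * weylMinus V d z x) =
      (greenDiag V d z x)⁻¹ := by rw [greenDiag, inv_div]
    rw [e] at h1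
    have h2 : 1 / 2 ≤ ‖(greenDiag V d z x)⁻¹ / (-2 * Complex.I * k)‖ := by
      have := norm_sub_norm_le (1 : ℂ) (1 - (greenDiag V d z x)⁻¹ / (-2 * Complex.I * k))
      rw [sub_sub_cancel, norm_one, norm_sub_rev] at this
      linarith
    have h3 : ‖-2 * Complex.I * k‖ = 2 * ‖k‖ := by simp
    rw [norm_div, h3, norm_inv, le_div_iff₀ (by positivity)] at h2
    have hg : 0 < ‖greenDiag V d z x‖ := norm_pos_iff.2
      (div_ne_zero (mul_ne_zero hψ0 hχ0) hW0)
    rw [le_div_iff₀ hkpos]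
    have h4 : ‖k‖ ≤ ‖greenDiag V d z x‖⁻¹ := by linarith
    calc _ ≤ ‖greenDiag V d z x‖ * ‖greenDiag V d z x‖⁻¹ := by gcongr
      _ = 1 := mul_inv_cancel₀ hg.ne'
  · have h1 := hmain 0
    have e1 : weylSol V d z 0 = 1 := (isWeylSol_weylSol hV hzim).zero
    have e2 : weylMinus V d z 0 = 1 := by
      rw [weylMinus, neg_zero, (isWeylSol_weylSol hV.reflect hzim).zero]
    rwa [e1, e2, mul_one, div_one] at h1

end LargeEnergy

/-! ### The integral equation for the Plücker coordinates of the decaying plane. -/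

section Modes

open Set MeasureTheory

/-- Integrated against `exp (-β t)` over `(x, ∞)`, the weight `exp (a exp (-β t))` gains a factor
`1/(a β)`. A large `a` therefore gives a contraction on a half line with arbitrary left end, without
smallness of the coupling. -/
theorem integral_Ioi_exp_exp {a β : ℝ} (ha : 0 < a) (hβ : 0 < β) (x : ℝ) :
    IntegrableOn (fun t => Real.exp (-(β * t)) * Real.exp (a * Real.exp (-(β * t)))) (Ioi x) ∧
    ∫ t in Ioi x, Real.exp (-(β * t)) * Real.exp (a * Real.exp (-(β * t))) =
      (Real.exp (a * Real.exp (-(β * x))) - 1) / (a * β) := by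
  have hd : ∀ t ∈ Ici x, HasDerivAt (fun t => -(Real.exp (a * Real.exp (-(β * t))) / (a * β)))
      (Real.exp (-(β * t)) * Real.exp (a * Real.exp (-(β * t)))) t := by
    intro t _
    have h1 : HasDerivAt (fun t => -(β * t)) (-(β * 1)) t := ((hasDerivAt_id t).const_mul β).neg
    refine (((h1.exp.const_mul a).exp.div_const (a * β)).neg).congr_deriv ?_
    field_simp
  have hlim : Tendsto (fun t => -(Real.exp (a * Real.exp (-(β * t))) / (a * β))) atTop
      (𝓝 (-(Real.exp (a * 0) / (a * β)))) := by
    refine Tendsto.neg (Tendsto.div_const ?_ _)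
    refine (Real.continuous_exp.tendsto _).comp (Tendsto.const_mul a ?_)
    exact Real.tendsto_exp_neg_atTop_nhds_zero.comp (tendsto_id.const_mul_atTop hβ)
  refine ⟨integrableOn_Ioi_deriv_of_nonneg' hd (fun t _ => by positivity) hlim, ?_⟩
  rw [integral_Ioi_of_hasDerivAt_of_nonneg' hd (fun t _ => by positivity) hlim]
  simp only [mul_zero, Real.exp_zero]
  ring

theorem exists_bound_of_tendsto_atTop {f : ℝ → ℂ} {l : ℂ} (hf : Continuous f)
    (h : Tendsto f atTop (𝓝 l)) (X : ℝ) : ∃ M : ℝ, ∀ x, X ≤ x → ‖f x‖ ≤ M := by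
  obtain ⟨T, hT⟩ := eventually_atTop.1
    (h.norm.eventually_lt (tendsto_const_nhds (x := ‖l‖ + 1)) (by linarith))
  obtain ⟨M, hM⟩ := (isCompact_Icc (a := X) (b := T)).exists_bound_of_continuousOn hf.continuousOn
  refine ⟨max M (‖l‖ + 1), fun x hx => ?_⟩
  rcases le_total x T with h1 | h1
  · exact (hM x ⟨hx, h1⟩).trans (le_max_left _ _)
  · exact (hT x h1).le.trans (le_max_right _ _)

/-- `c` is the vector of coefficients, with respect to modes `χ`, of a solution of a perturbed
system with coupling `N`. The coupling may jump at `0`. -/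
def IsModeSol (χ : Fin 4 → ℝ → ℂ) (N : Fin 4 → Fin 4 → ℝ → ℂ) (c : ℝ → Fin 4 → ℂ) : Prop :=
  (∀ i, Continuous fun x => c x i) ∧ ∀ x, x ≠ 0 → ∀ i,
    HasDerivAt (fun x => c x i) (∑ l, N i l x * (χ l x / χ i x) * c x l) x

/-- The growth of the plane spanned by modes `i, j`, relative to the one spanned by `0, 1`. -/
noncomputable def modeRatio (χ : Fin 4 → ℝ → ℂ) (i j : Fin 4) (x : ℝ) : ℂ :=
  χ i x * χ j x / (χ 0 x * χ 1 x)

/-- Modes such that the first two decay fastest, with exponentially localized coupling. -/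
structure ModeBound (χ : Fin 4 → ℝ → ℂ) (N : Fin 4 → Fin 4 → ℝ → ℂ) (β C n : ℝ) : Prop where
  ne_zero : ∀ i x, χ i x ≠ 0
  continuous : ∀ i, Continuous (χ i)
  measurable : ∀ i l, Measurable (N i l)
  norm_le : ∀ i l x, ‖N i l x‖ ≤ n * Real.exp (-(β * x))
  ratio : ∀ i j, i ≠ j → ∀ x t, x ≤ t → ‖modeRatio χ i j x‖ ≤ C * ‖modeRatio χ i j t‖

/-- The kernel of the integral equation for the Plücker coordinates of the plane of solutions
decaying at `+∞`, on `[X, ∞)`. -/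
noncomputable def planeKernel (χ : Fin 4 → ℝ → ℂ) (N : Fin 4 → Fin 4 → ℝ → ℂ) (X x t : ℝ)
    (p q : Fin 4 × Fin 4) : ℂ :=
  if X ≤ x ∧ x < t ∧ p.1 ≠ p.2 then
    -(modeRatio χ p.1 p.2 x / modeRatio χ p.1 p.2 t) *
      ((if p.2 = q.2 then N p.1 q.1 t else 0) + (if p.1 = q.1 then N p.2 q.2 t else 0))
  else 0

/-- The Plücker coordinates of the coordinate plane spanned by modes `0` and `1`. -/
def planeLimit (p : Fin 4 × Fin 4) : ℂ :=
  (if p.1 = 0 then 1 else 0) * (if p.2 = 1 then 1 else 0) -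
    (if p.2 = 0 then 1 else 0) * (if p.1 = 1 then 1 else 0)

/-- The normalized Plücker coordinates at `X` of the plane of solutions decaying at `+∞`. -/
noncomputable def planeSol (χ : Fin 4 → ℝ → ℂ) (N : Fin 4 → Fin 4 → ℝ → ℂ) (X : ℝ) :
    ℝ → Fin 4 × Fin 4 → ℂ :=
  integralSol (planeKernel χ N X) (fun _ => planeLimit)

theorem norm_planeLimit_le (p : Fin 4 × Fin 4) : ‖planeLimit p‖ ≤ 1 := by
  obtain ⟨i, j⟩ := p
  fin_cases i <;> fin_cases j <;> simp [planeLimit]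

/-- The dominating kernel for `planeKernel`. -/
noncomputable def planeBound (β C n X x t : ℝ) : ℝ :=
  (Ioi x).indicator (fun t => if X ≤ x then 2 * C * n * Real.exp (-(β * t)) else 0) t

/-- The weight for the integral equation of the decaying plane. -/
noncomputable def planeWeight (β C n x : ℝ) : ℝ :=
  Real.exp ((64 * C * n + 1) / β * Real.exp (-(β * x)))

theorem one_le_planeWeight {β C n : ℝ} (hβ : 0 < β) (hC : 0 ≤ C) (hn : 0 ≤ n) (x : ℝ) :
    1 ≤ planeWeight β C n x := Real.one_le_exp (by positivity)

theorem integrable_planeBound_mul {β C n : ℝ} (hβ : 0 < β) (hC : 0 ≤ C) (hn : 0 ≤ n) (X x : ℝ) :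
    Integrable (fun t => planeBound β C n X x t * planeWeight β C n t) ∧
    ∫ t, planeBound β C n X x t * planeWeight β C n t ≤
      2 * C * n * ((planeWeight β C n x - 1) / (64 * C * n + 1)) := by
  have ha : 0 < (64 * C * n + 1) / β := by positivity
  obtain ⟨h1, h2⟩ := integral_Ioi_exp_exp ha hβ x
  have hrw : (fun t => planeBound β C n X x t * planeWeight β C n t) = (Ioi x).indicator
      fun t => (if X ≤ x then 2 * C * n else 0) *
        (Real.exp (-(β * t)) * Real.exp ((64 * C * n + 1) / β * Real.exp (-(β * t)))) := by
    ext t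
    unfold planeBound planeWeight
    by_cases ht : t ∈ Ioi x
    · rw [indicator_of_mem ht, indicator_of_mem ht]
      split_ifs <;> ring
    · rw [indicator_of_notMem ht, indicator_of_notMem ht, zero_mul]
  rw [hrw]
  refine ⟨(integrable_indicator_iff measurableSet_Ioi).2 (h1.const_mul _), ?_⟩
  rw [integral_indicator measurableSet_Ioi, integral_const_mul, h2,
    div_mul_cancel₀ _ hβ.ne']
  have hw := one_le_planeWeight hβ hC hn x
  change (if X ≤ x then 2 * C * n else 0) * ((planeWeight β C n x - 1) / (64 * C * n + 1)) ≤ _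
  have : 0 ≤ (planeWeight β C n x - 1) / (64 * C * n + 1) :=
    div_nonneg (by linarith) (by positivity)
  gcongr
  split_ifs
  · exact le_rfl
  · positivity

/-- There are `16` index pairs and the kernel constant is `2 C n`, so the rate `64 C n` gives the
factor one half; the `+ 1` avoids division by zero. -/
theorem planeBound_contractive {β C n : ℝ} (hβ : 0 < β) (hC : 0 ≤ C) (hn : 0 ≤ n) (X : ℝ) :
    ContractiveBound (Fin 4 × Fin 4) (planeBound β C n X) (planeWeight β C n) := by
  refine ⟨fun x => (Real.exp_pos _).le, fun x => (integrable_planeBound_mul hβ hC hn X x).1,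
    fun x => ?_⟩
  have h := (integrable_planeBound_mul hβ hC hn X x).2
  have hw := one_le_planeWeight hβ hC hn x
  have hcard : (Fintype.card (Fin 4 × Fin 4) : ℝ) = 16 := by simp
  rw [hcard]
  calc _ ≤ 16 * (2 * C * n * ((planeWeight β C n x - 1) / (64 * C * n + 1))) := by gcongr
    _ = (64 * C * n / (64 * C * n + 1)) * ((planeWeight β C n x - 1) / 2) := by ring
    _ ≤ 1 * ((planeWeight β C n x - 1) / 2) := by
        gcongr
        rw [div_le_one (by positivity)]
        linarith
    _ ≤ planeWeight β C n x / 2 := by linarith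

variable {χ : Fin 4 → ℝ → ℂ} {N : Fin 4 → Fin 4 → ℝ → ℂ} {β C n : ℝ}

namespace ModeBound

theorem coupling_nonneg (h : ModeBound χ N β C n) : 0 ≤ n := by
  have := (norm_nonneg _).trans (h.norm_le 0 0 0)
  simpa using this

theorem modeRatio_ne_zero (h : ModeBound χ N β C n) (i j : Fin 4) (x : ℝ) :
    modeRatio χ i j x ≠ 0 :=
  div_ne_zero (mul_ne_zero (h.ne_zero _ _) (h.ne_zero _ _))
    (mul_ne_zero (h.ne_zero _ _) (h.ne_zero _ _))

theorem ratio_nonneg (h : ModeBound χ N β C n) : 0 ≤ C := by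
  have h1 := h.ratio 0 1 (by decide) 0 0 le_rfl
  have h2 := norm_pos_iff.2 (h.modeRatio_ne_zero 0 1 0)
  nlinarith

theorem continuous_modeRatio (h : ModeBound χ N β C n) (i j : Fin 4) :
    Continuous (modeRatio χ i j) :=
  ((h.continuous i).mul (h.continuous j)).div ((h.continuous 0).mul (h.continuous 1))
    fun _ => mul_ne_zero (h.ne_zero _ _) (h.ne_zero _ _)

theorem norm_ratio_div_le (h : ModeBound χ N β C n) {i j : Fin 4} (hij : i ≠ j) {x t : ℝ}
    (hxt : x ≤ t) : ‖modeRatio χ i j x / modeRatio χ i j t‖ ≤ C := by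
  rw [norm_div, div_le_iff₀ (norm_pos_iff.2 (h.modeRatio_ne_zero i j t))]
  exact h.ratio i j hij x t hxt

theorem measurable_planeKernel (h : ModeBound χ N β C n) (X : ℝ) (p q : Fin 4 × Fin 4) :
    Measurable fun y : ℝ × ℝ => planeKernel χ N X y.1 y.2 p q := by
  unfold planeKernel
  refine Measurable.ite ?_ ?_ measurable_const
  · exact (measurableSet_le measurable_const measurable_fst).inter
      ((measurableSet_lt measurable_fst measurable_snd).inter (MeasurableSet.const _))
  · have h1 := (h.continuous_modeRatio p.1 p.2).measurable
    have h2 := h.measurable p.1 q.1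
    have h3 := h.measurable p.2 q.2
    refine Measurable.mul ((h1.comp measurable_fst).div (h1.comp measurable_snd)).neg ?_
    refine Measurable.add ?_ ?_
    · split_ifs
      · exact h2.comp measurable_snd
      · exact measurable_const
    · split_ifs
      · exact h3.comp measurable_snd
      · exact measurable_const

theorem norm_planeKernel_le (h : ModeBound χ N β C n) (X x t : ℝ) (p q : Fin 4 × Fin 4) :
    ‖planeKernel χ N X x t p q‖ ≤ planeBound β C n X x t := by
  have hC := h.ratio_nonneg
  have hn := h.coupling_nonneg
  unfold planeKernel planeBound
  by_cases hx : X ≤ x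
  · by_cases ht : x < t
    · rw [indicator_of_mem (mem_Ioi.2 ht), if_pos hx]
      by_cases hp : p.1 ≠ p.2
      · rw [if_pos ⟨hx, ht, hp⟩, norm_mul, norm_neg]
        have hN : ∀ (P : Prop) [Decidable P] (i l : Fin 4),
            ‖if P then N i l t else 0‖ ≤ n * Real.exp (-(β * t)) := by
          intro P _ i l
          split_ifs
          · exact h.norm_le i l t
          · rw [norm_zero]; positivity
        calc _ ≤ C * (n * Real.exp (-(β * t)) + n * Real.exp (-(β * t))) :=
              mul_le_mul (h.norm_ratio_div_le hp ht.le)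
                ((norm_add_le _ _).trans (add_le_add (hN _ _ _) (hN _ _ _))) (norm_nonneg _) hC
          _ = _ := by ring
      · rw [if_neg (fun hh => hp hh.2.2), norm_zero]; positivity
    · rw [if_neg (fun hh => ht hh.2.1), norm_zero, indicator_of_notMem (by simpa using ht)]
  · rw [if_neg (fun hh => hx hh.1), norm_zero]
    refine indicator_nonneg (fun t _ => ?_) t
    rw [if_neg hx]

/-- The solution differs from its limit by one application of the kernel, hence by `16 · 2 · 2 C n`
times the weight. The bound vanishes as the coupling `n` tends to `0` with `C` fixed, which is the
source of the limit at infinity. -/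
theorem norm_planeSol_sub_le (hβ : 0 < β) (h : ModeBound χ N β C n) (X : ℝ) (p : Fin 4 × Fin 4) :
    ‖planeSol χ N X X p - planeLimit p‖ ≤ 64 * C * n * planeWeight β C n X := by
  have hC := h.ratio_nonneg
  have hn := h.coupling_nonneg
  have hB := planeBound_contractive hβ hC hn X
  have hb : ∀ x p, ‖planeLimit p‖ ≤ planeWeight β C n x := fun x p =>
    (norm_planeLimit_le p).trans (one_le_planeWeight hβ hC hn x)
  have heq := integralSol_eq (f₀ := fun _ => planeLimit) hB (h.measurable_planeKernel X)
    (h.norm_planeKernel_le X) (fun _ => measurable_const) hb X p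
  rw [planeSol, heq, add_sub_cancel_left]
  have hsol := norm_integralSol_le (f₀ := fun _ => planeLimit) hB (h.norm_planeKernel_le X) hb
  have hintg := (integrable_planeBound_mul hβ hC hn X X)
  have hw := one_le_planeWeight hβ hC hn X
  refine (norm_sum_le _ _).trans ?_
  have hterm : ∀ q, ‖∫ t, planeKernel χ N X X t p q *
      integralSol (planeKernel χ N X) (fun _ => planeLimit) t q‖ ≤
      2 * (2 * C * n * planeWeight β C n X) := by
    intro q
    calc _ ≤ ∫ t, 2 * (planeBound β C n X X t * planeWeight β C n t) := by
          refine norm_integral_le_of_norm_le (hintg.1.const_mul 2) (Eventually.of_forall fun t => ?_)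
          rw [norm_mul]
          calc _ ≤ planeBound β C n X X t * (2 * planeWeight β C n t) :=
                mul_le_mul (h.norm_planeKernel_le X X t p q) (hsol t q) (norm_nonneg _)
                  ((norm_nonneg _).trans (h.norm_planeKernel_le X X t p q))
            _ = _ := by ring
      _ ≤ 2 * (2 * C * n * ((planeWeight β C n X - 1) / (64 * C * n + 1))) := by
          rw [integral_const_mul]
          linarith [hintg.2]
      _ ≤ 2 * (2 * C * n * planeWeight β C n X) := by
          gcongr
          rw [div_le_iff₀ (by positivity)]
          have : 0 ≤ 64 * C * n := by positivity
          nlinarith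
  refine (Finset.sum_le_sum fun q _ => hterm q).trans (le_of_eq ?_)
  rw [Finset.sum_const, Finset.card_univ, nsmul_eq_mul]
  have hcard : (Fintype.card (Fin 4 × Fin 4) : ℝ) = 16 := by simp
  rw [hcard]; ring

end ModeBound

theorem differentiableOn_planeSol {U : Set ℂ} (hU : IsOpen U) {χ : ℂ → Fin 4 → ℝ → ℂ}
    {N : ℂ → Fin 4 → Fin 4 → ℝ → ℂ} (hβ : 0 < β) (h : ∀ w ∈ U, ModeBound (χ w) (N w) β C n)
    (hχ : ∀ i x, DifferentiableOn ℂ (fun w => χ w i x) U)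
    (hN : ∀ i l x, DifferentiableOn ℂ (fun w => N w i l x) U) (X : ℝ) (p : Fin 4 × Fin 4) :
    DifferentiableOn ℂ (fun w => planeSol (χ w) (N w) X X p) U := by
  rcases U.eq_empty_or_nonempty with rfl | ⟨w₀, hw₀⟩
  · exact differentiableOn_empty
  have hC := (h w₀ hw₀).ratio_nonneg
  have hn := (h w₀ hw₀).coupling_nonneg
  refine differentiableOn_integralSol (f₀ := fun _ _ => planeLimit) hU
    (planeBound_contractive hβ hC hn X) (fun w hw => (h w hw).measurable_planeKernel X)
    (fun w hw => (h w hw).norm_planeKernel_le X) (fun _ _ _ => measurable_const)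
    (fun _ _ x p => (norm_planeLimit_le p).trans (one_le_planeWeight hβ hC hn x)) ?_
    (fun _ _ => differentiableOn_const _) X p
  intro x t p q
  have hr : ∀ x, DifferentiableOn ℂ (fun w => modeRatio (χ w) p.1 p.2 x) U := fun x =>
    ((hχ _ x).mul (hχ _ x)).div ((hχ _ x).mul (hχ _ x)) fun w hw =>
      mul_ne_zero ((h w hw).ne_zero _ _) ((h w hw).ne_zero _ _)
  unfold planeKernel
  split_ifs
  · exact ((hr x).div (hr t) fun w hw => (h w hw).modeRatio_ne_zero _ _ _).neg.mul
      ((hN _ _ t).add (hN _ _ t))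
  · exact ((hr x).div (hr t) fun w hw => (h w hw).modeRatio_ne_zero _ _ _).neg.mul
      ((hN _ _ t).add (differentiableOn_const _))
  · exact ((hr x).div (hr t) fun w hw => (h w hw).modeRatio_ne_zero _ _ _).neg.mul
      ((differentiableOn_const _).add (hN _ _ t))
  · exact ((hr x).div (hr t) fun w hw => (h w hw).modeRatio_ne_zero _ _ _).neg.mul
      (differentiableOn_const _)
  · exact differentiableOn_const _

end Modes

/-! ### Identification of the Plücker coordinates of decaying solutions. -/

section Modes

open Set MeasureTheory

variable {χ : Fin 4 → ℝ → ℂ} {N : Fin 4 → Fin 4 → ℝ → ℂ} {β C n : ℝ}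

/-- The coefficient vector `c` is asymptotic at `+∞` to the pure mode `j`. -/
def IsAsymptoticMode (χ : Fin 4 → ℝ → ℂ) (c : ℝ → Fin 4 → ℂ) (j : Fin 4) : Prop :=
  ∀ i, Tendsto (fun x => χ i x * c x i / χ j x) atTop (𝓝 (if i = j then 1 else 0))

/-- Plücker coordinates of the plane spanned by two coefficient vectors. -/
def wedgeCoord (a b : ℝ → Fin 4 → ℂ) (p : Fin 4 × Fin 4) (x : ℝ) : ℂ :=
  a x p.1 * b x p.2 - a x p.2 * b x p.1

theorem sum_planeCoupling (M : Fin 4 → Fin 4 → ℂ) (f : Fin 4 × Fin 4 → ℂ) (i j : Fin 4) :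
    ∑ q : Fin 4 × Fin 4, ((if j = q.2 then M i q.1 else 0) + (if i = q.1 then M j q.2 else 0)) *
      f q = ∑ l, (M i l * f (l, j) + M j l * f (i, l)) := by
  rw [Fintype.sum_prod_type]
  simp only [add_mul, ite_mul, zero_mul, Finset.sum_add_distrib, Finset.sum_ite_eq,
    Finset.mem_univ, if_true]
  congr 1
  rw [Finset.sum_comm]
  simp

variable {a b : ℝ → Fin 4 → ℂ}

theorem continuous_wedgeCoord (ha : ∀ i, Continuous fun x => a x i)
    (hb : ∀ i, Continuous fun x => b x i) (p : Fin 4 × Fin 4) : Continuous (wedgeCoord a b p) :=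
  ((ha _).mul (hb _)).sub ((ha _).mul (hb _))

theorem hasDerivAt_wedgeCoord (ha : IsModeSol χ N a) (hb : IsModeSol χ N b) {x : ℝ} (hx : x ≠ 0)
    (i j : Fin 4) : HasDerivAt (wedgeCoord a b (i, j))
      (∑ l, (N i l x * (χ l x / χ i x) * wedgeCoord a b (l, j) x +
        N j l x * (χ l x / χ j x) * wedgeCoord a b (i, l) x)) x := by
  refine (((ha.2 x hx i).mul (hb.2 x hx j)).sub ((ha.2 x hx j).mul (hb.2 x hx i))).congr_deriv ?_
  simp only [wedgeCoord, Fin.sum_univ_four]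
  ring

theorem ModeBound.modeRatio_mul (h : ModeBound χ N β C n) (i j l : Fin 4) (x : ℝ) :
    modeRatio χ i j x * (χ l x / χ i x) = modeRatio χ l j x := by
  have h1 := h.ne_zero i x
  have h2 := h.ne_zero 0 x
  have h3 := h.ne_zero 1 x
  unfold modeRatio
  field_simp

theorem modeRatio_comm (χ : Fin 4 → ℝ → ℂ) (i j : Fin 4) (x : ℝ) :
    modeRatio χ i j x = modeRatio χ j i x := by
  unfold modeRatio; ring

theorem ModeBound.modeRatio_mul' (h : ModeBound χ N β C n) (i j l : Fin 4) (x : ℝ) :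
    modeRatio χ i j x * (χ l x / χ j x) = modeRatio χ i l x := by
  rw [modeRatio_comm, h.modeRatio_mul, modeRatio_comm]

theorem ModeBound.tendsto_wedge (h : ModeBound χ N β C n) (ha : IsAsymptoticMode χ a 0)
    (hb : IsAsymptoticMode χ b 1) (p : Fin 4 × Fin 4) :
    Tendsto (fun x => modeRatio χ p.1 p.2 x * wedgeCoord a b p x) atTop (𝓝 (planeLimit p)) := by
  refine (((ha p.1).mul (hb p.2)).sub ((ha p.2).mul (hb p.1))).congr fun x => ?_
  have h2 := h.ne_zero 0 x
  have h3 := h.ne_zero 1 x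
  unfold modeRatio wedgeCoord
  field_simp

/-- Wherever `planeLimit` is nonzero the pair consists of `0` and `1`, and there the ratio is
identically one. -/
theorem ModeBound.ratio_mul_planeLimit (h : ModeBound χ N β C n) (p : Fin 4 × Fin 4) (x t : ℝ) :
    modeRatio χ p.1 p.2 x / modeRatio χ p.1 p.2 t * planeLimit p = planeLimit p := by
  have h01 : ∀ x, modeRatio χ 0 1 x = 1 := fun x =>
    div_self (mul_ne_zero (h.ne_zero 0 x) (h.ne_zero 1 x))
  have h10 : ∀ x, modeRatio χ 1 0 x = 1 := fun x => by rw [modeRatio_comm, h01]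
  obtain ⟨i, j⟩ := p
  by_cases hp : i = 0 ∧ j = 1
  · rw [hp.1, hp.2]; simp [h01]
  · by_cases hp' : i = 1 ∧ j = 0
    · rw [hp'.1, hp'.2]; simp [h10]
    · have : planeLimit (i, j) = 0 := by
        unfold planeLimit
        by_cases h1 : i = 0 <;> by_cases h2 : j = 1 <;> by_cases h3 : j = 0 <;>
          by_cases h4 : i = 1 <;> simp_all
      rw [this, mul_zero]

/-- The Plücker coordinates of two decaying solutions are given by the solution of the integral
equation. -/
theorem ModeBound.wedge_eq_planeSol (hβ : 0 < β) (h : ModeBound χ N β C n) (ha : IsModeSol χ N a)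
    (hb : IsModeSol χ N b) (ha' : IsAsymptoticMode χ a 0) (hb' : IsAsymptoticMode χ b 1) (X : ℝ)
    (p : Fin 4 × Fin 4) :
    modeRatio χ p.1 p.2 X * wedgeCoord a b p X = planeSol χ N X X p := by
  have hC := h.ratio_nonneg
  have hn := h.coupling_nonneg
  set T : Fin 4 × Fin 4 → ℝ → ℂ := fun p x => modeRatio χ p.1 p.2 x * wedgeCoord a b p x with hT
  have hTc : ∀ p, Continuous (T p) := fun p =>
    (h.continuous_modeRatio _ _).mul (continuous_wedgeCoord ha.1 hb.1 p)
  have hTl : ∀ p, Tendsto (T p) atTop (𝓝 (planeLimit p)) := h.tendsto_wedge ha' hb'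
  obtain ⟨M, hM1, hM⟩ : ∃ M : ℝ, 1 ≤ M ∧ ∀ p x, X ≤ x → ‖T p x‖ ≤ M := by
    choose M hM using fun p => exists_bound_of_tendsto_atTop (hTc p) (hTl p) X
    have hMle : ∀ p, M p ≤ ∑ q, |M q| := fun p =>
      (le_abs_self _).trans (Finset.single_le_sum (f := fun q => |M q|)
        (fun q _ => abs_nonneg _) (Finset.mem_univ p))
    exact ⟨1 + ∑ q, |M q|, le_add_of_nonneg_right (Finset.sum_nonneg fun q _ => abs_nonneg _),
      fun p x hx => ((hM p x hx).trans (hMle p)).trans (by linarith)⟩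
  -- To the left of `X` the kernel vanishes, so the constant `planeLimit` extends the equation to
  -- the whole line.
  set f : ℝ → Fin 4 × Fin 4 → ℂ := fun x p => if X ≤ x then T p x else planeLimit p with hf
  have hw := one_le_planeWeight hβ hC hn
  have hB := planeBound_contractive hβ hC hn X
  have hfm : ∀ p, Measurable fun x => f x p := fun p =>
    Measurable.ite measurableSet_Ici (hTc p).measurable measurable_const
  have hfb : ∀ x p, ‖f x p‖ ≤ (M + 2) * planeWeight β C n x := by
    intro x p
    have : ‖f x p‖ ≤ M := by
      simp only [hf]
      split_ifs with hx
      · exact hM p x hx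
      · exact (norm_planeLimit_le p).trans hM1
    nlinarith [hw x]
  have hb₀ : ∀ x p, ‖planeLimit p‖ ≤ planeWeight β C n x := fun x p =>
    (norm_planeLimit_le p).trans (hw x)
  have hfe : ∀ x p, f x p = planeLimit p + ∑ q, ∫ t, planeKernel χ N X x t p q * f t q := by
    rintro x ⟨i, j⟩
    by_cases hx : X ≤ x
    swap
    · simp [hf, hx, planeKernel]
    -- On the diagonal wedge coordinate, limit and kernel all vanish.
    by_cases hij : i = j
    · subst hij
      have h1 : T (i, i) x = 0 := by simp [hT, wedgeCoord]
      have h2 : planeLimit (i, i) = 0 := by simp [planeLimit]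
      simp [hf, hx, planeKernel, h1, h2]
    have hG : ∀ t, x < t → ∑ q, planeKernel χ N X x t (i, j) q * f t q =
        -(modeRatio χ i j x * ∑ l, (N i l t * (χ l t / χ i t) * wedgeCoord a b (l, j) t +
          N j l t * (χ l t / χ j t) * wedgeCoord a b (i, l) t)) := by
      intro t ht
      have e1 : ∀ q, planeKernel χ N X x t (i, j) q * f t q =
          -(modeRatio χ i j x / modeRatio χ i j t) * (((if j = q.2 then N i q.1 t else 0) +
            (if i = q.1 then N j q.2 t else 0)) * T q t) := by
        intro q
        rw [planeKernel, if_pos ⟨hx, ht, hij⟩]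
        simp only [hf, if_pos (hx.trans ht.le)]
        ring
      simp only [e1]
      rw [← Finset.mul_sum, sum_planeCoupling (fun i l => N i l t) (fun q => T q t), neg_mul,
        neg_inj, div_mul_eq_mul_div, mul_div_assoc]
      congr 1
      rw [div_eq_iff (h.modeRatio_ne_zero i j t), Finset.sum_mul]
      refine Finset.sum_congr rfl fun l _ => ?_
      simp only [hT, ← h.modeRatio_mul i j l t, ← h.modeRatio_mul' i j l t]
      ring
    have hintg : ∀ q, Integrable fun t => planeKernel χ N X x t (i, j) q * f t q := fun q =>
      integrable_kernel_mul hB (h.measurable_planeKernel X) (h.norm_planeKernel_le X) hfm hfb x _ q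
    set D : ℝ → ℂ := fun t => ∑ l, (N i l t * (χ l t / χ i t) * wedgeCoord a b (l, j) t +
          N j l t * (χ l t / χ j t) * wedgeCoord a b (i, l) t) with hD
    have hsum : ∑ q, ∫ t, planeKernel χ N X x t (i, j) q * f t q =
        ∫ t in Ioi x, -(modeRatio χ i j x * D t) := by
      rw [← integral_finsetSum _ fun q _ => hintg q, ← integral_indicator measurableSet_Ioi]
      congr 1
      ext t
      by_cases ht : x < t
      · rw [indicator_of_mem (mem_Ioi.2 ht), hG t ht]
      · rw [indicator_of_notMem (by simpa using ht)]
        refine Finset.sum_eq_zero fun q _ => ?_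
        rw [planeKernel, if_neg (fun hh => ht hh.2.1), zero_mul]
    have hDint : IntegrableOn (fun t => -(modeRatio χ i j x * D t)) (Ioi x) := by
      have := (integrable_finsetSum Finset.univ fun q _ => hintg q).integrableOn (s := Ioi x)
      exact this.congr_fun (fun t ht => hG t ht) measurableSet_Ioi
    have hDint' : IntegrableOn D (Ioi x) := by
      have h0 : IntegrableOn (fun t => -(modeRatio χ i j x)⁻¹ * -(modeRatio χ i j x * D t))
          (Ioi x) := hDint.const_mul (-(modeRatio χ i j x)⁻¹)
      refine h0.congr_fun (fun t _ => ?_) measurableSet_Ioi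
      have := h.modeRatio_ne_zero i j x
      field_simp
    -- The coefficients may jump at `0`; continuity of the wedge lets the fundamental theorem of
    -- calculus skip that point.
    have hFTC : ∀ S, x ≤ S → ∫ t in x..S, D t = wedgeCoord a b (i, j) S - wedgeCoord a b (i, j) x := by
      intro S hS
      refine integral_eq_of_hasDerivAt_off_countable _ _ (s := {0}) (countable_singleton 0)
        (continuous_wedgeCoord ha.1 hb.1 _).continuousOn
        (fun t ht => hasDerivAt_wedgeCoord ha hb (fun h0 => ht.2 (by simp [h0])) i j) ?_
      rw [intervalIntegrable_iff_integrableOn_Ioc_of_le hS]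
      exact hDint'.mono_set Ioc_subset_Ioi_self
    have hlim1 : Tendsto (fun S => ∫ t in x..S, -(modeRatio χ i j x * D t)) atTop
        (𝓝 (∫ t in Ioi x, -(modeRatio χ i j x * D t))) :=
      intervalIntegral_tendsto_integral_Ioi x hDint tendsto_id
    have hlim2 : Tendsto (fun S => ∫ t in x..S, -(modeRatio χ i j x * D t)) atTop
        (𝓝 (T (i, j) x - planeLimit (i, j))) := by
      -- The boundary term at `S` is a ratio bounded by `C` times a quantity tending to zero.
      have hz : Tendsto (fun S => modeRatio χ i j x / modeRatio χ i j S *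
          (T (i, j) S - planeLimit (i, j))) atTop (𝓝 0) := by
        have h0 : Tendsto (fun S => C * ‖T (i, j) S - planeLimit (i, j)‖) atTop (𝓝 0) := by
          have := ((hTl (i, j)).sub_const (planeLimit (i, j))).norm.const_mul C
          simpa using this
        refine squeeze_zero_norm' ?_ h0
        filter_upwards [eventually_ge_atTop x] with S hS
        rw [norm_mul]
        gcongr
        exact h.norm_ratio_div_le hij hS
      have := (tendsto_const_nhds (x := T (i, j) x - planeLimit (i, j))).sub hz
      rw [sub_zero] at this
      refine this.congr' ?_
      filter_upwards [eventually_ge_atTop x] with S hS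
      rw [intervalIntegral.integral_neg, intervalIntegral.integral_const_mul, hFTC S hS, mul_sub,
        h.ratio_mul_planeLimit (i, j) x S]
      have := h.modeRatio_ne_zero i j S
      simp only [hT]
      field_simp
      ring
    rw [hsum, tendsto_nhds_unique hlim1 hlim2]
    simp only [hf, if_pos hx]
    ring
  have hsm := measurable_integralSol (f₀ := fun _ => planeLimit) hB (h.measurable_planeKernel X)
    (h.norm_planeKernel_le X) (fun _ => measurable_const) hb₀
  have hse := integralSol_eq (f₀ := fun _ => planeLimit) hB (h.measurable_planeKernel X)
    (h.norm_planeKernel_le X) (fun _ => measurable_const) hb₀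
  have hsb : ∀ x p, ‖planeSol χ N X x p‖ ≤ (M + 2) * planeWeight β C n x := fun x p =>
    (norm_integralSol_le (f₀ := fun _ => planeLimit) hB (h.norm_planeKernel_le X) hb₀ x p).trans
      (by nlinarith [hw x])
  have := eq_of_integral_equation (f₀ := fun _ => planeLimit) hB (h.measurable_planeKernel X)
    (h.norm_planeKernel_le X) hfm hsm hfb hsb hfe hse X p
  simpa [hf, hT, planeSol] using this

end Modes

/-! ### Growth and decay of quasiperiodic functions. -/

section Quasiperiodic

open Set

variable {d : ℝ} {τ : ℂ} {f : ℝ → ℂ}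

theorem exists_le_of_quasiperiodic (hd : 0 < d) (hf : Continuous f) (hf0 : ∀ x, f x ≠ 0)
    (hτ : τ ≠ 0) (hs : ∀ x, f (x + d) = τ * f x) (hτ1 : ‖τ‖ ≤ 1) :
    ∃ c : ℝ, ∀ x t, x ≤ t → ‖f t‖ ≤ c * ‖f x‖ := by
  obtain ⟨b, hb⟩ := (isCompact_Icc (a := 0) (b := 2 * d)).exists_bound_of_continuousOn
    hf.continuousOn
  obtain ⟨x₀, _, hx₀⟩ := (isCompact_Icc (a := 0) (b := 2 * d)).exists_isMinOn
    (nonempty_Icc.2 (by positivity)) hf.norm.continuousOn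
  exact ⟨b / ‖f x₀‖, fun x t hxt => norm_le_of_quasiperiodic_of_bounds hd hτ hτ1 hs
    (norm_pos_iff.2 (hf0 x₀)) (fun x hx => ⟨hx₀ hx, hb x hx⟩) hxt⟩

theorem exists_ge_of_quasiperiodic (hd : 0 < d) (hf : Continuous f) (hf0 : ∀ x, f x ≠ 0)
    (hτ : τ ≠ 0) (hs : ∀ x, f (x + d) = τ * f x) (hτ1 : 1 ≤ ‖τ‖) :
    ∃ c : ℝ, ∀ x t, x ≤ t → ‖f x‖ ≤ c * ‖f t‖ := by
  obtain ⟨c, hc⟩ := exists_le_of_quasiperiodic (f := fun x => (f x)⁻¹) (τ := τ⁻¹) hd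
    (hf.inv₀ hf0) (fun x => inv_ne_zero (hf0 x)) (inv_ne_zero hτ)
    (fun x => by rw [hs, mul_inv]) (by rw [norm_inv]; exact inv_le_one_of_one_le₀ hτ1)
  refine ⟨c, fun x t hxt => ?_⟩
  have h1 := hc x t hxt
  have hx := norm_pos_iff.2 (hf0 x)
  have ht := norm_pos_iff.2 (hf0 t)
  rw [norm_inv, norm_inv, ← div_eq_mul_inv, le_div_iff₀ hx, inv_mul_eq_div, div_le_iff₀ ht] at h1
  exact h1

theorem tendsto_zero_of_quasiperiodic (hd : 0 < d) (hf : Continuous f) (hf0 : ∀ x, f x ≠ 0)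
    (hτ : τ ≠ 0) (hs : ∀ x, f (x + d) = τ * f x) (hτ1 : ‖τ‖ < 1) : Tendsto f atTop (𝓝 0) := by
  obtain ⟨c, hc⟩ := exists_le_of_quasiperiodic hd hf hf0 hτ hs hτ1.le
  have h1 : Tendsto (fun m : ℕ => c * (‖τ‖ ^ m * ‖f 0‖)) atTop (𝓝 (c * (0 * ‖f 0‖))) :=
    ((tendsto_pow_atTop_nhds_zero_of_lt_one (norm_nonneg _) hτ1).mul_const _).const_mul c
  rw [zero_mul, mul_zero] at h1
  rw [tendsto_zero_iff_norm_tendsto_zero, Metric.tendsto_atTop]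
  intro ε hε
  obtain ⟨m, hm⟩ := (h1.eventually_lt_const hε).exists
  refine ⟨m * d, fun t ht => ?_⟩
  have h2 := hc _ _ ht
  have h3 := quasiperiodic_zpow hτ hs m 0
  rw [zero_add, Int.cast_natCast, zpow_natCast] at h3
  rw [h3, norm_mul, norm_pow] at h2
  simpa using h2.trans_lt hm

end Quasiperiodic

/-! ### Dichotomies and the kernel for a single asymptotic mode. -/

section Levinson

open Set MeasureTheory

/-- Dichotomy of the modes relative to the mode `j`: the modes in `fwd` decay faster. -/
structure ModeDichotomy (χ : Fin 4 → ℝ → ℂ) (j : Fin 4) (fwd : Set (Fin 4)) (C : ℝ) : Prop where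
  notMem : j ∉ fwd
  backward : ∀ i ∉ fwd, ∀ x t, x ≤ t → ‖χ i x / χ j x‖ ≤ C * ‖χ i t / χ j t‖
  forward : ∀ i ∈ fwd, ∀ x t, t ≤ x → ‖χ i x / χ j x‖ ≤ C * ‖χ i t / χ j t‖
  tendsto : ∀ i ∈ fwd, Tendsto (fun x => χ i x / χ j x) atTop (𝓝 0)

/-- Quotients of modes are quasiperiodic, so the modulus of `τ i / τ j` decides the class; equal
moduli go to the backward class, where boundedness is enough. -/
theorem exists_modeDichotomy {χ : Fin 4 → ℝ → ℂ} {d : ℝ} {τ : Fin 4 → ℂ} (hd : 0 < d)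
    (hχ : ∀ i, Continuous (χ i)) (hχ0 : ∀ i x, χ i x ≠ 0) (hτ : ∀ i, τ i ≠ 0)
    (hs : ∀ i x, χ i (x + d) = τ i * χ i x) (j : Fin 4) :
    ∃ fwd C, ModeDichotomy χ j fwd C := by
  have hc : ∀ i, Continuous fun x => χ i x / χ j x := fun i => (hχ i).div (hχ j) (hχ0 j)
  have h0 : ∀ i x, χ i x / χ j x ≠ 0 := fun i x => div_ne_zero (hχ0 i x) (hχ0 j x)
  have hτ' : ∀ i, τ i / τ j ≠ 0 := fun i => div_ne_zero (hτ i) (hτ j)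
  have hs' : ∀ i x, χ i (x + d) / χ j (x + d) = τ i / τ j * (χ i x / χ j x) := fun i x => by
    rw [hs, hs, mul_div_mul_comm]
  have key : ∀ i, ∃ c : ℝ, 0 ≤ c ∧
      (1 ≤ ‖τ i / τ j‖ → ∀ x t, x ≤ t → ‖χ i x / χ j x‖ ≤ c * ‖χ i t / χ j t‖) ∧
      (‖τ i / τ j‖ < 1 → ∀ x t, t ≤ x → ‖χ i x / χ j x‖ ≤ c * ‖χ i t / χ j t‖) := by
    intro i
    have hpos : ∀ c : ℝ, ‖χ i 0 / χ j 0‖ ≤ c * ‖χ i 0 / χ j 0‖ → 0 ≤ c := fun c hc => by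
      have := norm_pos_iff.2 (h0 i 0)
      nlinarith
    rcases le_or_gt 1 ‖τ i / τ j‖ with h1 | h1
    · obtain ⟨c, hc⟩ := exists_ge_of_quasiperiodic hd (hc i) (h0 i) (hτ' i) (hs' i) h1
      exact ⟨c, hpos c (hc 0 0 le_rfl), fun _ => hc, fun h2 => absurd h2 (not_lt.2 h1)⟩
    · obtain ⟨c, hc⟩ := exists_le_of_quasiperiodic hd (hc i) (h0 i) (hτ' i) (hs' i) h1.le
      exact ⟨c, hpos c (hc 0 0 le_rfl), fun h2 => absurd h1 (not_lt.2 h2),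
        fun _ x t hxt => hc t x hxt⟩
  choose c hc0 hcb hcf using key
  have hle : ∀ i, c i ≤ ∑ l, c l := fun i =>
    Finset.single_le_sum (fun l _ => hc0 l) (Finset.mem_univ i)
  refine ⟨{i | ‖τ i / τ j‖ < 1}, ∑ l, c l, ?_, fun i hi x t hxt => ?_, fun i hi x t hxt => ?_,
    fun i hi => ?_⟩
  · rw [mem_ofPred_eq, div_self (hτ j), norm_one]
    exact lt_irrefl _
  · exact (hcb i (not_lt.1 hi) x t hxt).trans (by gcongr; exact hle i)
  · exact (hcf i hi x t hxt).trans (by gcongr; exact hle i)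
  · exact tendsto_zero_of_quasiperiodic hd (hc i) (h0 i) (hτ' i) (hs' i) hi

open Classical in
/-- The kernel of the integral equation for a solution asymptotic to the mode `j`. -/
noncomputable def levinsonKernel (χ : Fin 4 → ℝ → ℂ) (N : Fin 4 → Fin 4 → ℝ → ℂ) (j : Fin 4)
    (fwd : Set (Fin 4)) (X x t : ℝ) (i l : Fin 4) : ℂ :=
  if X ≤ x then
    if i ∈ fwd then
      (Ioc X x).indicator (fun t => (χ i x / χ j x) / (χ i t / χ j t) * N i l t) t
    else (Ioi x).indicator (fun t => -((χ i x / χ j x) / (χ i t / χ j t) * N i l t)) t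
  else 0

variable {χ : Fin 4 → ℝ → ℂ} {N : Fin 4 → Fin 4 → ℝ → ℂ} {β C₀ C n : ℝ} {j : Fin 4}
  {fwd : Set (Fin 4)}

theorem ModeBound.measurable_levinsonKernel (h : ModeBound χ N β C₀ n) (X : ℝ) (i l : Fin 4) :
    Measurable fun y : ℝ × ℝ => levinsonKernel χ N j fwd X y.1 y.2 i l := by
  classical
  have h1 : Measurable fun x => χ i x / χ j x :=
    (h.continuous i).measurable.div (h.continuous j).measurable
  have h2 : Measurable fun y : ℝ × ℝ =>
      (χ i y.1 / χ j y.1) / (χ i y.2 / χ j y.2) * N i l y.2 :=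
    ((h1.comp measurable_fst).div (h1.comp measurable_snd)).mul
      ((h.measurable i l).comp measurable_snd)
  unfold levinsonKernel
  refine Measurable.ite (measurableSet_le measurable_const measurable_fst) ?_ measurable_const
  split_ifs
  · have : (fun y : ℝ × ℝ => (Ioc X y.1).indicator
        (fun t => (χ i y.1 / χ j y.1) / (χ i t / χ j t) * N i l t) y.2) =
        ({y : ℝ × ℝ | X < y.2} ∩ {y | y.2 ≤ y.1}).indicator
          fun y => (χ i y.1 / χ j y.1) / (χ i y.2 / χ j y.2) * N i l y.2 := by
      ext y; simp [indicator]
    rw [this]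
    exact h2.indicator ((measurableSet_lt measurable_const measurable_snd).inter
      (measurableSet_le measurable_snd measurable_fst))
  · have : (fun y : ℝ × ℝ => (Ioi y.1).indicator
        (fun t => -((χ i y.1 / χ j y.1) / (χ i t / χ j t) * N i l t)) y.2) =
        {y : ℝ × ℝ | y.1 < y.2}.indicator
          fun y => -((χ i y.1 / χ j y.1) / (χ i y.2 / χ j y.2) * N i l y.2) := by
      ext y; simp [indicator]
    rw [this]
    exact h2.neg.indicator (measurableSet_lt measurable_fst measurable_snd)

theorem ModeBound.norm_levinsonKernel_le (h : ModeBound χ N β C₀ n) (hD : ModeDichotomy χ j fwd C)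
    (X x t : ℝ) (i l : Fin 4) : ‖levinsonKernel χ N j fwd X x t i l‖ ≤
      (Ioi X).indicator (fun t => C * n * Real.exp (-(β * t))) t := by
  classical
  have h0 : ∀ i x, χ i x / χ j x ≠ 0 := fun i x => div_ne_zero (h.ne_zero i x) (h.ne_zero j x)
  have hn := h.coupling_nonneg
  have hC : 0 ≤ C := by
    have h1 := hD.backward j hD.notMem 0 0 le_rfl
    have h2 := norm_pos_iff.2 (h0 j 0)
    nlinarith
  have hpos : 0 ≤ (Ioi X).indicator (fun t => C * n * Real.exp (-(β * t))) t :=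
    indicator_nonneg (fun t _ => by positivity) t
  have hmain : ‖χ i x / χ j x‖ ≤ C * ‖χ i t / χ j t‖ →
      ‖(χ i x / χ j x) / (χ i t / χ j t) * N i l t‖ ≤ C * n * Real.exp (-(β * t)) := by
    intro hle
    rw [norm_mul, norm_div, mul_assoc]
    refine mul_le_mul ?_ (h.norm_le i l t) (norm_nonneg _) hC
    rwa [div_le_iff₀ (norm_pos_iff.2 (h0 i t))]
  unfold levinsonKernel
  split_ifs with hx hi
  · by_cases ht : t ∈ Ioc X x
    · rw [indicator_of_mem ht, indicator_of_mem (mem_Ioi.2 ht.1)]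
      exact hmain (hD.forward i hi x t ht.2)
    · rw [indicator_of_notMem ht, norm_zero]; exact hpos
  · by_cases ht : t ∈ Ioi x
    · rw [indicator_of_mem ht, indicator_of_mem (mem_Ioi.2 (hx.trans_lt ht)), norm_neg]
      exact hmain (hD.backward i hi x t (le_of_lt ht))
    · rw [indicator_of_notMem ht, norm_zero]; exact hpos
  · rw [norm_zero]; exact hpos

theorem integrableOn_exp_neg {β : ℝ} (hβ : 0 < β) (X : ℝ) :
    IntegrableOn (fun t => Real.exp (-(β * t))) (Ioi X) ∧
      ∫ t in Ioi X, Real.exp (-(β * t)) = Real.exp (-(β * X)) / β := by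
  have hd : ∀ t ∈ Ici X, HasDerivAt (fun t => -(Real.exp (-(β * t)) / β)) (Real.exp (-(β * t))) t := by
    intro t _
    have h1 : HasDerivAt (fun t => -(β * t)) (-(β * 1)) t := ((hasDerivAt_id t).const_mul β).neg
    refine ((h1.exp.div_const β).neg).congr_deriv ?_
    field_simp
  have hlim : Tendsto (fun t => -(Real.exp (-(β * t)) / β)) atTop (𝓝 (-(0 / β))) :=
    ((Real.tendsto_exp_neg_atTop_nhds_zero.comp (tendsto_id.const_mul_atTop hβ)).div_const _).neg
  refine ⟨integrableOn_Ioi_deriv_of_nonneg' hd (fun t _ => by positivity) hlim, ?_⟩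
  rw [integral_Ioi_of_hasDerivAt_of_nonneg' hd (fun t _ => by positivity) hlim]
  ring

/-- The constant weight works only for large `X`: four components and the factor one half give the
`8`. This suffices for existence at a single `λ`, where `X` need not be uniform. -/
theorem levinson_contractive (hβ : 0 < β) {K : ℝ} {X : ℝ}
    (hX : 8 * (K * (Real.exp (-(β * X)) / β)) ≤ 1) :
    ContractiveBound (Fin 4) (fun _ t => (Ioi X).indicator (fun t => K * Real.exp (-(β * t))) t)
      (fun _ => 1) := by
  obtain ⟨h1, h2⟩ := integrableOn_exp_neg hβ X
  refine ⟨fun _ => zero_le_one, fun _ => ?_, fun _ => ?_⟩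
  · simp only [mul_one]
    exact (integrable_indicator_iff measurableSet_Ioi).2 (h1.const_mul _)
  · simp only [mul_one]
    rw [integral_indicator measurableSet_Ioi, integral_const_mul, h2]
    simp only [Fintype.card_fin]
    push_cast
    linarith

end Levinson

/-! ### Existence of solutions asymptotic to a given mode. -/

section Levinson

open Set MeasureTheory

variable {χ : Fin 4 → ℝ → ℂ} {N : Fin 4 → Fin 4 → ℝ → ℂ} {β C₀ C n : ℝ} {j : Fin 4}
  {fwd : Set (Fin 4)}

/-- Near `+∞` there is a solution asymptotic to any given mode. -/
theorem ModeBound.exists_asymptotic (hβ : 0 < β) (h : ModeBound χ N β C₀ n)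
    (hD : ModeDichotomy χ j fwd C) (hN : ∀ i l x, 0 < x → ContinuousAt (N i l) x) :
    ∃ (X : ℝ) (c : ℝ → Fin 4 → ℂ), 0 ≤ X ∧ (∀ x, X < x → ∀ i,
      HasDerivAt (fun x => c x i) (∑ l, N i l x * (χ l x / χ i x) * c x l) x) ∧
      IsAsymptoticMode χ c j := by
  classical
  obtain ⟨X, hX0, hX⟩ : ∃ X : ℝ, 0 ≤ X ∧ 8 * (C * n * (Real.exp (-(β * X)) / β)) ≤ 1 := by
    have h1 : Tendsto (fun X => 8 * (C * n * (Real.exp (-(β * X)) / β))) atTop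
        (𝓝 (8 * (C * n * (0 / β)))) :=
      (((Real.tendsto_exp_neg_atTop_nhds_zero.comp
        (tendsto_id.const_mul_atTop hβ)).div_const _).const_mul _).const_mul _
    rw [zero_div, mul_zero, mul_zero] at h1
    obtain ⟨X, hX1, hX2⟩ := ((h1.eventually_lt_const one_pos).and (eventually_ge_atTop 0)).exists
    exact ⟨X, hX2, hX1.le⟩
  set κ : Fin 4 → ℝ → ℂ := fun i x => χ i x / χ j x with hκ
  have hκ0 : ∀ i x, κ i x ≠ 0 := fun i x => div_ne_zero (h.ne_zero i x) (h.ne_zero j x)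
  have hκj : ∀ x, κ j x = 1 := fun x => div_self (h.ne_zero j x)
  have hκc : ∀ i, Continuous (κ i) := fun i => (h.continuous i).div (h.continuous j) (h.ne_zero j)
  set δ : Fin 4 → ℂ := fun i => if i = j then 1 else 0 with hδ
  have hB := levinson_contractive hβ hX
  have hkm := h.measurable_levinsonKernel (j := j) (fwd := fwd) X
  have hkb := h.norm_levinsonKernel_le hD X
  have hδb : ∀ (_ : ℝ) i, ‖δ i‖ ≤ 1 := fun _ i => by
    simp only [hδ]; split_ifs <;> simp
  set y := integralSol (levinsonKernel χ N j fwd X) (fun _ => δ) with hy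
  have hym : ∀ i, Measurable fun x => y x i :=
    measurable_integralSol hB hkm hkb (fun _ => measurable_const) hδb
  have hyb : ∀ x i, ‖y x i‖ ≤ 2 * 1 := norm_integralSol_le (f₀ := fun _ => δ) hB hkb hδb
  have hye : ∀ x i, y x i = δ i + ∑ l, ∫ t, levinsonKernel χ N j fwd X x t i l * y t l :=
    integralSol_eq (f₀ := fun _ => δ) hB hkm hkb (fun _ => measurable_const) hδb
  have hintg : ∀ x i l, Integrable fun t => levinsonKernel χ N j fwd X x t i l * y t l :=
    integrable_kernel_mul hB hkm hkb hym hyb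
  -- With `y i = κ i * c i`, this is the derivative that the coefficient `c i` must have.
  set F : Fin 4 → ℝ → ℂ := fun i t => (∑ l, N i l t * y t l) / κ i t with hF
  have hFm : ∀ i, Measurable (F i) := fun i =>
    (Finset.measurable_sum _ fun l _ => (h.measurable i l).mul (hym l)).div (hκc i).measurable
  have hFi : ∀ i a b, IntervalIntegrable (F i) volume a b := by
    intro i a b
    have hcont : Continuous fun t => (4 * (n * Real.exp (-(β * t)) * 2)) / ‖κ i t‖ :=
      Continuous.div (by fun_prop) (hκc i).norm fun t => norm_ne_zero_iff.2 (hκ0 i t)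
    refine (hcont.intervalIntegrable a b).mono_fun (hFm i).aestronglyMeasurable
      (Eventually.of_forall fun t => ?_)
    have hn := h.coupling_nonneg
    simp only [hF]
    rw [norm_div, Real.norm_of_nonneg (by positivity)]
    gcongr
    refine (norm_sum_le _ _).trans ?_
    calc _ ≤ ∑ _l : Fin 4, n * Real.exp (-(β * t)) * 2 := by
          refine Finset.sum_le_sum fun l _ => ?_
          rw [norm_mul]
          exact mul_le_mul (h.norm_le i l t) (by simpa using hyb t l) (norm_nonneg _) (by positivity)
      _ = _ := by simp
  have hsumInt : ∀ x i, ∑ l, ∫ t, levinsonKernel χ N j fwd X x t i l * y t l =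
      ∫ t, ∑ l, levinsonKernel χ N j fwd X x t i l * y t l := fun x i =>
    (integral_finsetSum _ fun l _ => hintg x i l).symm
  have hfwd : ∀ x, X ≤ x → ∀ i ∈ fwd, (fun t => ∑ l, levinsonKernel χ N j fwd X x t i l * y t l) =
      (Ioc X x).indicator fun t => κ i x * F i t := by
    intro x hx i hi
    ext t
    by_cases ht : t ∈ Ioc X x
    · rw [indicator_of_mem ht]
      simp only [levinsonKernel, if_pos hx, if_pos hi, indicator_of_mem ht, hF]
      rw [mul_div_assoc', Finset.mul_sum, Finset.sum_div]
      refine Finset.sum_congr rfl fun l _ => ?_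
      simp only [hκ]; ring
    · rw [indicator_of_notMem ht]
      refine Finset.sum_eq_zero fun l _ => ?_
      simp only [levinsonKernel, if_pos hx, if_pos hi, indicator_of_notMem ht, zero_mul]
  have hbwd : ∀ x, X ≤ x → ∀ i ∉ fwd, (fun t => ∑ l, levinsonKernel χ N j fwd X x t i l * y t l) =
      (Ioi x).indicator fun t => -(κ i x) * F i t := by
    intro x hx i hi
    ext t
    by_cases ht : t ∈ Ioi x
    · rw [indicator_of_mem ht]
      simp only [levinsonKernel, if_pos hx, if_neg hi, indicator_of_mem ht, hF]
      rw [mul_div_assoc', Finset.mul_sum, Finset.sum_div]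
      refine Finset.sum_congr rfl fun l _ => ?_
      simp only [hκ]; ring
    · rw [indicator_of_notMem ht]
      refine Finset.sum_eq_zero fun l _ => ?_
      simp only [levinsonKernel, if_pos hx, if_neg hi, indicator_of_notMem ht, zero_mul]
  have hFint : ∀ i ∉ fwd, IntegrableOn (F i) (Ioi X) := by
    intro i hi
    have h1 := integrable_finsetSum Finset.univ fun l _ => hintg X i l
    rw [hbwd X le_rfl i hi, integrable_indicator_iff measurableSet_Ioi] at h1
    have h2 : IntegrableOn (fun t => (-(κ i X))⁻¹ * (-(κ i X) * F i t)) (Ioi X) :=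
      Integrable.const_mul h1 _
    refine h2.congr_fun (fun t _ => ?_) measurableSet_Ioi
    exact inv_mul_cancel_left₀ (neg_ne_zero.2 (hκ0 i X)) _
  -- Forward components integrate from `X`; backward ones integrate from `+∞`, and the constant
  -- converts that into a primitive based at `X`.
  set A : Fin 4 → ℂ := fun i => if i ∈ fwd then 0 else -∫ t in Ioi X, F i t with hA
  set c : ℝ → Fin 4 → ℂ := fun x i => δ i + A i + ∫ t in X..x, F i t with hc
  have hcy : ∀ x, X ≤ x → ∀ i, κ i x * c x i = y x i := by
    intro x hx i
    have hδκ : κ i x * δ i = δ i := by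
      simp only [hδ]
      split_ifs with hij
      · rw [hij, hκj, mul_one]
      · rw [mul_zero]
    rw [hye, hsumInt]
    simp only [hc, hA]
    by_cases hi : i ∈ fwd
    · rw [hfwd x hx i hi, integral_indicator measurableSet_Ioc, integral_const_mul,
        intervalIntegral.integral_of_le hx, if_pos hi]
      linear_combination hδκ
    · rw [hbwd x hx i hi, integral_indicator measurableSet_Ioi, integral_const_mul,
        ← intervalIntegral.integral_Ioi_sub_Ioi (hFint i hi) hx, if_neg hi]
      linear_combination hδκ
  have hcc : ∀ i, Continuous fun x => c x i := fun i =>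
    continuous_const.add (intervalIntegral.continuous_primitive (hFi i) X)
  have hyc : ∀ i x, X < x → ContinuousAt (fun x => y x i) x := by
    intro i x hx
    refine ((hκc i).mul (hcc i)).continuousAt.congr ?_
    filter_upwards [Ioi_mem_nhds hx] with t ht
    exact hcy t (le_of_lt ht) i
  refine ⟨X, c, hX0, fun x hx i => ?_, fun i => ?_⟩
  · have hFc : ContinuousAt (F i) x := by
      refine ContinuousAt.div ?_ (hκc i).continuousAt (hκ0 i x)
      exact tendsto_finsetSum _ fun l _ => (hN i l x (hX0.trans_lt hx)).mul (hyc l x hx)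
    have h1 := (intervalIntegral.integral_hasDerivAt_right (hFi i X x)
      (hFm i).stronglyMeasurable.stronglyMeasurableAtFilter hFc).const_add (δ i + A i)
    refine h1.congr_deriv ?_
    simp only [hF]
    rw [Finset.sum_div]
    refine Finset.sum_congr rfl fun l _ => ?_
    rw [← hcy x hx.le l]
    have e1 := h.ne_zero i x
    have e2 := h.ne_zero j x
    simp only [hκ]
    field_simp
  · have hlim : Tendsto (fun x => y x i) atTop (𝓝 (δ i)) := by
      -- Dominated convergence: at fixed `t` a forward kernel tends to zero with `κ i x`, and a
      -- backward kernel vanishes as soon as `x ≥ t`.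
      have h1 : ∀ l, Tendsto (fun x => ∫ t, levinsonKernel χ N j fwd X x t i l * y t l) atTop
          (𝓝 (∫ _ : ℝ, (0 : ℂ))) := by
        intro l
        refine tendsto_integral_filter_of_dominated_convergence
          (fun t => (Ioi X).indicator (fun t => C * n * Real.exp (-(β * t))) t * (2 * 1))
          (Eventually.of_forall fun x => (hintg x i l).aestronglyMeasurable)
          (Eventually.of_forall fun x => Eventually.of_forall fun t => ?_) ?_
          (Eventually.of_forall fun t => ?_)
        · rw [norm_mul]
          exact mul_le_mul (hkb x t i l) (hyb t l) (norm_nonneg _)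
            ((norm_nonneg _).trans (hkb x t i l))
        · have := (hB.integrable 0).mul_const (2 * 1)
          simpa using this
        · rw [← zero_mul (y t l)]
          refine Tendsto.mul_const _ ?_
          by_cases hi : i ∈ fwd
          · have h2 : Tendsto (fun x => ‖κ i x / κ i t * N i l t‖) atTop (𝓝 0) := by
              have hκt : Tendsto (κ i) atTop (𝓝 0) := hD.tendsto i hi
              have := ((hκt.div_const (κ i t)).mul_const (N i l t)).norm
              simpa only [zero_div, zero_mul, norm_zero] using this
            refine squeeze_zero_norm (fun x => ?_) h2
            simp only [levinsonKernel, if_pos hi]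
            split_ifs
            · exact norm_indicator_le_norm_self
                (fun t => (χ i x / χ j x) / (χ i t / χ j t) * N i l t) t
            · rw [norm_zero]; exact norm_nonneg _
          · refine tendsto_const_nhds.congr' ?_
            filter_upwards [eventually_ge_atTop t] with x hx
            simp only [levinsonKernel, if_neg hi]
            rw [indicator_of_notMem (by simpa using hx), ite_self]
      have h2 := (tendsto_finsetSum Finset.univ fun l _ => h1 l).const_add (δ i)
      simp only [integral_zero, Finset.sum_const_zero, add_zero] at h2
      exact h2.congr fun x => (hye x i).symm
    refine hlim.congr' ?_
    filter_upwards [eventually_ge_atTop X] with x hx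
    rw [← hcy x hx i]
    simp only [hκ]; ring

end Levinson

/-! ### Two coupled Hill equations in Weyl-mode coordinates. -/

section Coupled

open Set MeasureTheory

variable {V q : ℝ → ℝ} {d β Q : ℝ} {zp zm : ℂ}

/-- A real coupling that is exponentially localized and may jump at `0`. -/
structure IsCoupling (q : ℝ → ℝ) (β Q : ℝ) : Prop where
  pos : 0 < β
  measurable : Measurable q
  continuousAt : ∀ x, x ≠ 0 → ContinuousAt q x
  abs_le : ∀ x, |q x| ≤ Q * Real.exp (-(β * |x|))

theorem IsCoupling.reflect (h : IsCoupling q β Q) : IsCoupling (fun x => q (-x)) β Q where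
  pos := h.pos
  measurable := h.measurable.comp measurable_neg
  continuousAt x hx := (h.continuousAt (-x) (neg_ne_zero.2 hx)).comp continuous_neg.continuousAt
  abs_le x := by simpa using h.abs_le (-x)

theorem IsCoupling.nonneg (h : IsCoupling q β Q) : 0 ≤ Q := by
  have := (abs_nonneg _).trans (h.abs_le 0)
  simpa using this

theorem IsCoupling.abs_le_exp (h : IsCoupling q β Q) (x : ℝ) :
    |q x| ≤ Q * Real.exp (-(β * x)) := by
  refine (h.abs_le x).trans (mul_le_mul_of_nonneg_left (Real.exp_le_exp.2 ?_) h.nonneg)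
  have := mul_le_mul_of_nonneg_left (le_abs_self x) h.pos.le
  linarith

theorem IsCoupling.abs_le_const (h : IsCoupling q β Q) (x : ℝ) : |q x| ≤ Q := by
  refine (h.abs_le x).trans (mul_le_of_le_one_right h.nonneg (Real.exp_le_one_iff.2 ?_))
  have := mul_nonneg h.pos.le (abs_nonneg x)
  linarith

/-- The matrix of two Hill equations coupled by `q`, as a first order system. -/
noncomputable def coupledMatrix (V q : ℝ → ℝ) (zp zm : ℂ) (x : ℝ) : Matrix (Fin 4) (Fin 4) ℂ :=
  !![0, 1, 0, 0;
     (V x : ℂ) - 2 * (q x : ℂ) - zp, 0, -(q x : ℂ), 0;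
     0, 0, 0, 1;
     -(q x : ℂ), 0, (V x : ℂ) - 2 * (q x : ℂ) - zm, 0]

theorem hasDerivAt_coupledMatrix_iff {v : ℝ → Fin 4 → ℂ} {x : ℝ} :
    HasDerivAt v ((coupledMatrix V q zp zm x).mulVec (v x)) x ↔
      HasDerivAt (fun x => v x 0) (v x 1) x ∧
      HasDerivAt (fun x => v x 1)
        (((V x : ℂ) - 2 * (q x : ℂ) - zp) * v x 0 - (q x : ℂ) * v x 2) x ∧
      HasDerivAt (fun x => v x 2) (v x 3) x ∧
      HasDerivAt (fun x => v x 3)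
        (((V x : ℂ) - 2 * (q x : ℂ) - zm) * v x 2 - (q x : ℂ) * v x 0) x := by
  rw [hasDerivAt_pi]
  constructor
  · intro h
    refine ⟨(h 0).congr_deriv ?_, (h 1).congr_deriv ?_, (h 2).congr_deriv ?_,
      (h 3).congr_deriv ?_⟩ <;>
    simp [coupledMatrix, Matrix.mulVec, dotProduct, Fin.sum_univ_four] <;> ring
  · rintro ⟨h0, h1, h2, h3⟩ i
    fin_cases i
    · refine h0.congr_deriv ?_
      simp [coupledMatrix, Matrix.mulVec, dotProduct, Fin.sum_univ_four]
    · refine h1.congr_deriv ?_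
      simp [coupledMatrix, Matrix.mulVec, dotProduct, Fin.sum_univ_four]; ring
    · refine h2.congr_deriv ?_
      simp [coupledMatrix, Matrix.mulVec, dotProduct, Fin.sum_univ_four]
    · refine h3.congr_deriv ?_
      simp [coupledMatrix, Matrix.mulVec, dotProduct, Fin.sum_univ_four]; ring

/-- Solutions of two Hill equations coupled by `q`. -/
def IsCoupledSol (V q : ℝ → ℝ) (zp zm : ℂ) (v : ℝ → Fin 4 → ℂ) : Prop :=
  Continuous v ∧ ∀ x : ℝ, x ≠ 0 → HasDerivAt v ((coupledMatrix V q zp zm x).mulVec (v x)) x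

/-- The reflection `x ↦ -x` on first order systems of two second order equations. -/
def reflectVec (v : ℝ → Fin 4 → ℂ) (x : ℝ) : Fin 4 → ℂ :=
  ![v (-x) 0, -v (-x) 1, v (-x) 2, -v (-x) 3]

theorem reflectVec_reflectVec (v : ℝ → Fin 4 → ℂ) : reflectVec (reflectVec v) = v := by
  funext x i
  fin_cases i <;> simp [reflectVec]

theorem IsCoupledSol.reflect {v : ℝ → Fin 4 → ℂ} (h : IsCoupledSol V q zp zm v) :
    IsCoupledSol (fun x => V (-x)) (fun x => q (-x)) zp zm (reflectVec v) := by
  refine ⟨?_, fun x hx => ?_⟩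
  · have hc : ∀ i, Continuous fun x => v (-x) i := fun i =>
      (continuous_apply i).comp (h.1.comp continuous_neg)
    refine continuous_pi fun i => ?_
    fin_cases i
    · exact hc 0
    · exact (hc 1).neg
    · exact hc 2
    · exact (hc 3).neg
  · obtain ⟨h0, h1, h2, h3⟩ := hasDerivAt_coupledMatrix_iff.1 (h.2 (-x) (neg_ne_zero.2 hx))
    rw [hasDerivAt_coupledMatrix_iff]
    have hn : HasDerivAt (fun x : ℝ => -x) (-1) x := hasDerivAt_neg x
    refine ⟨(h0.scomp x hn).congr_deriv ?_, (h1.scomp x hn).neg.congr_deriv ?_,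
      (h2.scomp x hn).congr_deriv ?_, (h3.scomp x hn).neg.congr_deriv ?_⟩ <;>
    simp [reflectVec]

/-- The four decaying solutions of the uncoupled Hill equations. -/
noncomputable def hillMode (V : ℝ → ℝ) (d : ℝ) (zp zm : ℂ) : Fin 4 → ℝ → ℂ :=
  ![weylSol V d zp, weylSol V d zm, weylMinus V d zp, weylMinus V d zm]

/-- The coupling between the modes `hillMode`. -/
noncomputable def hillCoupling (V q : ℝ → ℝ) (d : ℝ) (zp zm : ℂ) (i l : Fin 4) (x : ℝ) : ℂ :=
  (![greenDiag V d zp x, greenDiag V d zm x, -greenDiag V d zp x, -greenDiag V d zm x] i) *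
    (!![2, 1, 2, 1; 1, 2, 1, 2; 2, 1, 2, 1; 1, 2, 1, 2] i l) * (q x : ℂ)

/-- Coefficients of a vector function with respect to the modes `hillMode`. -/
noncomputable def toModes (V : ℝ → ℝ) (d : ℝ) (zp zm : ℂ) (v : ℝ → Fin 4 → ℂ) (x : ℝ) :
    Fin 4 → ℂ :=
  ![(v x 0 * weylMinus' V d zp x - v x 1 * weylMinus V d zp x) / weylWronskian V d zp,
    (v x 2 * weylMinus' V d zm x - v x 3 * weylMinus V d zm x) / weylWronskian V d zm,
    (v x 1 * weylSol V d zp x - v x 0 * weylSol' V d zp x) / weylWronskian V d zp,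
    (v x 3 * weylSol V d zm x - v x 2 * weylSol' V d zm x) / weylWronskian V d zm]

/-- The vector function with given coefficients with respect to the modes `hillMode`. -/
noncomputable def ofModes (V : ℝ → ℝ) (d : ℝ) (zp zm : ℂ) (c : ℝ → Fin 4 → ℂ) (x : ℝ) :
    Fin 4 → ℂ :=
  ![weylSol V d zp x * c x 0 + weylMinus V d zp x * c x 2,
    weylSol' V d zp x * c x 0 + weylMinus' V d zp x * c x 2,
    weylSol V d zm x * c x 1 + weylMinus V d zm x * c x 3,
    weylSol' V d zm x * c x 1 + weylMinus' V d zm x * c x 3]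

/-- Cramer's rule in each of the two planes `(u, u')`, with the constant Wronskian as determinant.
-/
theorem toModes_ofModes (hV : IsHillPotential V d) (hp : zp.im ≠ 0) (hm : zm.im ≠ 0)
    (c : ℝ → Fin 4 → ℂ) : toModes V d zp zm (ofModes V d zp zm c) = c := by
  funext x i
  have h1 := weylWronskian_ne_zero hV hp
  have h2 := weylWronskian_ne_zero hV hm
  have h3 := weylWronskian_eq hV hp x
  have h4 := weylWronskian_eq hV hm x
  fin_cases i <;> simp [toModes, ofModes, div_eq_iff, h1, h2]
  · linear_combination c x 0 * h3
  · linear_combination c x 1 * h4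
  · linear_combination c x 2 * h3
  · linear_combination c x 3 * h4

theorem ofModes_toModes (hV : IsHillPotential V d) (hp : zp.im ≠ 0) (hm : zm.im ≠ 0)
    (v : ℝ → Fin 4 → ℂ) : ofModes V d zp zm (toModes V d zp zm v) = v := by
  funext x i
  have h1 := weylWronskian_ne_zero hV hp
  have h2 := weylWronskian_ne_zero hV hm
  have h3 := weylWronskian_eq hV hp x
  have h4 := weylWronskian_eq hV hm x
  fin_cases i <;> simp [toModes, ofModes] <;> field_simp
  · linear_combination v x 0 * h3
  · linear_combination v x 1 * h3
  · linear_combination v x 2 * h4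
  · linear_combination v x 3 * h4

theorem hillMode_ne_zero (hV : IsHillPotential V d) (hp : zp.im ≠ 0) (hm : zm.im ≠ 0)
    (i : Fin 4) (x : ℝ) : hillMode V d zp zm i x ≠ 0 := by
  fin_cases i
  · exact weylSol_ne_zero hV hp x
  · exact weylSol_ne_zero hV hm x
  · exact weylMinus_ne_zero hV hp x
  · exact weylMinus_ne_zero hV hm x

theorem continuous_hillMode (hV : IsHillPotential V d) (hp : zp.im ≠ 0) (hm : zm.im ≠ 0)
    (i : Fin 4) : Continuous (hillMode V d zp zm i) := by
  fin_cases i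
  · exact (isWeylSol_weylSol hV hp).hill.continuous
  · exact (isWeylSol_weylSol hV hm).hill.continuous
  · exact (isHillSol_weylMinus hV hp).continuous
  · exact (isHillSol_weylMinus hV hm).continuous

theorem continuous_greenDiag (hV : IsHillPotential V d) (hp : zp.im ≠ 0) :
    Continuous (greenDiag V d zp) :=
  ((isWeylSol_weylSol hV hp).hill.continuous.mul (isHillSol_weylMinus hV hp).continuous).div_const _

/-- Variation of constants: the uncoupled part cancels by Hill's equation, leaving only terms with
`q`. Writing each as a mode quotient times the periodic Green diagonal isolates a bounded factor. -/
theorem hasDerivAt_toModes (hV : IsHillPotential V d) (hp : zp.im ≠ 0) (hm : zm.im ≠ 0)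
    {v : ℝ → Fin 4 → ℂ} {x : ℝ}
    (h : HasDerivAt v ((coupledMatrix V q zp zm x).mulVec (v x)) x) (i : Fin 4) :
    HasDerivAt (fun x => toModes V d zp zm v x i)
      (∑ l, hillCoupling V q d zp zm i l x * (hillMode V d zp zm l x / hillMode V d zp zm i x) *
        toModes V d zp zm v x l) x := by
  have hv := fun i => congrFun (congrFun (ofModes_toModes hV hp hm v) x) i
  set c := toModes V d zp zm v x with hc
  have e0 := hv 0
  have e2 := hv 2
  simp only [ofModes, Matrix.cons_val, ← hc] at e0 e2
  obtain ⟨h0, h1, h2, h3⟩ := hasDerivAt_coupledMatrix_iff.1 h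
  have hp1 := (isWeylSol_weylSol hV hp).hill
  have hm1 := (isWeylSol_weylSol hV hm).hill
  have hp2 := isHillSol_weylMinus hV hp
  have hm2 := isHillSol_weylMinus hV hm
  have w1 := weylWronskian_ne_zero hV hp
  have w2 := weylWronskian_ne_zero hV hm
  have n1 := weylSol_ne_zero hV hp x
  have n2 := weylSol_ne_zero hV hm x
  have n3 := weylMinus_ne_zero hV hp x
  have n4 := weylMinus_ne_zero hV hm x
  fin_cases i
  · refine (((h0.mul (hp2.hasDerivAt' x)).sub (h1.mul (hp2.hasDerivAt x))).div_const
      (weylWronskian V d zp)).congr_deriv ?_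
    simp [hillCoupling, hillMode, greenDiag, Fin.sum_univ_four]
    field_simp
    linear_combination weylMinus V d zp x * (-2 * (q x : ℂ) * e0 - q x * e2)
  · refine (((h2.mul (hm2.hasDerivAt' x)).sub (h3.mul (hm2.hasDerivAt x))).div_const
      (weylWronskian V d zm)).congr_deriv ?_
    simp [hillCoupling, hillMode, greenDiag, Fin.sum_univ_four]
    field_simp
    linear_combination weylMinus V d zm x * (-2 * (q x : ℂ) * e2 - q x * e0)
  · refine (((h1.mul (hp1.hasDerivAt x)).sub (h0.mul (hp1.hasDerivAt' x))).div_const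
      (weylWronskian V d zp)).congr_deriv ?_
    simp [hillCoupling, hillMode, greenDiag, Fin.sum_univ_four]
    field_simp
    linear_combination weylSol V d zp x * (2 * (q x : ℂ) * e0 + q x * e2)
  · refine (((h3.mul (hm1.hasDerivAt x)).sub (h2.mul (hm1.hasDerivAt' x))).div_const
      (weylWronskian V d zm)).congr_deriv ?_
    simp [hillCoupling, hillMode, greenDiag, Fin.sum_univ_four]
    field_simp
    linear_combination weylSol V d zm x * (2 * (q x : ℂ) * e2 + q x * e0)

theorem hasDerivAt_ofModes (hV : IsHillPotential V d) (hp : zp.im ≠ 0) (hm : zm.im ≠ 0)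
    {c : ℝ → Fin 4 → ℂ} {x : ℝ}
    (h : ∀ i, HasDerivAt (fun x => c x i)
      (∑ l, hillCoupling V q d zp zm i l x * (hillMode V d zp zm l x / hillMode V d zp zm i x) *
        c x l) x) :
    HasDerivAt (ofModes V d zp zm c)
      ((coupledMatrix V q zp zm x).mulVec (ofModes V d zp zm c x)) x := by
  rw [hasDerivAt_coupledMatrix_iff]
  have hp1 := (isWeylSol_weylSol hV hp).hill
  have hm1 := (isWeylSol_weylSol hV hm).hill
  have hp2 := isHillSol_weylMinus hV hp
  have hm2 := isHillSol_weylMinus hV hm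
  have w1 := weylWronskian_ne_zero hV hp
  have w2 := weylWronskian_ne_zero hV hm
  have n1 := weylSol_ne_zero hV hp x
  have n2 := weylSol_ne_zero hV hm x
  have n3 := weylMinus_ne_zero hV hp x
  have n4 := weylMinus_ne_zero hV hm x
  have h3 := weylWronskian_eq hV hp x
  have h4 := weylWronskian_eq hV hm x
  refine ⟨(((hp1.hasDerivAt x).mul (h 0)).add ((hp2.hasDerivAt x).mul (h 2))).congr_deriv ?_,
    (((hp1.hasDerivAt' x).mul (h 0)).add ((hp2.hasDerivAt' x).mul (h 2))).congr_deriv ?_,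
    (((hm1.hasDerivAt x).mul (h 1)).add ((hm2.hasDerivAt x).mul (h 3))).congr_deriv ?_,
    (((hm1.hasDerivAt' x).mul (h 1)).add ((hm2.hasDerivAt' x).mul (h 3))).congr_deriv ?_⟩
  · simp [hillCoupling, hillMode, greenDiag, Fin.sum_univ_four, ofModes]
    field_simp
    ring
  · simp [hillCoupling, hillMode, greenDiag, Fin.sum_univ_four, ofModes]
    field_simp
    linear_combination (-2 * (q x : ℂ) * (weylSol V d zp x * c x 0 + weylMinus V d zp x * c x 2) -
      q x * (weylSol V d zm x * c x 1 + weylMinus V d zm x * c x 3)) * h3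
  · simp [hillCoupling, hillMode, greenDiag, Fin.sum_univ_four, ofModes]
    field_simp
    ring
  · simp [hillCoupling, hillMode, greenDiag, Fin.sum_univ_four, ofModes]
    field_simp
    linear_combination (-2 * (q x : ℂ) * (weylSol V d zm x * c x 1 + weylMinus V d zm x * c x 3) -
      q x * (weylSol V d zp x * c x 0 + weylMinus V d zp x * c x 2)) * h4

end Coupled

/-! ### Uniform bounds for the mode system. -/

section Coupled

open Set MeasureTheory

variable {V q : ℝ → ℝ} {d β Q c g : ℝ} {zp zm : ℂ}

theorem IsCoupledSol.isModeSol (hV : IsHillPotential V d) (hp : zp.im ≠ 0) (hm : zm.im ≠ 0)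
    {v : ℝ → Fin 4 → ℂ} (h : IsCoupledSol V q zp zm v) :
    IsModeSol (hillMode V d zp zm) (hillCoupling V q d zp zm) (toModes V d zp zm v) := by
  refine ⟨fun i => ?_, fun x hx i => hasDerivAt_toModes hV hp hm (h.2 x hx) i⟩
  have hc : ∀ i, Continuous fun x => v x i := fun i => (continuous_apply i).comp h.1
  have hp1 := (isWeylSol_weylSol hV hp).hill
  have hm1 := (isWeylSol_weylSol hV hm).hill
  have hp2 := isHillSol_weylMinus hV hp
  have hm2 := isHillSol_weylMinus hV hm
  fin_cases i
  · exact (((hc 0).mul hp2.continuous').sub ((hc 1).mul hp2.continuous)).div_const _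
  · exact (((hc 2).mul hm2.continuous').sub ((hc 3).mul hm2.continuous)).div_const _
  · exact (((hc 1).mul hp1.continuous).sub ((hc 0).mul hp1.continuous')).div_const _
  · exact (((hc 3).mul hm1.continuous).sub ((hc 2).mul hm1.continuous')).div_const _

theorem norm_mul_div_mul_le {a b a' b' r s : ℂ} {c : ℝ} (ha : ‖a‖ ≤ c * ‖a'‖)
    (hb : ‖b‖ ≤ c * ‖b'‖) (h : ‖r‖⁻¹ ≤ c ^ 2 * ‖s‖⁻¹) (hc : 0 ≤ c) :
    ‖a * b / r‖ ≤ c ^ 4 * ‖a' * b' / s‖ := by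
  rw [div_eq_mul_inv, div_eq_mul_inv, norm_mul, norm_mul, norm_mul, norm_mul, norm_inv, norm_inv]
  calc ‖a‖ * ‖b‖ * ‖r‖⁻¹ ≤ (c * ‖a'‖) * (c * ‖b'‖) * (c ^ 2 * ‖s‖⁻¹) := by gcongr
    _ = _ := by ring

theorem HillBound.one_le (hV : IsHillPotential V d) (hp : zp.im ≠ 0) (h : HillBound V d zp c g) :
    1 ≤ c := by
  have := h.plus 0 0 le_rfl
  have h1 := norm_pos_iff.2 (weylSol_ne_zero hV hp 0)
  by_contra! h2
  nlinarith

theorem HillBound.green_nonneg (h : HillBound V d zp c g) : 0 ≤ g :=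
  (norm_nonneg _).trans (h.green 0)

/-- Every other coordinate plane replaces decaying modes by growing ones, each replacement costing
the constants of `HillBound`. The decay rates at `zp` and `zm` are never compared with each other,
so the constants survive a change in their order. -/
theorem modeBound_hillMode (hV : IsHillPotential V d) (hq : IsCoupling q β Q) (hp : zp.im ≠ 0)
    (hm : zm.im ≠ 0) (hbp : HillBound V d zp c g) (hbm : HillBound V d zm c g) :
    ModeBound (hillMode V d zp zm) (hillCoupling V q d zp zm) β (c ^ 4) (2 * g * Q) where
  ne_zero := hillMode_ne_zero hV hp hm
  continuous := continuous_hillMode hV hp hm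
  measurable i l := by
    refine Measurable.mul (Measurable.mul_const ?_ _)
      (Complex.measurable_ofReal.comp hq.measurable)
    have h1 := (continuous_greenDiag hV hp).measurable
    have h2 := (continuous_greenDiag hV hm).measurable
    fin_cases i
    · exact h1
    · exact h2
    · exact h1.neg
    · exact h2.neg
  norm_le i l x := by
    have h1 : ‖![greenDiag V d zp x, greenDiag V d zm x, -greenDiag V d zp x,
        -greenDiag V d zm x] i‖ ≤ g := by
      have h1 := hbp.green x
      have h2 := hbm.green x
      fin_cases i <;> simpa
    have h2 : ‖(!![2, 1, 2, 1; 1, 2, 1, 2; 2, 1, 2, 1; 1, 2, 1, 2] :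
        Matrix (Fin 4) (Fin 4) ℂ) i l‖ ≤ 2 := by
      fin_cases i <;> fin_cases l <;> simp
    have h3 : ‖(q x : ℂ)‖ ≤ Q * Real.exp (-(β * x)) := by
      rw [Complex.norm_real]; exact hq.abs_le_exp x
    unfold hillCoupling
    rw [norm_mul, norm_mul]
    have hg := hbp.green_nonneg
    calc _ ≤ g * 2 * (Q * Real.exp (-(β * x))) := by gcongr
      _ = _ := by ring
  ratio i j hij x t hxt := by
    have hc := hbp.one_le hV hp
    have hc0 : 0 ≤ c := by linarith
    have key : ∀ {z : ℂ}, z.im ≠ 0 → HillBound V d z c g →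
        ‖weylSol V d z x‖⁻¹ ≤ c * ‖weylSol V d z t‖⁻¹ := fun {z} hz hb => by
      have h1 := norm_pos_iff.2 (weylSol_ne_zero hV hz x)
      have h2 := norm_pos_iff.2 (weylSol_ne_zero hV hz t)
      rw [inv_le_iff_one_le_mul₀ h1]
      have := hb.plus x t hxt
      rw [show c * ‖weylSol V d z t‖⁻¹ * ‖weylSol V d z x‖ =
        (c * ‖weylSol V d z x‖) / ‖weylSol V d z t‖ by ring, le_div_iff₀ h2]
      linarith
    have n0 := weylSol_ne_zero hV hp
    have n1 := weylSol_ne_zero hV hm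
    have k0 := key hp hbp
    have k1 := key hm hbm
    have m2 := hbp.minus x t hxt
    have m3 := hbm.minus x t hxt
    have c2 : 1 ≤ c ^ 4 := one_le_pow₀ hc
    have c1 : c ≤ c ^ 4 := le_self_pow₀ hc (by norm_num)
    have k2 : ‖weylSol V d zp x * weylSol V d zm x‖⁻¹ ≤
        c ^ 2 * ‖weylSol V d zp t * weylSol V d zm t‖⁻¹ := by
      rw [norm_mul, norm_mul, mul_inv, mul_inv]
      calc _ ≤ (c * ‖weylSol V d zp t‖⁻¹) * (c * ‖weylSol V d zm t‖⁻¹) := by gcongr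
        _ = _ := by ring
    have e01 : ‖weylSol V d zp x * weylSol V d zm x / (weylSol V d zp x * weylSol V d zm x)‖ ≤
        c ^ 4 * ‖weylSol V d zp t * weylSol V d zm t / (weylSol V d zp t * weylSol V d zm t)‖ := by
      rw [div_self (mul_ne_zero (n0 x) (n1 x)), div_self (mul_ne_zero (n0 t) (n1 t))]
      simpa using c2
    have half : ∀ {a b r a' b' r' : ℂ}, ‖a‖ ≤ c * ‖a'‖ → r ≠ 0 → r' ≠ 0 →
        ‖b‖⁻¹ ≤ c * ‖b'‖⁻¹ →
        ‖r * a / (r * b)‖ ≤ c ^ 4 * ‖r' * a' / (r' * b')‖ := by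
      intro a b r a' b' r' h1 h2 h3 h4
      rw [mul_div_mul_left _ _ h2, mul_div_mul_left _ _ h3, norm_div, norm_div, div_eq_mul_inv,
        div_eq_mul_inv]
      calc ‖a‖ * ‖b‖⁻¹ ≤ (c * ‖a'‖) * (c * ‖b'‖⁻¹) := by gcongr
        _ = c ^ 2 * (‖a'‖ * ‖b'‖⁻¹) := by ring
        _ ≤ c ^ 4 * (‖a'‖ * ‖b'‖⁻¹) := by gcongr; norm_num
    have e02 := half m2 (n0 x) (n0 t) k1
    have e03 := half m3 (n0 x) (n0 t) k1
    have e12 := half m2 (n1 x) (n1 t) k0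
    have e13 := half m3 (n1 x) (n1 t) k0
    -- Both modes are replaced here, which uses all four factors `c` and explains the exponent `4`.
    have e23 := norm_mul_div_mul_le m2 m3 k2 hc0
    rw [mul_comm (weylSol V d zm x) (weylSol V d zp x),
      mul_comm (weylSol V d zm t) (weylSol V d zp t)] at e12 e13
    have key' : ∀ i j : Fin 4, i < j → ‖modeRatio (hillMode V d zp zm) i j x‖ ≤
        c ^ 4 * ‖modeRatio (hillMode V d zp zm) i j t‖ := by
      intro i j hij
      fin_cases i <;> fin_cases j <;> first | exact absurd hij (by decide) | skip
      · exact e01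
      · exact e02
      · exact e03
      · exact e12
      · exact e13
      · exact e23
    rcases lt_or_gt_of_ne hij with h | h
    · exact key' i j h
    · rw [modeRatio_comm _ i j, modeRatio_comm _ i j]
      exact key' j i h

theorem exists_bound_of_periodic {f : ℝ → ℂ} (hd : 0 < d) (hf : Continuous f)
    (h : Function.Periodic f d) : ∃ M : ℝ, ∀ x, ‖f x‖ ≤ M := by
  obtain ⟨M, hM⟩ := (isCompact_Icc (a := (0 : ℝ)) (b := d)).exists_bound_of_continuousOn
    hf.continuousOn
  refine ⟨M, fun x => ?_⟩
  obtain ⟨y, hy, hxy⟩ := h.exists_mem_Ico₀ hd x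
  rw [hxy]
  exact hM y (Ico_subset_Icc_self hy)

/-- Logarithmic derivatives of Weyl solutions are continuous and periodic. Consequently a mode
vector and its scalar mode have comparable size. -/
theorem exists_logDeriv_weyl_bound (hV : IsHillPotential V d) (hp : zp.im ≠ 0) :
    ∃ M : ℝ, ∀ x, ‖weylSol' V d zp x‖ ≤ M * ‖weylSol V d zp x‖ ∧
      ‖weylMinus' V d zp x‖ ≤ M * ‖weylMinus V d zp x‖ := by
  have h1 := isWeylSol_weylSol hV hp
  have h2 := isHillSol_weylMinus hV hp
  have n1 := weylSol_ne_zero hV hp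
  have n2 := weylMinus_ne_zero hV hp
  have hρ := floquetMult_ne_zero hV hp
  obtain ⟨M1, hM1⟩ := exists_bound_of_periodic (f := fun x => weylSol' V d zp x / weylSol V d zp x)
    hV.pos (h1.hill.continuous'.div h1.hill.continuous n1) fun x => by
      simp only []
      rw [h1.shift, h1.shift', mul_div_mul_left _ _ hρ]
  obtain ⟨M2, hM2⟩ := exists_bound_of_periodic
    (f := fun x => weylMinus' V d zp x / weylMinus V d zp x)
    hV.pos (h2.continuous'.div h2.continuous n2) fun x => by
      simp only []
      rw [(weylMinus_shift hV hp x).1, (weylMinus_shift hV hp x).2,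
        mul_div_mul_left _ _ (inv_ne_zero hρ)]
  refine ⟨max M1 M2, fun x => ⟨?_, ?_⟩⟩
  · have := (hM1 x).trans (le_max_left M1 M2)
    rwa [norm_div, div_le_iff₀ (norm_pos_iff.2 (n1 x))] at this
  · have := (hM2 x).trans (le_max_right M1 M2)
    rwa [norm_div, div_le_iff₀ (norm_pos_iff.2 (n2 x))] at this

theorem exists_hillBound (hV : IsHillPotential V d) (hp : zp.im ≠ 0) (hm : zm.im ≠ 0) :
    ∃ c g, HillBound V d zp c g ∧ HillBound V d zm c g := by
  obtain ⟨c, g, h⟩ := eventually_hillBound hV hp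
  obtain ⟨c', g', h'⟩ := eventually_hillBound hV hm
  exact ⟨max c c', max g g', h.self_of_nhds.mono (le_max_left _ _) (le_max_left _ _),
    h'.self_of_nhds.mono (le_max_right _ _) (le_max_right _ _)⟩

end Coupled

/-! ### Translation between vector asymptotics and mode asymptotics. -/

section Coupled

open Set MeasureTheory

variable {V q : ℝ → ℝ} {d β Q c g : ℝ} {zp zm : ℂ}

/-- The solution vector of the uncoupled system given by the mode `j`. -/
noncomputable def hillVec (V : ℝ → ℝ) (d : ℝ) (zp zm : ℂ) (j : Fin 4) : ℝ → Fin 4 → ℂ :=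
  ofModes V d zp zm fun _ => Pi.single j 1

theorem isBigO_hillVec (hV : IsHillPotential V d) (hp : zp.im ≠ 0) (hm : zm.im ≠ 0) (j : Fin 4)
    (l : Filter ℝ) : hillVec V d zp zm j =O[l] hillMode V d zp zm j := by
  obtain ⟨M, hM⟩ := exists_logDeriv_weyl_bound hV hp
  obtain ⟨M', hM'⟩ := exists_logDeriv_weyl_bound hV hm
  have hs : ∀ f : ℝ → ℂ, f =O[l] f := fun f => isBigO_refl f l
  have a1 : weylSol' V d zp =O[l] weylSol V d zp := .of_bound M (.of_forall fun x => (hM x).1)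
  have a2 : weylMinus' V d zp =O[l] weylMinus V d zp := .of_bound M (.of_forall fun x => (hM x).2)
  have a3 : weylSol' V d zm =O[l] weylSol V d zm := .of_bound M' (.of_forall fun x => (hM' x).1)
  have a4 : weylMinus' V d zm =O[l] weylMinus V d zm :=
    .of_bound M' (.of_forall fun x => (hM' x).2)
  rw [isBigO_pi]
  intro i
  fin_cases j <;> fin_cases i <;>
    simp [hillVec, ofModes, hillMode, isBigO_zero, isBigO_refl] <;> assumption

theorem isBigO_hillMode (j : Fin 4) (l : Filter ℝ) :
    hillMode V d zp zm j =O[l] hillVec V d zp zm j := by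
  refine .of_bound 1 (.of_forall fun x => ?_)
  rw [one_mul]
  fin_cases j
  · simpa [hillVec, ofModes, hillMode] using norm_le_pi_norm (hillVec V d zp zm 0 x) 0
  · simpa [hillVec, ofModes, hillMode] using norm_le_pi_norm (hillVec V d zp zm 1 x) 2
  · simpa [hillVec, ofModes, hillMode] using norm_le_pi_norm (hillVec V d zp zm 2 x) 0
  · simpa [hillVec, ofModes, hillMode] using norm_le_pi_norm (hillVec V d zp zm 3 x) 2

/-- Multiplying a coefficient by its own mode leaves products such as `ψ χ / W` and `ψ χ' / W` in
front of the components of `u`; all of these are bounded. -/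
theorem isLittleO_toModes (hV : IsHillPotential V d) (hp : zp.im ≠ 0) (hm : zm.im ≠ 0)
    {u : ℝ → Fin 4 → ℂ} {f : ℝ → ℂ} {l : Filter ℝ} (hu : u =o[l] f) (i : Fin 4) :
    (fun x => hillMode V d zp zm i x * toModes V d zp zm u x i) =o[l] f := by
  obtain ⟨M, hM⟩ := exists_logDeriv_weyl_bound hV hp
  obtain ⟨M', hM'⟩ := exists_logDeriv_weyl_bound hV hm
  obtain ⟨c, g, hbp, hbm⟩ := exists_hillBound hV hp hm
  have hu' := isLittleO_pi.1 hu
  have key : ∀ {a b : ℝ → ℂ} {K K' : ℝ} (i j : Fin 4), (∀ x, ‖a x‖ ≤ K) → (∀ x, ‖b x‖ ≤ K') →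
      (fun x => a x * u x i - b x * u x j) =o[l] f := by
    intro a b K K' i j ha hb
    have h1 : a =O[l] (fun _ => (1 : ℂ)) := .of_bound K (.of_forall fun x => by simpa using ha x)
    have h2 : b =O[l] (fun _ => (1 : ℂ)) := .of_bound K' (.of_forall fun x => by simpa using hb x)
    have h3 := (h1.mul_isLittleO (hu' i)).sub (h2.mul_isLittleO (hu' j))
    simpa using h3
  have hG : ∀ {z : ℂ} {M : ℝ}, z.im ≠ 0 → HillBound V d z c g →
      (∀ x, ‖weylSol' V d z x‖ ≤ M * ‖weylSol V d z x‖ ∧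
      ‖weylMinus' V d z x‖ ≤ M * ‖weylMinus V d z x‖) →
      (∀ x, ‖weylSol V d z x * weylMinus' V d z x / weylWronskian V d z‖ ≤ M * g) ∧
      ∀ x, ‖weylMinus V d z x * weylSol' V d z x / weylWronskian V d z‖ ≤ M * g := by
    intro z M hz hb hM
    have hM0 : 0 ≤ M := by
      have := (norm_nonneg _).trans (hM 0).1
      exact nonneg_of_mul_nonneg_left this (norm_pos_iff.2 (weylSol_ne_zero hV hz 0))
    refine ⟨fun x => ?_, fun x => ?_⟩
    · calc _ ≤ M * ‖greenDiag V d z x‖ := by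
            rw [greenDiag, norm_div, norm_div, norm_mul, norm_mul, ← mul_div_assoc]
            refine div_le_div_of_nonneg_right ?_ (norm_nonneg _)
            calc _ ≤ ‖weylSol V d z x‖ * (M * ‖weylMinus V d z x‖) := by gcongr; exact (hM x).2
              _ = _ := by ring
        _ ≤ _ := by gcongr; exact hb.green x
    · calc _ ≤ M * ‖greenDiag V d z x‖ := by
            rw [greenDiag, norm_div, norm_div, norm_mul, norm_mul, ← mul_div_assoc]
            refine div_le_div_of_nonneg_right ?_ (norm_nonneg _)
            calc _ ≤ ‖weylMinus V d z x‖ * (M * ‖weylSol V d z x‖) := by gcongr; exact (hM x).1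
              _ = _ := by ring
        _ ≤ _ := by gcongr; exact hb.green x
  have hGp := hG hp hbp hM
  have hGm := hG hm hbm hM'
  fin_cases i
  · refine (key 0 1 hGp.1 hbp.green).congr_left fun x => ?_
    simp [toModes, hillMode, greenDiag]; ring
  · refine (key 2 3 hGm.1 hbm.green).congr_left fun x => ?_
    simp [toModes, hillMode, greenDiag]; ring
  · refine (key 1 0 hbp.green hGp.2).congr_left fun x => ?_
    simp [toModes, hillMode, greenDiag]; ring
  · refine (key 3 2 hbm.green hGm.2).congr_left fun x => ?_
    simp [toModes, hillMode, greenDiag]; ring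

theorem isLittleO_ofModes (hV : IsHillPotential V d) (hp : zp.im ≠ 0) (hm : zm.im ≠ 0)
    {c : ℝ → Fin 4 → ℂ} {f : ℝ → ℂ} {l : Filter ℝ}
    (hc : ∀ i, (fun x => hillMode V d zp zm i x * c x i) =o[l] f) :
    ofModes V d zp zm c =o[l] f := by
  obtain ⟨M, hM⟩ := exists_logDeriv_weyl_bound hV hp
  obtain ⟨M', hM'⟩ := exists_logDeriv_weyl_bound hV hm
  have key : ∀ {a b c : ℝ → ℂ} {K : ℝ}, (∀ x, ‖a x‖ ≤ K * ‖b x‖) →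
      (fun x => b x * c x) =o[l] f → (fun x => a x * c x) =o[l] f := fun {a b c K} h h' =>
    (IsBigO.of_bound K (.of_forall fun x => by
      rw [norm_mul, norm_mul, ← mul_assoc]; gcongr; exact h x)).trans_isLittleO h'
  rw [isLittleO_pi]
  intro i
  fin_cases i
  · exact (hc 0).add (hc 2)
  · exact (key (fun x => (hM x).1) (hc 0)).add (key (fun x => (hM x).2) (hc 2))
  · exact (hc 1).add (hc 3)
  · exact (key (fun x => (hM' x).1) (hc 1)).add (key (fun x => (hM' x).2) (hc 3))

theorem toModes_sub (v w : ℝ → Fin 4 → ℂ) (x : ℝ) (i : Fin 4) :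
    toModes V d zp zm (v - w) x i = toModes V d zp zm v x i - toModes V d zp zm w x i := by
  fin_cases i <;> simp [toModes] <;> ring

theorem ofModes_sub (v w : ℝ → Fin 4 → ℂ) :
    ofModes V d zp zm (v - w) = ofModes V d zp zm v - ofModes V d zp zm w := by
  funext x i
  fin_cases i <;> simp [ofModes] <;> ring

theorem isAsymptoticMode_iff_isLittleO {χ : Fin 4 → ℝ → ℂ} (hχ : ∀ i x, χ i x ≠ 0)
    {a : ℝ → Fin 4 → ℂ} {j : Fin 4} : IsAsymptoticMode χ a j ↔
      ∀ i, (fun x => χ i x * (a x i - (Pi.single j 1 : Fin 4 → ℂ) i)) =o[atTop] χ j := by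
  refine forall_congr' fun i => ?_
  rw [isLittleO_iff_tendsto fun x hx => absurd hx (hχ j x),
    ← tendsto_sub_nhds_zero_iff (x := if i = j then (1 : ℂ) else 0)]
  refine tendsto_congr fun x => ?_
  rcases eq_or_ne i j with rfl | h
  · have := hχ i x
    simp; field_simp
  · simp [h]

/-- Both directions apply a linear change of coordinates to the error. It preserves smallness
relative to the scalar mode, which is comparable to the mode vector. -/
theorem isEquivalent_hillVec_iff (hV : IsHillPotential V d) (hp : zp.im ≠ 0) (hm : zm.im ≠ 0)
    {v : ℝ → Fin 4 → ℂ} {j : Fin 4} : v ~[atTop] hillVec V d zp zm j ↔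
      IsAsymptoticMode (hillMode V d zp zm) (toModes V d zp zm v) j := by
  rw [isAsymptoticMode_iff_isLittleO (hillMode_ne_zero hV hp hm)]
  constructor
  · intro h i
    have h1 := isLittleO_toModes hV hp hm
      (IsLittleO.trans_isBigO h (isBigO_hillVec hV hp hm j atTop)) i
    refine h1.congr_left fun x => ?_
    rw [toModes_sub, hillVec, toModes_ofModes hV hp hm]
  · intro h
    have h1 := isLittleO_ofModes (c := toModes V d zp zm v - fun _ => Pi.single j 1) hV hp hm h
    rw [ofModes_sub, ofModes_toModes hV hp hm] at h1
    exact h1.trans_isBigO (isBigO_hillMode j atTop)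

theorem exists_coupledMatrix_bound (hV : IsHillPotential V d) (hq : IsCoupling q β Q)
    (zp zm : ℂ) : ∃ L : ℝ, 0 < L ∧ ∀ x i j, ‖coupledMatrix V q zp zm x i j‖ ≤ L := by
  obtain ⟨B, hB⟩ := hV.exists_bound
  have hQ := hq.nonneg
  have hB0 : 0 ≤ B := (abs_nonneg _).trans (hB 0)
  have h1 : ∀ x, ‖(q x : ℂ)‖ ≤ Q := fun x => by
    rw [Complex.norm_real]; exact hq.abs_le_const x
  have h2 : ∀ x, ‖(V x : ℂ)‖ ≤ B := fun x => by
    rw [Complex.norm_real]; exact hB x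
  have h3 : ∀ x (z : ℂ), ‖(V x : ℂ) - 2 * (q x : ℂ) - z‖ ≤ B + 2 * Q + ‖z‖ := fun x z => by
    refine (norm_sub_le _ _).trans (add_le_add_left ((norm_sub_le _ _).trans ?_) _)
    rw [norm_mul, Complex.norm_ofNat]
    have := h1 x
    have := h2 x
    linarith
  refine ⟨B + 2 * Q + ‖zp‖ + ‖zm‖ + 1, by positivity, fun x i j => ?_⟩
  have h3p := h3 x zp
  have h3m := h3 x zm
  have := hq.abs_le_const x
  have := norm_nonneg zp
  have := norm_nonneg zm
  fin_cases i <;> fin_cases j <;> simp [coupledMatrix] <;> linarith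

theorem continuousAt_coupledMatrix (hV : IsHillPotential V d) (hq : IsCoupling q β Q)
    {x : ℝ} (hx : x ≠ 0) (i j : Fin 4) :
    ContinuousAt (fun t => coupledMatrix V q zp zm t i j) x := by
  have h1 : ContinuousAt (fun t => (V t : ℂ)) x :=
    (Complex.continuous_ofReal.comp hV.continuous).continuousAt
  have h2 : ContinuousAt (fun t => (q t : ℂ)) x :=
    Complex.continuous_ofReal.continuousAt.comp (hq.continuousAt x hx)
  have h3 : ∀ z, ContinuousAt (fun t => (V t : ℂ) - 2 * (q t : ℂ) - z) x := fun z =>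
    (h1.sub (h2.const_mul 2)).sub continuousAt_const
  fin_cases i <;> fin_cases j <;> simp [coupledMatrix] <;>
    first | exact continuousAt_const | exact h3 _ | exact h2.neg

theorem measurable_coupledMatrix (hV : IsHillPotential V d) (hq : IsCoupling q β Q)
    (i j : Fin 4) : Measurable (fun t => coupledMatrix V q zp zm t i j) := by
  have h1 : Measurable (fun t => (V t : ℂ)) :=
    (Complex.continuous_ofReal.comp hV.continuous).measurable
  have h2 : Measurable (fun t => (q t : ℂ)) := Complex.measurable_ofReal.comp hq.measurable
  have h3 : ∀ z, Measurable (fun t => (V t : ℂ) - 2 * (q t : ℂ) - z) := fun z =>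
    (h1.sub (h2.const_mul 2)).sub measurable_const
  fin_cases i <;> fin_cases j <;> simp [coupledMatrix] <;>
    first | exact measurable_const | exact h3 _ | exact h2

theorem lipschitzWith_mulVec {A : Matrix (Fin 4) (Fin 4) ℂ} {L : ℝ} (hL : 0 ≤ L)
    (hA : ∀ i j, ‖A i j‖ ≤ L) : LipschitzWith (4 * L).toNNReal A.mulVec := by
  refine LipschitzWith.of_dist_le_mul fun u v => ?_
  rw [dist_eq_norm, dist_eq_norm, ← Matrix.mulVec_sub, Real.coe_toNNReal _ (by positivity),
    pi_norm_le_iff_of_nonneg (by positivity)]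
  intro i
  rw [Matrix.mulVec, dotProduct]
  refine (norm_sum_le _ _).trans ?_
  calc ∑ j, ‖A i j * (u - v) j‖ ≤ ∑ _j : Fin 4, L * ‖u - v‖ := by
        refine Finset.sum_le_sum fun j _ => ?_
        rw [norm_mul]
        exact mul_le_mul (hA i j) (norm_le_pi_norm _ j) (norm_nonneg _) hL
    _ = 4 * L * ‖u - v‖ := by simp; ring

/-- A solution defined near `+∞` agrees there with a global one. -/
theorem exists_isCoupledSol_eqOn (hV : IsHillPotential V d) (hq : IsCoupling q β Q)
    {X : ℝ} (hX : 0 < X) {v : ℝ → Fin 4 → ℂ}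
    (hv : ∀ x, X ≤ x → HasDerivAt v ((coupledMatrix V q zp zm x).mulVec (v x)) x) :
    ∃ u, IsCoupledSol V q zp zm u ∧ ∀ x, X ≤ x → u x = v x := by
  obtain ⟨L, hL, hA⟩ := exists_coupledMatrix_bound hV hq zp zm
  have hm := measurable_coupledMatrix (zp := zp) (zm := zm) hV hq
  set u := linSol (fun x i j => coupledMatrix V q zp zm x i j) X (v X) with hu
  have hus : IsCoupledSol V q zp zm u := by
    refine ⟨continuous_pi fun i => continuous_linSol hm hL hA X i, fun x hx => ?_⟩
    rw [hasDerivAt_pi]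
    exact fun i => hasDerivAt_linSol hm hL hA X x i fun j => continuousAt_coupledMatrix hV hq hx i j
  refine ⟨u, hus, fun x hx => ?_⟩
  refine ODE_solution_unique (v := fun t => (coupledMatrix V q zp zm t).mulVec)
    (fun t => lipschitzWith_mulVec hL.le (hA t)) hus.1.continuousOn
    (fun t ht => (hus.2 t (hX.trans_le ht.1).ne').hasDerivWithinAt)
    (fun t ht => (hv t ht.1).continuousAt.continuousWithinAt)
    (fun t ht => (hv t ht.1).hasDerivWithinAt)
    (funext fun i => linSol_self hm hL hA X i) ⟨hx, le_rfl⟩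

theorem exists_isCoupledSol_isEquivalent (hV : IsHillPotential V d) (hq : IsCoupling q β Q)
    (hp : zp.im ≠ 0) (hm : zm.im ≠ 0) (j : Fin 4) :
    ∃ v, IsCoupledSol V q zp zm v ∧ v ~[atTop] hillVec V d zp zm j := by
  obtain ⟨c, g, hbp, hbm⟩ := exists_hillBound hV hp hm
  have hB := modeBound_hillMode hV hq hp hm hbp hbm
  have hρp := floquetMult_ne_zero hV hp
  have hρm := floquetMult_ne_zero hV hm
  obtain ⟨fwd, C, hD⟩ := exists_modeDichotomy (τ := ![floquetMult V d zp, floquetMult V d zm,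
    (floquetMult V d zp)⁻¹, (floquetMult V d zm)⁻¹]) hV.pos (continuous_hillMode hV hp hm)
    (hillMode_ne_zero hV hp hm) (fun i => by fin_cases i <;> simp [hρp, hρm])
    (fun i x => by
      fin_cases i
      · exact (isWeylSol_weylSol hV hp).shift x
      · exact (isWeylSol_weylSol hV hm).shift x
      · exact (weylMinus_shift hV hp x).1
      · exact (weylMinus_shift hV hm x).1) j
  obtain ⟨X, a, hX, ha, ha'⟩ := hB.exists_asymptotic hq.pos hD fun i l x hx => by
    refine ContinuousAt.mul (ContinuousAt.mul ?_ continuousAt_const)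
      (Complex.continuous_ofReal.continuousAt.comp (hq.continuousAt x hx.ne'))
    have h1 := (continuous_greenDiag hV hp).continuousAt (x := x)
    have h2 := (continuous_greenDiag hV hm).continuousAt (x := x)
    fin_cases i
    · exact h1
    · exact h2
    · exact h1.neg
    · exact h2.neg
  -- Moving to `X + 1` makes the starting point positive, past the jump, and strictly beyond `X`,
  -- where the derivative is known.
  obtain ⟨v, hv, hva⟩ := exists_isCoupledSol_eqOn (X := X + 1) (v := ofModes V d zp zm a) hV hq
    (by linarith) fun x hx => hasDerivAt_ofModes hV hp hm (ha x (by linarith))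
  refine ⟨v, hv, ?_⟩
  have h1 : ofModes V d zp zm a ~[atTop] hillVec V d zp zm j := by
    rwa [isEquivalent_hillVec_iff hV hp hm, toModes_ofModes hV hp hm]
  refine h1.congr_left ?_
  filter_upwards [eventually_ge_atTop (X + 1)] with x hx using (hva x hx).symm

end Coupled

/-! ### Bloch waves are Weyl solutions; reflection; the determinant formula. -/

section Bloch

open Set

variable {V q : ℝ → ℝ} {d β Q c g : ℝ} {z k zp zm : ℂ} {ψ : ℝ → ℂ}

theorem IsBlochWave.isHillSol (h : IsBlochWave V d z k ψ) : IsHillSol V z ψ (deriv ψ) :=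
  ⟨fun x => (h.differentiable x).hasDerivAt, h.hill⟩

theorem IsBlochWave.isWeylSol (hd : 0 < d) (hk : 0 < k.im) (h : IsBlochWave V d z k ψ) :
    IsWeylSol V d z (Complex.exp (Complex.I * k * d)) ψ (deriv ψ) := by
  obtain ⟨p, hp, hp0, hψ⟩ := h.bloch
  have hs : ∀ x, ψ (x + d) = Complex.exp (Complex.I * k * d) * ψ x := fun x => by
    rw [hψ, hψ, hp x, Complex.ofReal_add, mul_add, Complex.exp_add]; ring
  refine ⟨h.isHillSol, by simp [hψ, hp0], hs, fun x => ?_, ?_⟩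
  · have h1 : deriv (fun x => ψ (x + d)) x = deriv ψ (x + d) := deriv_comp_add_const ..
    rw [← h1, funext hs, deriv_const_mul _ (h.differentiable x)]
  · rw [Complex.norm_exp, Real.exp_lt_one_iff]
    simp
    positivity

theorem IsBlochWave.reflect (h : IsBlochWave V d z k ψ) :
    IsBlochWave (fun x => V (-x)) d z (-k) (fun x => ψ (-x)) := by
  have h1 := h.isHillSol.reflect
  obtain ⟨p, hp, hp0, hψ⟩ := h.bloch
  refine ⟨fun x => (h1.hasDerivAt x).differentiableAt, fun x => ?_, fun x => p (-x), fun x => ?_,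
    by simpa using hp0, fun x => ?_⟩
  · rw [h1.deriv_eq]
    exact h1.hasDerivAt' x
  · simp only []
    rw [← hp (-(x + d))]
    congr 1; ring
  · rw [hψ]
    congr 2
    push_cast; ring

theorem IsWeylSol.isBlochWave {ψ' : ℝ → ℂ}
    (h : IsWeylSol V d z (Complex.exp (Complex.I * k * d)) ψ ψ') : IsBlochWave V d z k ψ := by
  refine ⟨fun x => (h.hill.hasDerivAt x).differentiableAt, fun x => ?_,
    fun x => ψ x * Complex.exp (-(Complex.I * k * x)), fun x => ?_, by simp [h.zero], fun x => ?_⟩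
  · rw [h.hill.deriv_eq]
    exact h.hill.hasDerivAt' x
  · simp only []
    rw [h.shift, Complex.ofReal_add, mul_add, neg_add, Complex.exp_add,
      Complex.exp_neg (Complex.I * k * d)]
    field_simp [Complex.exp_ne_zero]
  · rw [mul_assoc, ← Complex.exp_add]
    simp

/-- The exponent `k` is determined only up to multiples of `2π/d`, but the wave itself is fixed by
uniqueness of the normalized decaying solution. -/
theorem IsBlochWave.eq_weylSol (hV : IsHillPotential V d) (hz : z.im ≠ 0) (hk : 0 < k.im)
    (h : IsBlochWave V d z k ψ) : ψ = weylSol V d z ∧ deriv ψ = weylSol' V d z := by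
  have := (h.isWeylSol hV.pos hk).unique hV (isWeylSol_weylSol hV hz)
  exact ⟨this.1, this.2.1⟩

theorem IsBlochWave.eq_weylMinus (hV : IsHillPotential V d) (hz : z.im ≠ 0) (hk : 0 < k.im)
    (h : IsBlochWave V d z (-k) ψ) : ψ = weylMinus V d z ∧ deriv ψ = weylMinus' V d z := by
  have h1 := h.reflect
  rw [neg_neg] at h1
  have h2 := (h1.eq_weylSol hV.reflect hz hk).1
  have h3 : ψ = weylMinus V d z := by
    funext x
    have := congrFun h2 (-x)
    rwa [neg_neg] at this
  refine ⟨h3, ?_⟩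
  rw [h3, (isHillSol_weylMinus hV hz).deriv_eq]

/-- Taking `k = -i log ρ / d` gives `Im k = -log ‖ρ‖ / d > 0`. The same `k` serves both ends because
reflection preserves the multiplier. -/
theorem exists_isBlochWave (hV : IsHillPotential V d) (hz : z.im ≠ 0) :
    ∃ k : ℂ, 0 < k.im ∧ IsBlochWave V d z k (weylSol V d z) ∧
      IsBlochWave V d z (-k) (weylMinus V d z) := by
  have h1 := isWeylSol_weylSol hV hz
  have hρ := floquetMult_ne_zero hV hz
  have hd := hV.pos
  have hd' : (d : ℂ) ≠ 0 := by exact_mod_cast hd.ne'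
  have hk : Complex.exp (Complex.I * (-Complex.I * (Complex.log (floquetMult V d z) / d)) * d) =
      floquetMult V d z := by
    rw [show Complex.I * (-Complex.I * (Complex.log (floquetMult V d z) / d)) * d =
      -(Complex.I * Complex.I) * (Complex.log (floquetMult V d z) / d * d) by ring,
      Complex.I_mul_I, div_mul_cancel₀ _ hd', neg_neg, one_mul, Complex.exp_log hρ]
  refine ⟨-Complex.I * (Complex.log (floquetMult V d z) / d), ?_, ?_, ?_⟩
  · have : Real.log ‖floquetMult V d z‖ < 0 := Real.log_neg (norm_pos_iff.2 hρ) h1.norm_lt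
    simp [Complex.div_ofReal_re, Complex.log_re]
    exact div_neg_of_neg_of_pos this hd
  · refine IsWeylSol.isBlochWave (ψ' := weylSol' V d z) ?_
    rwa [hk]
  · have h2 := isWeylSol_weylSol hV.reflect hz
    rw [floquetMult_reflect hV hz, ← hk] at h2
    have h3 := h2.isBlochWave.reflect
    simp only [neg_neg] at h3
    exact h3

/-- Reflection only moves the point and changes signs of components, so it preserves the supremum
norm. -/
theorem reflectVec_isEquivalent {v w : ℝ → Fin 4 → ℂ} {l l' : Filter ℝ}
    (h : v ~[l] w) (hl : Tendsto (fun x : ℝ => -x) l' l) : reflectVec v ~[l'] reflectVec w := by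
  have hn : ∀ (u : ℝ → Fin 4 → ℂ) x, ‖reflectVec u x‖ = ‖u (-x)‖ := by
    intro u x
    refine le_antisymm ((pi_norm_le_iff_of_nonneg (norm_nonneg _)).2 fun i => ?_)
      ((pi_norm_le_iff_of_nonneg (norm_nonneg _)).2 fun i => ?_)
    · have := norm_le_pi_norm (u (-x)) i
      fin_cases i <;> simpa [reflectVec] using this
    · have := norm_le_pi_norm (reflectVec u x) i
      fin_cases i <;> simpa [reflectVec] using this
  have h1 : ((v - w) ∘ fun x => -x) =o[l'] (w ∘ fun x => -x) := h.isLittleO.comp_tendsto hl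
  have h2 : reflectVec (v - w) = reflectVec v - reflectVec w := by
    funext x i
    fin_cases i <;> simp [reflectVec] <;> ring
  change (reflectVec v - reflectVec w) =o[l'] reflectVec w
  rw [← h2]
  refine .of_norm_norm ?_
  rw [funext (hn _), funext (hn _)]
  exact h1.norm_norm

theorem weylMinus_reflect (x : ℝ) :
    weylMinus (fun x => V (-x)) d z x = weylSol V d z (-x) ∧
      weylMinus' (fun x => V (-x)) d z x = -weylSol' V d z (-x) := by
  simp [weylMinus, weylMinus']

theorem hillVec_zero :
    hillVec V d zp zm 0 = fun x => ![weylSol V d zp x, weylSol' V d zp x, 0, 0] := by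
  funext x i
  fin_cases i <;> simp [hillVec, ofModes]

theorem hillVec_one :
    hillVec V d zp zm 1 = fun x => ![0, 0, weylSol V d zm x, weylSol' V d zm x] := by
  funext x i
  fin_cases i <;> simp [hillVec, ofModes]

theorem reflectVec_hillVec_zero : reflectVec (hillVec (fun x => V (-x)) d zp zm 0) =
    fun x => ![weylMinus V d zp x, weylMinus' V d zp x, 0, 0] := by
  funext x i
  fin_cases i <;> simp [hillVec, ofModes, reflectVec, weylMinus, weylMinus']

theorem reflectVec_hillVec_one : reflectVec (hillVec (fun x => V (-x)) d zp zm 1) =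
    fun x => ![0, 0, weylMinus V d zm x, weylMinus' V d zm x] := by
  funext x i
  fin_cases i <;> simp [hillVec, ofModes, reflectVec, weylMinus, weylMinus']

/-- The Evans function of the coupled system in terms of the Plücker coordinates of the planes
of solutions decaying at `+∞` and at `-∞`. -/
noncomputable def coupledEvans (V q : ℝ → ℝ) (d xs : ℝ) (zp zm : ℂ) : ℂ :=
  let P := planeSol (hillMode V d zp zm) (hillCoupling V q d zp zm) xs xs
  let R := planeSol (hillMode (fun x => V (-x)) d zp zm)
    (hillCoupling (fun x => V (-x)) (fun x => q (-x)) d zp zm) (-xs) (-xs);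
  -(weylWronskian V d zp * weylWronskian V d zm) *
    (R (2, 3) * P (2, 3) - R (2, 0) * P (1, 3) + R (2, 1) * P (1, 2) + R (3, 0) * P (0, 3) -
      R (3, 1) * P (0, 2) + R (0, 1) * P (0, 1))

/-- The matrix factors as coefficient vectors times the basis of modes. The basis has determinant
minus the product of the two Wronskians, and the coefficient determinant is Laplace-expanded along
its first two rows. -/
theorem det_columns (a b c e : Fin 4 → ℂ) (P1 P1' P2 P2' M1 M1' M2 M2' : ℂ) :
    (Matrix.of ![
      ![P1 * a 0 + P2 * a 2, P1' * a 0 + P2' * a 2, M1 * a 1 + M2 * a 3, M1' * a 1 + M2' * a 3],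
      ![P1 * b 0 + P2 * b 2, P1' * b 0 + P2' * b 2, M1 * b 1 + M2 * b 3, M1' * b 1 + M2' * b 3],
      ![P1 * c 0 + P2 * c 2, P1' * c 0 + P2' * c 2, M1 * c 1 + M2 * c 3, M1' * c 1 + M2' * c 3],
      ![P1 * e 0 + P2 * e 2, P1' * e 0 + P2' * e 2, M1 * e 1 + M2 * e 3,
        M1' * e 1 + M2' * e 3]]).transpose.det =
    -((P1 * P2' - P1' * P2) * (M1 * M2' - M1' * M2)) *
      ((a 0 * b 1 - a 1 * b 0) * (c 2 * e 3 - c 3 * e 2) -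
        (a 0 * b 2 - a 2 * b 0) * (c 1 * e 3 - c 3 * e 1) +
        (a 0 * b 3 - a 3 * b 0) * (c 1 * e 2 - c 2 * e 1) +
        (a 1 * b 2 - a 2 * b 1) * (c 0 * e 3 - c 3 * e 0) -
        (a 1 * b 3 - a 3 * b 1) * (c 0 * e 2 - c 2 * e 0) +
        (a 2 * b 3 - a 3 * b 2) * (c 0 * e 1 - c 1 * e 0)) := by
  rw [Matrix.det_transpose]
  have h : (Matrix.of ![
      ![P1 * a 0 + P2 * a 2, P1' * a 0 + P2' * a 2, M1 * a 1 + M2 * a 3, M1' * a 1 + M2' * a 3],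
      ![P1 * b 0 + P2 * b 2, P1' * b 0 + P2' * b 2, M1 * b 1 + M2 * b 3, M1' * b 1 + M2' * b 3],
      ![P1 * c 0 + P2 * c 2, P1' * c 0 + P2' * c 2, M1 * c 1 + M2 * c 3, M1' * c 1 + M2' * c 3],
      ![P1 * e 0 + P2 * e 2, P1' * e 0 + P2' * e 2, M1 * e 1 + M2 * e 3,
        M1' * e 1 + M2' * e 3]]) = Matrix.of ![a, b, c, e] *
      !![P1, P1', 0, 0; 0, 0, M1, M1'; P2, P2', 0, 0; 0, 0, M2, M2'] := by
    ext i j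
    fin_cases i <;> fin_cases j <;> simp [Matrix.mul_apply, Fin.sum_univ_four] <;> ring
  rw [h, Matrix.det_mul]
  simp [Matrix.det_succ_row_zero, Fin.sum_univ_succ, Fin.succAbove]
  ring

end Bloch

/-! ### The Evans value is well defined. -/

section Evans

open Set

variable {V q : ℝ → ℝ} {d β Q c g : ℝ} {zp zm : ℂ}

/-- By the Laplace expansion only the two wedges enter, and both are fixed by their integral
equations. In each product the normalizing mode ratio at `+∞` is the inverse of the one at `-∞`, so
the normalizations cancel. -/
theorem det_eq_coupledEvans (hV : IsHillPotential V d) (hq : IsCoupling q β Q)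
    (hp : zp.im ≠ 0) (hm : zm.im ≠ 0) {vm₁ vm₂ vp₁ vp₂ : ℝ → Fin 4 → ℂ}
    (hm₁ : IsCoupledSol V q zp zm vm₁) (hm₂ : IsCoupledSol V q zp zm vm₂)
    (hp₁ : IsCoupledSol V q zp zm vp₁) (hp₂ : IsCoupledSol V q zp zm vp₂)
    (am₁ : reflectVec vm₁ ~[atTop] hillVec (fun x => V (-x)) d zp zm 0)
    (am₂ : reflectVec vm₂ ~[atTop] hillVec (fun x => V (-x)) d zp zm 1)
    (ap₁ : vp₁ ~[atTop] hillVec V d zp zm 0) (ap₂ : vp₂ ~[atTop] hillVec V d zp zm 1) (xs : ℝ) :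
    (Matrix.of ![vm₁ xs, vm₂ xs, vp₁ xs, vp₂ xs]).transpose.det =
      coupledEvans V q d xs zp zm := by
  obtain ⟨c, g, hbp, hbm⟩ := exists_hillBound hV hp hm
  obtain ⟨c', g', hbp', hbm'⟩ := exists_hillBound hV.reflect hp hm
  have hB := modeBound_hillMode hV hq hp hm hbp hbm
  have hB' := modeBound_hillMode hV.reflect hq.reflect hp hm hbp' hbm'
  rw [isEquivalent_hillVec_iff hV hp hm] at ap₁ ap₂
  rw [isEquivalent_hillVec_iff hV.reflect hp hm] at am₁ am₂
  have eP := hB.wedge_eq_planeSol hq.pos (hp₁.isModeSol hV hp hm) (hp₂.isModeSol hV hp hm) ap₁ ap₂ xs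
  have eR := hB'.wedge_eq_planeSol hq.pos (hm₁.reflect.isModeSol hV.reflect hp hm)
    (hm₂.reflect.isModeSol hV.reflect hp hm) am₁ am₂ (-xs)
  have sp : ∀ v : ℝ → Fin 4 → ℂ, v xs = ofModes V d zp zm (toModes V d zp zm v) xs := fun v => by
    rw [ofModes_toModes hV hp hm]
  have sm : ∀ v : ℝ → Fin 4 → ℂ, v xs = reflectVec (ofModes (fun x => V (-x)) d zp zm
      (toModes (fun x => V (-x)) d zp zm (reflectVec v))) xs := fun v => by
    rw [ofModes_toModes hV.reflect hp hm, reflectVec_reflectVec]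
  unfold coupledEvans
  simp only [← eP, ← eR]
  rw [sp vp₁, sp vp₂, sm vm₁, sm vm₂]
  simp only [wedgeCoord]
  generalize toModes V d zp zm vp₁ = a
  generalize toModes V d zp zm vp₂ = b
  generalize toModes (fun x => V (-x)) d zp zm (reflectVec vm₁) = a'
  generalize toModes (fun x => V (-x)) d zp zm (reflectVec vm₂) = b'
  -- Reflection interchanges the decaying and the growing mode of each Hill equation, permuting the
  -- indices `0, 2` and `1, 3`.
  have hr : ∀ e : ℝ → Fin 4 → ℂ, reflectVec (ofModes (fun x => V (-x)) d zp zm e) xs =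
      ofModes V d zp zm (fun _ => ![e (-xs) 2, e (-xs) 3, e (-xs) 0, e (-xs) 1]) xs := fun e => by
    funext i
    fin_cases i <;> simp [reflectVec, ofModes, weylMinus, weylMinus'] <;> ring
  rw [hr, hr]
  refine (det_columns ![a' (-xs) 2, a' (-xs) 3, a' (-xs) 0, a' (-xs) 1]
    ![b' (-xs) 2, b' (-xs) 3, b' (-xs) 0, b' (-xs) 1] (a xs) (b xs) (weylSol V d zp xs)
    (weylSol' V d zp xs) (weylMinus V d zp xs) (weylMinus' V d zp xs) (weylSol V d zm xs)
    (weylSol' V d zm xs) (weylMinus V d zm xs) (weylMinus' V d zm xs)).trans ?_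
  rw [weylWronskian_eq hV hp, weylWronskian_eq hV hm]
  congr 1
  have n1 := weylSol_ne_zero hV hp xs
  have n2 := weylSol_ne_zero hV hm xs
  have n3 := weylMinus_ne_zero hV hp xs
  have n4 := weylMinus_ne_zero hV hm xs
  have w : ∀ z, weylSol (fun x => V (-x)) d z (-xs) = weylMinus V d z xs := fun _ => rfl
  simp [modeRatio, hillMode, weylMinus_reflect, w]
  field_simp

theorem muPlus_im (μ : ℝ) (lam : ℂ) : (muPlus μ lam).im = lam.re := by simp [muPlus]

theorem muMinus_im (μ : ℝ) (lam : ℂ) : (muMinus μ lam).im = -lam.re := by simp [muMinus]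

theorem IsGapSoliton.isCoupling {Γp Γm μ : ℝ} {φ : ℝ → ℝ} (h : IsGapSoliton V Γp Γm μ φ) :
    ∃ β Q, IsCoupling (fun x => interfaceCoeff Γp Γm x * φ x ^ 2) β Q := by
  obtain ⟨C, α, hα, hC⟩ := h.localized
  have hφ := h.contDiff.continuous
  refine ⟨2 * α, (|Γp| + |Γm|) * C ^ 2, by positivity, ?_, fun x hx => ?_, fun x => ?_⟩
  · refine Measurable.mul ?_ (hφ.pow 2).measurable
    exact Measurable.ite measurableSet_Ici measurable_const measurable_const
  · refine ContinuousAt.mul ?_ (hφ.pow 2).continuousAt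
    rcases lt_or_gt_of_ne hx with h | h
    · refine (continuousAt_const (y := Γm)).congr ?_
      filter_upwards [Iio_mem_nhds h] with y hy
      rw [interfaceCoeff, if_neg (not_le.2 hy)]
    · refine (continuousAt_const (y := Γp)).congr ?_
      filter_upwards [Ioi_mem_nhds h] with y hy
      rw [interfaceCoeff, if_pos (le_of_lt hy)]
  · have h1 : |interfaceCoeff Γp Γm x| ≤ |Γp| + |Γm| := by
      unfold interfaceCoeff
      split_ifs
      · linarith [abs_nonneg Γm]
      · linarith [abs_nonneg Γp]
    have h2 : |φ x| ^ 2 ≤ C ^ 2 * Real.exp (-(2 * α * |x|)) := by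
      calc |φ x| ^ 2 ≤ (C * Real.exp (-(α * |x|))) ^ 2 := by gcongr; exact hC x
        _ = C ^ 2 * Real.exp (-(2 * α * |x|)) := by
          rw [mul_pow, ← Real.exp_nat_mul]; congr 2; push_cast; ring
    rw [abs_mul, abs_pow, mul_assoc]
    gcongr

/-- The forward direction is independence of all choices, including `k` and the four solutions; the
backward direction is existence. The solutions at `-∞` come from those at `+∞` of the reflected
system. -/
theorem isEvansValue_iff {Γp Γm μ : ℝ} {φ : ℝ → ℝ} (hV : IsHillPotential V d)
    (hφ : IsGapSoliton V Γp Γm μ φ) {lam : ℂ} (hl : 0 < lam.re) (xs : ℝ) (z : ℂ) :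
    IsEvansValue V d Γp Γm μ φ xs lam z ↔
      z = coupledEvans V (fun x => interfaceCoeff Γp Γm x * φ x ^ 2) d xs (muPlus μ lam)
        (muMinus μ lam) := by
  obtain ⟨β, Q, hq⟩ := hφ.isCoupling
  have hp : (muPlus μ lam).im ≠ 0 := by rw [muPlus_im]; exact hl.ne'
  have hm : (muMinus μ lam).im ≠ 0 := by rw [muMinus_im]; exact (neg_neg_of_pos hl).ne
  constructor
  · rintro ⟨kp, km, ψp₁, ψp₂, ψm₁, ψm₂, vm₁, vm₂, vp₁, vp₂, hkp, hkm, bp₁, bp₂, bm₁, bm₂, sm₁, sm₂,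
      sp₁, sp₂, am₁, am₂, ap₁, ap₂, rfl⟩
    obtain ⟨rfl, ep₁⟩ := bp₁.eq_weylSol hV hp hkp
    obtain ⟨rfl, ep₂⟩ := bp₂.eq_weylMinus hV hp hkp
    obtain ⟨rfl, em₁⟩ := bm₁.eq_weylSol hV hm hkm
    obtain ⟨rfl, em₂⟩ := bm₂.eq_weylMinus hV hm hkm
    rw [ep₂, ← reflectVec_hillVec_zero (zm := muMinus μ lam)] at am₁
    rw [em₂, ← reflectVec_hillVec_one (zp := muPlus μ lam)] at am₂
    rw [ep₁, ← hillVec_zero (zm := muMinus μ lam)] at ap₁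
    rw [em₁, ← hillVec_one (zp := muPlus μ lam)] at ap₂
    have am₁' := reflectVec_isEquivalent am₁ tendsto_neg_atTop_atBot
    have am₂' := reflectVec_isEquivalent am₂ tendsto_neg_atTop_atBot
    rw [reflectVec_reflectVec] at am₁' am₂'
    exact det_eq_coupledEvans hV hq hp hm sm₁ sm₂ sp₁ sp₂ am₁' am₂' ap₁ ap₂ xs
  · rintro rfl
    obtain ⟨kp, hkp, bp₁, bp₂⟩ := exists_isBlochWave hV hp
    obtain ⟨km, hkm, bm₁, bm₂⟩ := exists_isBlochWave hV hm
    obtain ⟨vp₁, sp₁, ap₁⟩ := exists_isCoupledSol_isEquivalent hV hq hp hm 0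
    obtain ⟨vp₂, sp₂, ap₂⟩ := exists_isCoupledSol_isEquivalent hV hq hp hm 1
    obtain ⟨w₁, t₁, b₁⟩ := exists_isCoupledSol_isEquivalent hV.reflect hq.reflect hp hm 0
    obtain ⟨w₂, t₂, b₂⟩ := exists_isCoupledSol_isEquivalent hV.reflect hq.reflect hp hm 1
    have sm₁ := t₁.reflect
    have sm₂ := t₂.reflect
    simp only [neg_neg] at sm₁ sm₂
    have am₁ := reflectVec_isEquivalent b₁ tendsto_neg_atBot_atTop
    have am₂ := reflectVec_isEquivalent b₂ tendsto_neg_atBot_atTop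
    have hdet := det_eq_coupledEvans hV hq hp hm sm₁ sm₂ sp₁ sp₂
      (by rwa [reflectVec_reflectVec]) (by rwa [reflectVec_reflectVec]) ap₁ ap₂ xs
    rw [reflectVec_hillVec_zero] at am₁
    rw [reflectVec_hillVec_one] at am₂
    rw [hillVec_zero] at ap₁
    rw [hillVec_one] at ap₂
    refine ⟨kp, km, _, _, _, _, _, _, _, _, hkp, hkm, bp₁, bp₂, bm₁, bm₂, sm₁, sm₂, sp₁, sp₂, ?_, ?_,
      ?_, ?_, hdet.symm⟩
    · rwa [(isHillSol_weylMinus hV hp).deriv_eq]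
    · rwa [(isHillSol_weylMinus hV hm).deriv_eq]
    · rwa [(isWeylSol_weylSol hV hp).hill.deriv_eq]
    · rwa [(isWeylSol_weylSol hV hm).hill.deriv_eq]

theorem evans_eq {Γp Γm μ : ℝ} {φ : ℝ → ℝ} (hV : IsHillPotential V d)
    (hφ : IsGapSoliton V Γp Γm μ φ) {lam : ℂ} (hl : 0 < lam.re) (xs : ℝ) :
    evans V d Γp Γm μ φ xs lam =
      coupledEvans V (fun x => interfaceCoeff Γp Γm x * φ x ^ 2) d xs (muPlus μ lam)
        (muMinus μ lam) :=
  (isEvansValue_iff hV hφ hl xs _).1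
    (Classical.epsilon_spec ⟨_, (isEvansValue_iff hV hφ hl xs _).2 rfl⟩)

end Evans

/-! ### Analyticity of the Evans function. -/

section EvansAnalytic

open Set

variable {V q : ℝ → ℝ} {d β Q : ℝ}

/-- Around each `λ` one neighbourhood `U` carries common constants for `μ₊` and `μ₋`, so a single
contractive majorant makes the Neumann series holomorphic. -/
theorem differentiableAt_planeSol_hillMode (hV : IsHillPotential V d) (hq : IsCoupling q β Q)
    (μ : ℝ) {lam : ℂ} (hl : 0 < lam.re) (X : ℝ) (p : Fin 4 × Fin 4) :
    DifferentiableAt ℂ (fun w => planeSol (hillMode V d (muPlus μ w) (muMinus μ w))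
      (hillCoupling V q d (muPlus μ w) (muMinus μ w)) X X p) lam := by
  have him : ∀ w : ℂ, 0 < w.re → (muPlus μ w).im ≠ 0 ∧ (muMinus μ w).im ≠ 0 := fun w hw =>
    ⟨by rw [muPlus_im]; exact hw.ne', by rw [muMinus_im]; exact (neg_neg_of_pos hw).ne⟩
  have hdp : ∀ w, DifferentiableAt ℂ (muPlus μ) w := fun w => by unfold muPlus; fun_prop
  have hdm : ∀ w, DifferentiableAt ℂ (muMinus μ) w := fun w => by unfold muMinus; fun_prop
  obtain ⟨c, g, h⟩ := eventually_hillBound hV (him lam hl).1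
  obtain ⟨c', g', h'⟩ := eventually_hillBound hV (him lam hl).2
  obtain ⟨U, hU, hUo, hlU⟩ := eventually_nhds_iff.1
    (((hdp lam).continuousAt.eventually h).and (((hdm lam).continuousAt.eventually h').and
      (Complex.continuous_re.continuousAt.eventually (lt_mem_nhds hl))))
  have hpU : ∀ w ∈ U, 0 < w.re := fun w hw => (hU w hw).2.2
  have dS : ∀ w ∈ U, ∀ x, DifferentiableAt ℂ (fun w => weylSol V d (muPlus μ w) x) w ∧
      DifferentiableAt ℂ (fun w => weylSol V d (muMinus μ w) x) w := fun w hw x =>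
    ⟨(differentiableAt_weylSol hV (him w (hpU w hw)).1 x).comp w (hdp w),
      (differentiableAt_weylSol hV (him w (hpU w hw)).2 x).comp w (hdm w)⟩
  have dM : ∀ w ∈ U, ∀ x, DifferentiableAt ℂ (fun w => weylMinus V d (muPlus μ w) x) w ∧
      DifferentiableAt ℂ (fun w => weylMinus V d (muMinus μ w) x) w := fun w hw x =>
    ⟨(differentiableAt_weylMinus hV (him w (hpU w hw)).1 x).comp w (hdp w),
      (differentiableAt_weylMinus hV (him w (hpU w hw)).2 x).comp w (hdm w)⟩
  have dG : ∀ w ∈ U, ∀ x, DifferentiableAt ℂ (fun w => greenDiag V d (muPlus μ w) x) w ∧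
      DifferentiableAt ℂ (fun w => greenDiag V d (muMinus μ w) x) w := fun w hw x =>
    ⟨((dS w hw x).1.mul (dM w hw x).1).div
        ((differentiableAt_weylWronskian hV (him w (hpU w hw)).1).comp w (hdp w))
        (weylWronskian_ne_zero hV (him w (hpU w hw)).1),
      ((dS w hw x).2.mul (dM w hw x).2).div
        ((differentiableAt_weylWronskian hV (him w (hpU w hw)).2).comp w (hdm w))
        (weylWronskian_ne_zero hV (him w (hpU w hw)).2)⟩
  refine (differentiableOn_planeSol hUo hq.pos (fun w hw => modeBound_hillMode hV hq
    (him w (hpU w hw)).1 (him w (hpU w hw)).2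
    ((hU w hw).1.mono (le_max_left c c') (le_max_left g g'))
    ((hU w hw).2.1.mono (le_max_right c c') (le_max_right g g'))) (fun i x w hw => ?_)
    (fun i l x w hw => ?_) X p).differentiableAt (hUo.mem_nhds hlU)
  · refine DifferentiableAt.differentiableWithinAt ?_
    fin_cases i
    · exact (dS w hw x).1
    · exact (dS w hw x).2
    · exact (dM w hw x).1
    · exact (dM w hw x).2
  · refine DifferentiableAt.differentiableWithinAt ?_
    refine DifferentiableAt.mul_const (DifferentiableAt.mul_const ?_ _) _
    fin_cases i
    · exact (dG w hw x).1
    · exact (dG w hw x).2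
    · exact (dG w hw x).1.neg
    · exact (dG w hw x).2.neg

theorem differentiableAt_coupledEvans (hV : IsHillPotential V d) (hq : IsCoupling q β Q)
    (μ xs : ℝ) {lam : ℂ} (hl : 0 < lam.re) :
    DifferentiableAt ℂ (fun w => coupledEvans V q d xs (muPlus μ w) (muMinus μ w)) lam := by
  have hp : (muPlus μ lam).im ≠ 0 := by rw [muPlus_im]; exact hl.ne'
  have hm : (muMinus μ lam).im ≠ 0 := by rw [muMinus_im]; exact (neg_neg_of_pos hl).ne
  have hdp : DifferentiableAt ℂ (muPlus μ) lam := by unfold muPlus; fun_prop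
  have hdm : DifferentiableAt ℂ (muMinus μ) lam := by unfold muMinus; fun_prop
  have h1 : DifferentiableAt ℂ (fun w => weylWronskian V d (muPlus μ w)) lam :=
    (differentiableAt_weylWronskian hV hp).comp lam hdp
  have h2 : DifferentiableAt ℂ (fun w => weylWronskian V d (muMinus μ w)) lam :=
    (differentiableAt_weylWronskian hV hm).comp lam hdm
  have P := differentiableAt_planeSol_hillMode hV hq μ hl xs
  have R := differentiableAt_planeSol_hillMode hV.reflect hq.reflect μ hl (-xs)
  exact (h1.mul h2).neg.mul (((((((R (2, 3)).mul (P (2, 3))).sub ((R (2, 0)).mul (P (1, 3)))).add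
    ((R (2, 1)).mul (P (1, 2)))).add ((R (3, 0)).mul (P (0, 3)))).sub
    ((R (3, 1)).mul (P (0, 2)))).add ((R (0, 1)).mul (P (0, 1))))

/-! ### Asymptotics at infinity in a half-plane. -/

/-- The filter of points tending to infinity in a half-plane `Re λ ≥ δ`. -/
noncomputable abbrev halfPlaneAtInfty (δ : ℝ) : Filter ℂ :=
  Bornology.cobounded ℂ ⊓ 𝓟 {lam : ℂ | δ ≤ lam.re}

theorem exists_sq_eq_im_pos {z : ℂ} (hz : z.im ≠ 0) : ∃ k : ℂ, k ^ 2 = z ∧ 0 < k.im := by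
  obtain ⟨k, hk⟩ := IsAlgClosed.exists_pow_nat_eq z (n := 2) two_pos
  have hki : k.im ≠ 0 := fun h => hz (by rw [← hk, sq, Complex.mul_im, h]; ring)
  rcases lt_or_gt_of_ne hki with h | h
  · exact ⟨-k, by rw [neg_sq, hk], by simpa using h⟩
  · exact ⟨k, hk, h⟩

/-- The square root with positive imaginary part of a non-real complex number. -/
noncomputable def upperSqrt (z : ℂ) : ℂ :=
  if h : z.im ≠ 0 then (exists_sq_eq_im_pos h).choose else 0

theorem upperSqrt_spec {z : ℂ} (hz : z.im ≠ 0) : upperSqrt z ^ 2 = z ∧ 0 < (upperSqrt z).im := by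
  rw [upperSqrt, dif_pos hz]
  exact (exists_sq_eq_im_pos hz).choose_spec

variable {δ μ : ℝ}

theorem eventually_le_re (δ : ℝ) : ∀ᶠ lam in halfPlaneAtInfty δ, δ ≤ lam.re :=
  mem_inf_of_right (mem_principal_self _)

theorem tendsto_norm_upperSqrt {f : ℂ → ℂ} {l : Filter ℂ} (hf : ∀ᶠ w in l, (f w).im ≠ 0)
    (h : Tendsto (fun w => ‖f w‖) l atTop) : Tendsto (fun w => ‖upperSqrt (f w)‖) l atTop := by
  have h1 : Tendsto (fun w => √‖f w‖) l atTop := Real.tendsto_sqrt_atTop.comp h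
  refine h1.congr' ?_
  filter_upwards [hf] with w hw
  conv_lhs => rw [← (upperSqrt_spec hw).1]
  rw [norm_pow, Real.sqrt_sq (norm_nonneg _)]

theorem tendsto_norm_halfPlane (δ : ℝ) :
    Tendsto (fun lam : ℂ => ‖lam‖) (halfPlaneAtInfty δ) atTop :=
  tendsto_norm_cobounded_atTop.mono_left inf_le_left

theorem tendsto_norm_muPlus : Tendsto (fun lam => ‖muPlus μ lam‖) (halfPlaneAtInfty δ) atTop := by
  refine tendsto_atTop_mono (fun lam => ?_) (tendsto_atTop_add_const_right _ (-|μ|)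
    (tendsto_norm_halfPlane δ))
  have h := norm_sub_le (muPlus μ lam) μ
  rw [show muPlus μ lam - μ = Complex.I * lam by unfold muPlus; ring, norm_mul, Complex.norm_I,
    one_mul, Complex.norm_real, Real.norm_eq_abs] at h
  linarith

theorem tendsto_norm_muMinus : Tendsto (fun lam => ‖muMinus μ lam‖) (halfPlaneAtInfty δ) atTop := by
  refine tendsto_atTop_mono (fun lam => ?_) (tendsto_atTop_add_const_right _ (-|μ|)
    (tendsto_norm_halfPlane δ))
  have h := norm_sub_le (muMinus μ lam) μ
  rw [show muMinus μ lam - μ = -(Complex.I * lam) by unfold muMinus; ring, norm_neg, norm_mul,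
    Complex.norm_I, one_mul, Complex.norm_real, Real.norm_eq_abs] at h
  linarith

/-- The product `-k₊ k₋` has square `λ² + μ²`. Since `k₊` lies in the first quadrant and `k₋` in the
second, its real part is positive. So the factor `-k₊ k₋ + λ` of `μ²` has modulus at least `δ`, and
the other factor `-k₊ k₋ - λ` stays bounded. -/
theorem tendsto_upperSqrt_mul (hδ : 0 < δ) :
    Tendsto (fun lam => -(upperSqrt (muPlus μ lam) * upperSqrt (muMinus μ lam)) / lam)
      (halfPlaneAtInfty δ) (𝓝 1) := by
  rw [← tendsto_sub_nhds_zero_iff]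
  have h1 : Tendsto (fun lam : ℂ => μ ^ 2 / δ * ‖lam‖⁻¹) (halfPlaneAtInfty δ) (𝓝 0) := by
    simpa using (tendsto_norm_halfPlane δ).inv_tendsto_atTop.const_mul (μ ^ 2 / δ)
  refine squeeze_zero_norm' ?_ h1
  filter_upwards [eventually_le_re δ] with lam hl
  have hl0 : 0 < lam.re := hδ.trans_le hl
  have hlne : lam ≠ 0 := fun h => by simp [h] at hl0
  obtain ⟨ep, ip⟩ := upperSqrt_spec (z := muPlus μ lam) (by rw [muPlus_im]; exact hl0.ne')
  obtain ⟨em, im⟩ := upperSqrt_spec (z := muMinus μ lam)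
    (by rw [muMinus_im]; exact (neg_neg_of_pos hl0).ne)
  set a := upperSqrt (muPlus μ lam)
  set b := upperSqrt (muMinus μ lam)
  have ha : 0 < a.re := by
    have := congrArg Complex.im ep
    rw [muPlus_im, sq, Complex.mul_im] at this
    by_contra! h
    nlinarith
  have hb : b.re < 0 := by
    have := congrArg Complex.im em
    rw [muMinus_im, sq, Complex.mul_im] at this
    by_contra! h
    nlinarith
  have hw : 0 < (-(a * b)).re := by
    rw [Complex.neg_re, Complex.mul_re]
    nlinarith [mul_pos ha (neg_pos.2 hb), mul_pos ip im]
  have hprod : (-(a * b) - lam) * (-(a * b) + lam) = (μ : ℂ) ^ 2 := by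
    have : a ^ 2 * b ^ 2 = μ ^ 2 + lam ^ 2 := by
      rw [ep, em]; unfold muPlus muMinus
      linear_combination -lam ^ 2 * Complex.I_sq
    linear_combination this
  have hge : δ ≤ ‖-(a * b) + lam‖ := by
    refine le_trans ?_ (Complex.re_le_norm _)
    rw [Complex.add_re]; linarith
  have hsub : ‖-(a * b) - lam‖ ≤ μ ^ 2 / δ := by
    rw [le_div_iff₀ hδ]
    have := congrArg norm hprod
    rw [norm_mul, norm_pow, Complex.norm_real, Real.norm_eq_abs, sq_abs] at this
    rw [← this]
    gcongr
  rw [div_sub_one hlne, norm_div, div_eq_mul_inv]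
  gcongr

theorem tendsto_weylWronskian_div (hV : IsHillPotential V d) (hδ : 0 < δ) {f : ℂ → ℂ}
    {l : Filter ℂ} (hf : ∀ᶠ w in l, δ ≤ |(f w).im|) (h : Tendsto (fun w => ‖f w‖) l atTop) :
    Tendsto (fun w => weylWronskian V d (f w) / (-2 * Complex.I * upperSqrt (f w))) l (𝓝 1) := by
  have hf' : ∀ᶠ w in l, (f w).im ≠ 0 := by
    filter_upwards [hf] with w hw
    exact abs_pos.1 (hδ.trans_le hw)
  rw [Metric.tendsto_nhds]
  intro ε hε
  obtain ⟨K, hK⟩ := exists_hillBound_large hV hδ (ε := min (ε / 2) (1 / 2)) (by positivity)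
    (min_le_right _ _)
  filter_upwards [hf, hf', (tendsto_norm_upperSqrt hf' h).eventually_ge_atTop K] with w h1 h2 h3
  obtain ⟨h4, h5⟩ := upperSqrt_spec h2
  rw [dist_eq_norm]
  exact ((hK _ _ h4 h5 h1 h3).2.trans (min_le_left _ _)).trans_lt (half_lt_self hε)

/-- The growth constant `(3 exp d)⁴` is fixed, while the coupling is `2 G Q` with `G` the sum of the
two bounds `1/|k_±|` on the Green functions, which tends to zero. -/
theorem tendsto_planeSol_hillMode (hV : IsHillPotential V d) (hq : IsCoupling q β Q)
    (hδ : 0 < δ) (μ X : ℝ) (p : Fin 4 × Fin 4) :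
    Tendsto (fun w => planeSol (hillMode V d (muPlus μ w) (muMinus μ w))
      (hillCoupling V q d (muPlus μ w) (muMinus μ w)) X X p) (halfPlaneAtInfty δ)
      (𝓝 (planeLimit p)) := by
  have hp : ∀ᶠ w in halfPlaneAtInfty δ, δ ≤ |(muPlus μ w).im| ∧ (muPlus μ w).im ≠ 0 := by
    filter_upwards [eventually_le_re δ] with w hw
    rw [muPlus_im]
    exact ⟨hw.trans (le_abs_self _), (hδ.trans_le hw).ne'⟩
  have hm : ∀ᶠ w in halfPlaneAtInfty δ, δ ≤ |(muMinus μ w).im| ∧ (muMinus μ w).im ≠ 0 := by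
    filter_upwards [eventually_le_re δ] with w hw
    rw [muMinus_im, abs_neg]
    exact ⟨hw.trans (le_abs_self _), (neg_neg_of_pos (hδ.trans_le hw)).ne⟩
  have tp := tendsto_norm_upperSqrt (hp.mono fun _ h => h.2) (tendsto_norm_muPlus (μ := μ))
  have tm := tendsto_norm_upperSqrt (hm.mono fun _ h => h.2) (tendsto_norm_muMinus (μ := μ))
  obtain ⟨K, hK⟩ := exists_hillBound_large hV hδ (ε := 1 / 2) (by norm_num) le_rfl
  set G : ℂ → ℝ := fun w => 1 / ‖upperSqrt (muPlus μ w)‖ + 1 / ‖upperSqrt (muMinus μ w)‖ with hG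
  have hG0 : Tendsto G (halfPlaneAtInfty δ) (𝓝 0) := by
    have := tp.inv_tendsto_atTop.add tm.inv_tendsto_atTop
    simpa [hG] using this
  set C : ℝ := (3 * Real.exp d) ^ 4 with hC
  have hF : Continuous fun g : ℝ => 64 * C * (2 * g * Q) * planeWeight β C (2 * g * Q) X := by
    unfold planeWeight; fun_prop
  have hlim := (hF.tendsto 0).comp hG0
  simp only [mul_zero, zero_mul] at hlim
  rw [← tendsto_sub_nhds_zero_iff]
  refine squeeze_zero_norm' ?_ hlim
  filter_upwards [hp, hm, tp.eventually_ge_atTop K, tm.eventually_ge_atTop K] with w h1 h2 h3 h4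
  obtain ⟨h5, h6⟩ := upperSqrt_spec h1.2
  obtain ⟨h7, h8⟩ := upperSqrt_spec h2.2
  have hbp := (hK _ _ h5 h6 h1.1 h3).1.mono le_rfl (le_add_of_nonneg_right (by positivity) :
    1 / ‖upperSqrt (muPlus μ w)‖ ≤ G w)
  have hbm := (hK _ _ h7 h8 h2.1 h4).1.mono le_rfl (le_add_of_nonneg_left (by positivity) :
    1 / ‖upperSqrt (muMinus μ w)‖ ≤ G w)
  exact (modeBound_hillMode hV hq h1.2 h2.2 hbp hbm).norm_planeSol_sub_le hq.pos X p

theorem tendsto_coupledEvans_div (hV : IsHillPotential V d) (hq : IsCoupling q β Q)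
    (hδ : 0 < δ) (μ xs : ℝ) :
    Tendsto (fun w => coupledEvans V q d xs (muPlus μ w) (muMinus μ w) / (-4 * w))
      (halfPlaneAtInfty δ) (𝓝 1) := by
  have P := tendsto_planeSol_hillMode hV hq hδ μ xs
  have R := tendsto_planeSol_hillMode hV.reflect hq.reflect hδ μ (-xs)
  have W1 := tendsto_weylWronskian_div hV hδ (f := muPlus μ) (l := halfPlaneAtInfty δ) (by
    filter_upwards [eventually_le_re δ] with w hw
    rw [muPlus_im]
    exact hw.trans (le_abs_self _)) tendsto_norm_muPlus
  have W2 := tendsto_weylWronskian_div hV hδ (f := muMinus μ) (l := halfPlaneAtInfty δ) (by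
    filter_upwards [eventually_le_re δ] with w hw
    rw [muMinus_im, abs_neg]
    exact hw.trans (le_abs_self _)) tendsto_norm_muMinus
  have hlim := (((W1.mul W2).mul (tendsto_upperSqrt_mul (μ := μ) hδ))).mul
    (((((((R (2, 3)).mul (P (2, 3))).sub ((R (2, 0)).mul (P (1, 3)))).add
    ((R (2, 1)).mul (P (1, 2)))).add ((R (3, 0)).mul (P (0, 3)))).sub
    ((R (3, 1)).mul (P (0, 2)))).add ((R (0, 1)).mul (P (0, 1))))
  -- Of the six Laplace terms only the `(0, 1)` one survives: in the limit the planes are spanned by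
  -- the decaying modes of each end.
  have h1 : (1 * 1 * 1 * (planeLimit (2, 3) * planeLimit (2, 3) -
      planeLimit (2, 0) * planeLimit (1, 3) + planeLimit (2, 1) * planeLimit (1, 2) +
      planeLimit (3, 0) * planeLimit (0, 3) - planeLimit (3, 1) * planeLimit (0, 2) +
      planeLimit (0, 1) * planeLimit (0, 1))) = 1 := by
    simp [planeLimit]
  rw [h1] at hlim
  refine hlim.congr' ?_
  filter_upwards [eventually_le_re δ] with w hw
  have hl0 : 0 < w.re := hδ.trans_le hw
  have hwne : w ≠ 0 := fun h => by simp [h] at hl0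
  obtain ⟨-, ip⟩ := upperSqrt_spec (z := muPlus μ w) (by rw [muPlus_im]; exact hl0.ne')
  obtain ⟨-, im⟩ := upperSqrt_spec (z := muMinus μ w)
    (by rw [muMinus_im]; exact (neg_neg_of_pos hl0).ne)
  have n1 : upperSqrt (muPlus μ w) ≠ 0 := fun h => by simp [h] at ip
  have n2 : upperSqrt (muMinus μ w) ≠ 0 := fun h => by simp [h] at im
  have hI : Complex.I ≠ 0 := Complex.I_ne_zero
  unfold coupledEvans
  refine Eq.trans ?_ (mul_div_right_comm _ _ _).symm
  congr 1
  generalize weylWronskian V d (muPlus μ w) = a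
  generalize weylWronskian V d (muMinus μ w) = b
  have hI2 : Complex.I ^ 2 = -1 := Complex.I_sq
  field_simp
  rw [hI2]
  ring

end EvansAnalytic

/-! ### The main statement. -/

theorem tendsto_evans_div {V φ : ℝ → ℝ} {d Γp Γm μ δ : ℝ} (hV : IsHillPotential V d)
    (hφ : IsGapSoliton V Γp Γm μ φ) (xs : ℝ) (hδ : 0 < δ) :
    Tendsto (fun lam => evans V d Γp Γm μ φ xs lam / (-4 * lam)) (halfPlaneAtInfty δ) (𝓝 1) := by
  obtain ⟨β, Q, hq⟩ := hφ.isCoupling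
  refine (tendsto_coupledEvans_div hV hq hδ μ xs).congr' ?_
  filter_upwards [eventually_le_re δ] with lam hl
  rw [evans_eq hV hφ (hδ.trans_le hl)]

/-- The Evans function is well defined for `Re λ > 0`, its renormalization is analytic there,
and `E(λ) → 1`, `𝓔(λ) ~ -4 λ` as `|λ| → ∞` in every half-plane `Re λ ≥ δ > 0` (hence along
every ray, and uniformly in every closed sector, inside the open right half-plane). -/
theorem lemma4 (V : ℝ → ℝ) (d : ℝ) (hd : 0 < d) (hVcont : Continuous V)
    (hVper : Function.Periodic V d) (Γp Γm μ : ℝ) (φ : ℝ → ℝ)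
    (hφ : IsGapSoliton V Γp Γm μ φ) (xs : ℝ) :
    (∀ lam : ℂ, 0 < lam.re → ∃! z : ℂ, IsEvansValue V d Γp Γm μ φ xs lam z) ∧
    AnalyticOnNhd ℂ (renormEvans V d Γp Γm μ φ xs) {lam : ℂ | 0 < lam.re} ∧
    (∀ δ : ℝ, 0 < δ →
      Tendsto (renormEvans V d Γp Γm μ φ xs)
        (Bornology.cobounded ℂ ⊓ 𝓟 {lam : ℂ | δ ≤ lam.re}) (𝓝 1)) ∧
    (∀ δ : ℝ, 0 < δ →
      evans V d Γp Γm μ φ xs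
        ~[Bornology.cobounded ℂ ⊓ 𝓟 {lam : ℂ | δ ≤ lam.re}] (fun lam : ℂ => -4 * lam)) := by
  have hV : IsHillPotential V d := ⟨hd, hVcont, hVper⟩
  refine ⟨fun lam hl => ⟨_, (isEvansValue_iff hV hφ hl xs _).2 rfl,
    fun z hz => (isEvansValue_iff hV hφ hl xs z).1 hz⟩, ?_, fun δ hδ => ?_, fun δ hδ => ?_⟩
  · obtain ⟨β, Q, hq⟩ := hφ.isCoupling
    refine DifferentiableOn.analyticOnNhd (fun lam hl => ?_)
      (isOpen_lt continuous_const Complex.continuous_re)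
    have hne : 4 * lam + 1 ≠ 0 := fun h => by
      have h1 := congrArg Complex.re h
      have h2 : 0 < lam.re := hl
      simp at h1
      linarith
    have h1 : DifferentiableAt ℂ (fun w : ℂ => -1 / (4 * w + 1)) lam :=
      (differentiableAt_const _).div (by fun_prop) hne
    -- The function `evans` is defined by a choice; on the half-plane it agrees with the explicit
    -- analytic expression `coupledEvans`.
    refine DifferentiableWithinAt.congr
      (h1.mul (differentiableAt_coupledEvans hV hq μ xs hl)).differentiableWithinAt
      (fun w hw => ?_) ?_
    · exact congrArg _ (evans_eq hV hφ hw xs)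
    · exact congrArg _ (evans_eq hV hφ hl xs)
  · have h1 := tendsto_evans_div hV hφ xs hδ
    -- The factor `(4 λ + 1)/(4 λ)` relates the renormalization to the quotient by `-4 λ`, and it
    -- tends to one.
    have h2 : Tendsto (fun lam : ℂ => 1 + 4⁻¹ * lam⁻¹) (halfPlaneAtInfty δ) (𝓝 (1 + 4⁻¹ * 0)) :=
      ((tendsto_inv₀_cobounded.mono_left inf_le_left).const_mul _).const_add _
    have h3 := h1.mul (h2.inv₀ (by simp))
    simp only [mul_zero, add_zero, inv_one, mul_one] at h3
    refine h3.congr' ?_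
    filter_upwards [eventually_le_re δ] with lam hl
    have hl0 : 0 < lam.re := hδ.trans_le hl
    have hne0 : lam ≠ 0 := fun h => by simp [h] at hl0
    have hne : 4 * lam + 1 ≠ 0 := fun h => by
      have h1 := congrArg Complex.re h
      simp at h1
      linarith
    have h4 : 1 + 4⁻¹ * lam⁻¹ = (4 * lam + 1) / (4 * lam) := by field_simp
    rw [h4, renormEvans]
    field_simp
  · refine (isEquivalent_iff_tendsto_one ?_).2 (tendsto_evans_div hV hφ xs hδ)
    filter_upwards [eventually_le_re δ] with lam hl
    have hl0 : 0 < lam.re := hδ.trans_le hl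
    have hne0 : lam ≠ 0 := fun h => by simp [h] at hl0
    simpa using hne0
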